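/- **Proposition 4.3.** Let $\omega\subset\mathbb R^2$ be a bounded open set with Lipschitz boundary (for instance piecewise $C^1$), and let $u_0\in L^1(\partial\omega,\mathcal H^1)$. Consider the minimum problem $$\mathcal P_{1,0}=\min\Big\{|Du|(\omega)+\int_{\partial\omega}|u-u_0|\,d\mathcal H^1:\ u\in BV(\omega)\Big\},$$ where $|Du|$ is the total variation measure of the vector measure $Du$ and, on $\partial\omega$, $u$ stands for its trace, i.e. for $\mathcal H^1$-a.e. $x\in\partial\omega$ the number $u(x)$ such that the mean value of $|u(\cdot)-u(x)|$ over $\omega\cap B_r(x)$ tends to $0$ as $r\to0^+$; and the dual problem $$\mathcal D_0=\sup\Big\{-\int_{\partial\omega}(\sigma\cdot\nu)\,u_0\,d\mathcal H^1:\ \sigma\in L^\infty(\omega;\mathbb R^3),\ \operatorname{div}\sigma=0,\ |\sigma|\le1\text{ a.e. in }\omega\Big\}.$$ Here the fields $\sigma$ depend on the planar variables only, so that $\operatorname{div}\sigma=\partial_1\sigma_1+\partial_2\sigma_2$ (in the sense of distributions in $\omega$), and $\sigma\cdot\nabla\varphi=\sigma_1\partial_1\varphi+\sigma_2\partial_2\varphi$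 for functions $\varphi$ on the plane. The normal trace $\sigma\cdot\nu\in L^\infty(\partial\omega)$, with $\nu$ the outer unit normal, is the function determined by $\int_\omega\sigma\cdot\nabla\varphi\,dx=\int_{\partial\omega}(\sigma\cdot\nu)\varphi\,d\mathcal H^1$ for all $\varphi\in C_c^\infty(\mathbb R^2)$. For $u \in BV(\omega)$ and such $\sigma$, $\sigma\cdot Du$ denotes the signed measure on $\omega$ that represents the distribution $\varphi\mapsto-\int_\omega(\sigma\cdot\nabla\varphi)\,u\,dx$, $\varphi\in C_c^\infty(\omega)$. Let $u\in BV(\omega)$ and $\sigma\in L^\infty(\omega;\mathbb R^3)$ with $\operatorname{div}\sigma=0$ and $|\sigma|\le1$ a.e. in $\omega$. Then $u$ is a minimizer for $\mathcal P_{1,0}$ and $\sigma$ is a maximizer for $\mathcal D_0$ if and only if both $$-\sigma\cdot Du=|Du|\quad\text{as measures on }\omega$$ and $$\sigma\cdot\nu=\frac{u-u_0}{|u-u_0|}\quad\mathcal H^1\text{-a.e. on }\partial\omega\cap\{u\neq u_0\}.$$ -/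

import Mathlib

open MeasureTheory Set Filter Topology
open scoped ENNReal

namespace LeastGradient

/-- The Euclidean plane, in which the cross section `ω` lives. -/
abbrev Plane := EuclideanSpace ℝ (Fin 2)

/-- Euclidean three-space, in which the fields `σ` take their values. -/
abbrev Space := EuclideanSpace ℝ (Fin 3)

/-- The planar part `(s₁, s₂)` of a vector `s = (s₁, s₂, s₃)`. -/
noncomputable def planar (s : Space) : Plane := !₂[s 0, s 1]

/-- `φ ∈ 𝒟(U)`: `φ` is smooth with compact support contained in `U`. -/
structure IsTestFunction (U : Set Plane) (φ : Plane → ℝ) : Prop where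
  smooth : ContDiff ℝ (⊤ : ℕ∞) φ
  compactSupport : HasCompactSupport φ
  tsupport_subset : tsupport φ ⊆ U

/-- `ω` has Lipschitz boundary: near each of its boundary points, and in suitable orthonormal
coordinates, `ω` is the set of points strictly above the graph of a Lipschitz function. -/
def HasLipschitzBoundary (ω : Set Plane) : Prop :=
  ∀ x ∈ frontier ω, ∃ r > 0, ∃ e : Plane ≃ₗᵢ[ℝ] Plane, ∃ K : NNReal, ∃ γ : ℝ → ℝ,
    LipschitzWith K γ ∧ ∀ y ∈ Metric.ball x r, (y ∈ ω ↔ γ (e y 0) < e y 1)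

/-- The arc length measure `ℋ¹` on `∂ω`. -/
noncomputable def boundaryMeasure (ω : Set Plane) : Measure Plane :=
  (μH[1]).restrict (frontier ω)

/-! ### Functions of bounded variation -/

/-- `μ` is a vector measure of finite total variation, carried by `ω`, which is the
distributional gradient of `u` in `ω`. -/
structure IsGradientMeasure (ω : Set Plane) (u : Plane → ℝ) (μ : VectorMeasure Plane Plane) :
    Prop where
  finite : μ.variation univ < ∞
  carried : ∀ B, MeasurableSet B → Disjoint B ω → μ B = 0
  integral_eq : ∀ φ, IsTestFunction ω φ →
    ∫ x in ω, u x • gradient φ x = - ∫ᵛ x, φ x ∂•μ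

/-- `u ∈ BV(ω)`. Only the values of `u` in `ω` matter. -/
def IsBV (ω : Set Plane) (u : Plane → ℝ) : Prop :=
  IntegrableOn u ω ∧ ∃ μ, IsGradientMeasure ω u μ

open Classical in
/-- The measure `Du` of a function `u ∈ BV(ω)`; the total variation measure `|Du|` is
`(gradientMeasure ω u).variation`. -/
noncomputable def gradientMeasure (ω : Set Plane) (u : Plane → ℝ) : VectorMeasure Plane Plane :=
  if h : ∃ μ, IsGradientMeasure ω u μ then h.choose else 0

/-- `t` is the one-sided approximate limit of `u` at the boundary point `x`, taken from `ω`. -/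
def IsTraceAt (ω : Set Plane) (u : Plane → ℝ) (x : Plane) (t : ℝ) : Prop :=
  Tendsto (fun r : ℝ => ⨍ y in ω ∩ Metric.ball x r, |u y - t|) (𝓝[>] 0) (𝓝 0)

open Classical in
/-- The trace of `u` on `∂ω`. -/
noncomputable def trace (ω : Set Plane) (u : Plane → ℝ) (x : Plane) : ℝ :=
  if h : ∃ t, IsTraceAt ω u x t then h.choose else 0

/-! ### Divergence-free fields -/

/-- `div σ = 0` in the sense of distributions in `ω`, where `σ` depends only on the planar
variables, so that `div σ = ∂₁σ₁ + ∂₂σ₂`. -/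
def IsDivFree (ω : Set Plane) (σ : Plane → Space) : Prop :=
  ∀ φ, IsTestFunction ω φ → ∫ x in ω, inner ℝ (planar (σ x)) (gradient φ x) = 0

/-- The fields `σ ∈ L^∞(ω; ℝ³)` with `div σ = 0` and `|σ| ≤ 1` almost everywhere in `ω`. -/
structure IsAdmissible (ω : Set Plane) (σ : Plane → Space) : Prop where
  memLp : MemLp σ ∞ (volume.restrict ω)
  divFree : IsDivFree ω σ
  norm_le_one : ∀ᵐ x ∂volume.restrict ω, ‖σ x‖ ≤ 1

/-- `s ∈ L^∞(∂ω)` is the (weak) normal trace `σ · ν` of the divergence-free field `σ`, `ν` being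
the outer unit normal: Green's formula holds for all `φ ∈ 𝒟(ℝ²)`. -/
structure IsNormalTrace (ω : Set Plane) (σ : Plane → Space) (s : Plane → ℝ) : Prop where
  memLp : MemLp s ∞ (boundaryMeasure ω)
  green : ∀ φ, IsTestFunction univ φ →
    ∫ x in ω, inner ℝ (planar (σ x)) (gradient φ x) = ∫ x, s x * φ x ∂boundaryMeasure ω

open Classical in
/-- The normal trace `σ · ν` on `∂ω` of a bounded divergence-free field `σ`. -/
noncomputable def normalTrace (ω : Set Plane) (σ : Plane → Space) : Plane → ℝ :=
  if h : ∃ s, IsNormalTrace ω σ s then h.choose else 0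

/-- The distribution `σ · Du` in `ω`, for a divergence-free field `σ`. -/
noncomputable def pairing (ω : Set Plane) (σ : Plane → Space) (u φ : Plane → ℝ) : ℝ :=
  - ∫ x in ω, inner ℝ (planar (σ x)) (gradient φ x) * u x

/-- `m` is a signed measure that represents the distribution `σ · Du` in `ω`. -/
def IsPairingMeasure (ω : Set Plane) (σ : Plane → Space) (u : Plane → ℝ)
    (m : SignedMeasure Plane) : Prop :=
  ∀ φ, IsTestFunction ω φ → pairing ω σ u φ = ∫ᵛ x, φ x ∂•m

open Classical in
/-- The measure `σ · Du`; it is determined by `σ` and `u` on the Borel subsets of `ω`. -/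
noncomputable def pairingMeasure (ω : Set Plane) (σ : Plane → Space) (u : Plane → ℝ) :
    SignedMeasure Plane :=
  if h : ∃ m, IsPairingMeasure ω σ u m then h.choose else 0

/-! ### The two variational problems -/

/-- The functional `|Du|(ω) + ∫_{∂ω} |u - u₀| dℋ¹` of the problem `𝒫_{1,0}`. -/
noncomputable def primal (ω : Set Plane) (u₀ u : Plane → ℝ) : ℝ≥0∞ :=
  (gradientMeasure ω u).variation ω + ∫⁻ x, ‖trace ω u x - u₀ x‖ₑ ∂boundaryMeasure ω

/-- The functional `-∫_{∂ω} (σ · ν) u₀ dℋ¹` of the dual problem `𝒟₀`. -/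
noncomputable def dual (ω : Set Plane) (u₀ : Plane → ℝ) (σ : Plane → Space) : ℝ :=
  - ∫ x, normalTrace ω σ x * u₀ x ∂boundaryMeasure ω

/-- `u` is extremal for `𝒫_{1,0}`: it minimizes the functional over `BV(ω)`. -/
def IsExtremalPrimal (ω : Set Plane) (u₀ u : Plane → ℝ) : Prop :=
  IsBV ω u ∧ ∀ v, IsBV ω v → primal ω u₀ u ≤ primal ω u₀ v

/-- `σ` is extremal for `𝒟₀`: it maximizes the functional over the admissible fields. -/
def IsExtremalDual (ω : Set Plane) (u₀ : Plane → ℝ) (σ : Plane → Space) : Prop :=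
  IsAdmissible ω σ ∧ ∀ τ, IsAdmissible ω τ → dual ω u₀ τ ≤ dual ω u₀ σ

end LeastGradient

/-!
For `u ∈ BV(ω)` and an admissible field `σ`, the duality gap is

`P(u) - D(σ) = ∫_ω (1 + h) d|Du| + ∫_{∂ω} (|u - u₀| - (σ · ν) (u - u₀)) dℋ¹`,

where `σ · Du = h |Du|` (`exists_gap_eq`). Since `|h| ≤ 1` and `|σ · ν| ≤ 1`, both integrands are
nonnegative. Hence `D(σ) ≤ P(u)`, and equality holds if and only if both integrands vanish almost
everywhere, which is what the two optimality conditions say (`dual_eq_primalValue_iff`). It remains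
to see that the minimum of `P`, if attained, is a value of `D` (`exists_isAdmissible_dual_eq`). This
is the Hahn-Banach theorem: if `P ≥ m ≥ 0` on smooth functions, then the linear form `(φ, c) ↦ m c`
is dominated by the `L¹` norms of `∇φ` in `ω` and of `φ - c u₀` on `∂ω`, hence is represented by
bounded densities (`exists_density_pair`), and these are a divergence-free field and its normal
trace. Only the values of `P` on smooth functions are needed here, so no approximation theorem for
functions of bounded variation enters.

The formula for the gap is Green's formula, `(σ · Du)(ω) = ∫_{∂ω} (σ · ν) u dℋ¹`, together with the
bounds on the densities. The ingredients are the following.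

* `|σ · Du| ≤ |Du|` (`IsUnitField.abs_integral_inner_gradient_mul_le`): mollification of `σ` keeps
  the bound and, locally in `ω`, the vanishing of the divergence.
* Traces: near a boundary point, `ω` lies above a Lipschitz graph. The variation of `u` along
  vertical segments is controlled by `|Du|` (`lintegral_translate_sub_le`), so the averages of `u`
  over short vertical segments converge in `L¹` (`GraphChart.exists_graphTrace`). The limit is a
  one-sided approximate limit almost everywhere, because `|Du|` has mass `o(r)` in rectangles of
  size `r` over almost every point of the graph (`GraphChart.exists_isTraceAt`).
* `|σ · ν| ≤ 1` (`IsUnitField.integral_inner_gradient_le`): near the graph, `σ` is tested with a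
  cutoff whose level sets are translates of a `C¹` approximation of the graph. The flux is then at
  most the integral of `√(1 + γ'²) |φ|`, which is at most the integral of `|φ|` over the boundary by
  one half of the area formula (`GraphChart.lintegral_speed_mul_le`).
* Green's formula (`IsUnitField.setIntegral_density_eq`): `σ · Du` is tested with cutoffs `η`. The
  error made in replacing `u` by a smooth `φ` is `∫ |∇η| |u - φ|`, which is controlled by the
  distance of the traces of `u` and `φ` in `L¹(∂ω)`, and smooth functions are dense there.
-/

namespace LeastGradient

/-! ### Densities of dominated linear forms -/

/-- `(L¹)' = L^∞` for functions with values in a Hilbert space and a finite measure, in norm `1`.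
The density comes from the Riesz representation theorem in `L²`, which is contained in `L¹`. -/
theorem exists_density_of_linearMap_L1 {X H : Type*} [MeasurableSpace X] {μ : Measure X}
    [IsFiniteMeasure μ] [NormedAddCommGroup H] [InnerProductSpace ℝ H] [CompleteSpace H]
    (F : Lp H 1 μ →ₗ[ℝ] ℝ) (hF : ∀ f, F f ≤ ‖f‖) :
    ∃ g : X → H, StronglyMeasurable g ∧ (∀ x, ‖g x‖ ≤ 1) ∧
      ∀ f (hf : Integrable f μ), F (hf.toL1 f) = ∫ x, inner ℝ (g x) (f x) ∂μ := by
  have hF' : ∀ f, ‖F f‖ ≤ ‖f‖ := fun f => by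
    rw [Real.norm_eq_abs]
    refine abs_le.2 ⟨?_, hF f⟩
    have := hF (-f)
    rw [map_neg, norm_neg] at this
    linarith
  let F₁ : Lp H 1 μ →L[ℝ] ℝ := F.mkContinuous 1 (by simpa using hF')
  have hle : Lp H 2 μ ≤ Lp H 1 μ := Lp.antitone (by norm_num)
  let ι : Lp H 2 μ →ₗ[ℝ] Lp H 1 μ :=
    { toFun := fun f => ⟨f.1, hle f.2⟩, map_add' := fun _ _ => rfl, map_smul' := fun _ _ => rfl }
  obtain ⟨C, hC⟩ : ∃ C : ℝ, ∀ f : Lp H 2 μ, ‖ι f‖ ≤ C * ‖f‖ := by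
    refine ⟨(μ univ ^ (1 / (1 : ℝ≥0∞).toReal - 1 / (2 : ℝ≥0∞).toReal)).toReal, fun f => ?_⟩
    have h := eLpNorm_le_eLpNorm_mul_rpow_measure_univ (μ := μ) (p := 1) (q := 2) (by norm_num)
      (Lp.aestronglyMeasurable f)
    rw [Lp.norm_def, Lp.norm_def, mul_comm, ← ENNReal.toReal_mul]
    refine ENNReal.toReal_mono ?_ h
    refine ENNReal.mul_ne_top (Lp.eLpNorm_ne_top f) ?_
    exact ENNReal.rpow_ne_top_of_nonneg (by norm_num) (measure_ne_top _ _)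
  let F₂ : Lp H 2 μ →L[ℝ] ℝ := F₁ ∘L (ι.mkContinuous C hC)
  obtain ⟨G, hG⟩ := (InnerProductSpace.toDual ℝ (Lp H 2 μ)).surjective F₂
  have key : ∀ f (hf : MemLp f 2 μ), F ((hf.integrable (by norm_num)).toL1 f)
      = ∫ x, inner ℝ (G x) (f x) ∂μ := by
    intro f hf
    have h1 : F₂ (hf.toLp f) = F ((hf.integrable (by norm_num)).toL1 f) := rfl
    rw [← h1, ← hG, InnerProductSpace.toDual_apply_apply, L2.inner_def]
    refine integral_congr_ae ?_
    filter_upwards [hf.coeFn_toLp] with x hx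
    rw [hx]
  have hGm := Lp.stronglyMeasurable G
  have hGi : Integrable G μ := (Lp.memLp G).integrable (by norm_num)
  set B : Set X := {x | 1 < ‖G x‖} with hB
  have hBm : MeasurableSet B := measurableSet_lt measurable_const hGm.norm.measurable
  -- Testing with the unit vectors `G / |G|` on `{|G| > 1}` shows that this set is negligible.
  have hB0 : μ B = 0 := by
    let f : X → H := B.indicator fun x => ‖G x‖⁻¹ • G x
    have hfm : StronglyMeasurable f :=
      ((hGm.norm.measurable.inv.stronglyMeasurable).smul hGm).indicator hBm
    have hf1 : ∀ x, ‖f x‖ = B.indicator (fun _ => (1 : ℝ)) x := by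
      intro x
      by_cases hx : x ∈ B
      · have : (0 : ℝ) < ‖G x‖ := lt_trans one_pos hx
        simp [f, hx, norm_smul, inv_mul_cancel₀ this.ne']
      · simp [f, hx]
    have hf : MemLp f 2 μ := MemLp.of_bound hfm.aestronglyMeasurable 1 (Eventually.of_forall
      fun x => by rw [hf1]; exact indicator_le_self' (by simp) x)
    have h := key f hf
    have h2 := hF ((hf.integrable (by norm_num)).toL1 f)
    rw [h, L1.norm_of_fun_eq_integral_norm] at h2
    have h3 : ∀ x, inner ℝ (G x) (f x) = B.indicator (fun x => ‖G x‖) x := by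
      intro x
      by_cases hx : x ∈ B
      · have : (0 : ℝ) < ‖G x‖ := lt_trans one_pos hx
        simp only [f, hx, indicator_of_mem, inner_smul_right, real_inner_self_eq_norm_sq]
        field_simp
      · simp [f, hx]
    simp_rw [h3, hf1] at h2
    rw [integral_indicator hBm, integral_indicator hBm] at h2
    have h4 : ∫ x in B, (‖G x‖ - 1) ∂μ ≤ 0 := by
      rw [integral_sub hGi.norm.integrableOn (by simp)]; linarith
    have h5 : 0 ≤ᵐ[μ.restrict B] fun x => ‖G x‖ - 1 := by
      filter_upwards [ae_restrict_mem hBm] with x hx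
      exact sub_nonneg.2 (le_of_lt hx)
    have h6 := (integral_eq_zero_iff_of_nonneg_ae h5
      (hGi.norm.integrableOn.sub (by simp))).1 (le_antisymm h4 (integral_nonneg_of_ae h5))
    rw [← Measure.restrict_eq_zero, ← ae_eq_bot]
    by_contra hne
    have : (ae (μ.restrict B)).NeBot := ⟨hne⟩
    obtain ⟨x, hx, hx'⟩ := ((ae_restrict_mem hBm).and h6).exists
    have : ‖G x‖ - 1 = 0 := hx'
    have : 1 < ‖G x‖ := hx
    linarith
  refine ⟨Bᶜ.indicator G, hGm.indicator hBm.compl, fun x => ?_, ?_⟩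
  · by_cases hx : x ∈ B
    · simp [hx]
    · rw [indicator_of_mem (mem_compl hx)]
      exact not_lt.1 hx
  have hgG : ∀ᵐ x ∂μ, Bᶜ.indicator G x = G x := by
    have : ∀ᵐ x ∂μ, x ∈ Bᶜ := (compl_mem_ae_iff.2 hB0)
    filter_upwards [this] with x hx using by simp only [hx, indicator_of_mem]
  have hgm : StronglyMeasurable (Bᶜ.indicator G) := hGm.indicator hBm.compl
  have hg1 : ∀ x, ‖Bᶜ.indicator G x‖ ≤ 1 := by
    intro x
    by_cases hx : x ∈ B
    · simp [hx]
    · rw [indicator_of_mem (mem_compl hx)]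
      exact not_lt.1 hx
  have hint : ∀ {f : X → H}, Integrable f μ →
      Integrable (fun x => inner ℝ (Bᶜ.indicator G x) (f x)) μ := by
    intro f hf
    refine hf.norm.mono' (hgm.aestronglyMeasurable.inner hf.1) (Eventually.of_forall fun x => ?_)
    calc ‖inner ℝ (Bᶜ.indicator G x) (f x)‖ ≤ ‖Bᶜ.indicator G x‖ * ‖f x‖ := norm_inner_le_norm _ _
      _ ≤ 1 * ‖f x‖ := by gcongr; exact hg1 x
      _ = ‖f x‖ := one_mul _
  set g := Bᶜ.indicator G with hg
  -- Both functionals are continuous on `L¹` and agree on indicators, hence on all of `L¹`.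
  let Φ : Lp H 1 μ →L[ℝ] ℝ := LinearMap.mkContinuous
    { toFun := fun f => ∫ x, inner ℝ (g x) (f x) ∂μ
      map_add' := fun f f' => by
        rw [← integral_add (hint (L1.integrable_coeFn f)) (hint (L1.integrable_coeFn f'))]
        refine integral_congr_ae ?_
        filter_upwards [Lp.coeFn_add f f'] with x hx
        rw [hx, Pi.add_apply, inner_add_right]
      map_smul' := fun c f => by
        rw [RingHom.id_apply, smul_eq_mul, ← integral_const_mul]
        refine integral_congr_ae ?_
        filter_upwards [Lp.coeFn_smul c f] with x hx
        rw [hx, Pi.smul_apply, inner_smul_right] } 1 (fun f => by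
        rw [one_mul, L1.norm_eq_integral_norm]
        refine norm_integral_le_of_norm_le (L1.integrable_coeFn f).norm (Eventually.of_forall
          fun x => ?_)
        calc ‖inner ℝ (g x) (f x)‖ ≤ ‖g x‖ * ‖f x‖ := norm_inner_le_norm _ _
          _ ≤ 1 * ‖f x‖ := by gcongr; exact hg1 x
          _ = ‖f x‖ := one_mul _)
  have hΦ : ∀ f (hf : Integrable f μ), Φ (hf.toL1 f) = ∫ x, inner ℝ (g x) (f x) ∂μ := by
    intro f hf
    refine integral_congr_ae ?_
    filter_upwards [hf.coeFn_toL1] with x hx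
    rw [hx]
  have hEq : F₁ = Φ := by
    refine ContinuousLinearMap.ext fun f => ?_
    refine Lp.induction (p := 1) (by norm_num) (motive := fun f : Lp H 1 μ => F₁ f = Φ f) ?_ ?_ ?_ f
    · intro c s hs hμs
      have hm : MemLp (s.indicator fun _ => c) 2 μ := memLp_indicator_const 2 hs c (Or.inr hμs.ne)
      have e : (Lp.simpleFunc.indicatorConst 1 hs hμs.ne c : Lp H 1 μ)
          = (hm.integrable (by norm_num)).toL1 (s.indicator fun _ => c) := by
        rw [Lp.simpleFunc.coe_indicatorConst]; rfl
      rw [e, hΦ]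
      refine (key _ hm).trans (integral_congr_ae ?_)
      filter_upwards [hgG] with x hx
      rw [hx]
    · intro f f' hf hf' _ h1 h2
      rw [map_add, map_add, h1, h2]
    · exact isClosed_eq F₁.continuous Φ.continuous
  intro f hf
  rw [← hΦ f hf, ← hEq]; rfl

/-- A linear form on `V` controlled by the `L¹` norms of two families of functions depending
linearly on `v : V` is represented by densities bounded by `1` (Hahn-Banach and `(L¹)' = L^∞`). -/
theorem exists_density_pair {V X₁ X₂ H₁ H₂ : Type*} [AddCommGroup V] [Module ℝ V]
    [MeasurableSpace X₁] [MeasurableSpace X₂] {μ₁ : Measure X₁} {μ₂ : Measure X₂}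
    [IsFiniteMeasure μ₁] [IsFiniteMeasure μ₂]
    [NormedAddCommGroup H₁] [InnerProductSpace ℝ H₁] [CompleteSpace H₁]
    [NormedAddCommGroup H₂] [InnerProductSpace ℝ H₂] [CompleteSpace H₂]
    (A : V →ₗ[ℝ] X₁ → H₁) (B : V →ₗ[ℝ] X₂ → H₂)
    (hA : ∀ v, Integrable (A v) μ₁) (hB : ∀ v, Integrable (B v) μ₂) (L : V →ₗ[ℝ] ℝ)
    (hL : ∀ v, L v ≤ ∫ x, ‖A v x‖ ∂μ₁ + ∫ x, ‖B v x‖ ∂μ₂) :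
    ∃ (g : X₁ → H₁) (h : X₂ → H₂), StronglyMeasurable g ∧ (∀ x, ‖g x‖ ≤ 1) ∧
      StronglyMeasurable h ∧ (∀ x, ‖h x‖ ≤ 1) ∧
      ∀ v, L v = ∫ x, inner ℝ (g x) (A v x) ∂μ₁ + ∫ x, inner ℝ (h x) (B v x) ∂μ₂ := by
  let A' : V →ₗ[ℝ] Lp H₁ 1 μ₁ :=
    { toFun := fun v => (hA v).toL1 _
      map_add' := fun v w => by
        rw [← Integrable.toL1_add]; congr 1; exact map_add A v w
      map_smul' := fun c v => by
        rw [RingHom.id_apply, ← Integrable.toL1_smul]; congr 1; exact map_smul A c v }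
  let B' : V →ₗ[ℝ] Lp H₂ 1 μ₂ :=
    { toFun := fun v => (hB v).toL1 _
      map_add' := fun v w => by
        rw [← Integrable.toL1_add]; congr 1; exact map_add B v w
      map_smul' := fun c v => by
        rw [RingHom.id_apply, ← Integrable.toL1_smul]; congr 1; exact map_smul B c v }
  -- On `V × L¹ × L¹`, the form `(v, 0) ↦ L v` is dominated by `N`. The extension `F` vanishes at
  -- `(v, -A v, -B v)`, where `N` is zero, so `L v = F (0, A v, B v)`.
  let N : V × (Lp H₁ 1 μ₁ × Lp H₂ 1 μ₂) → ℝ := fun p => ‖A' p.1 + p.2.1‖ + ‖B' p.1 + p.2.2‖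
  let f : (V × (Lp H₁ 1 μ₁ × Lp H₂ 1 μ₂)) →ₗ.[ℝ] ℝ :=
    ⟨LinearMap.ker (LinearMap.snd ℝ V (Lp H₁ 1 μ₁ × Lp H₂ 1 μ₂)),
      L ∘ₗ (LinearMap.fst ℝ V (Lp H₁ 1 μ₁ × Lp H₂ 1 μ₂)) ∘ₗ Submodule.subtype _⟩
  obtain ⟨F, hFf, hFN⟩ := exists_extension_of_le_sublinear f N
    (fun c hc p => by
      simp only [N, Prod.smul_fst, Prod.smul_snd, map_smul, ← smul_add, norm_smul,
        Real.norm_eq_abs, abs_of_pos hc]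
      ring)
    (fun p q => by
      simp only [N, Prod.fst_add, Prod.snd_add, map_add]
      rw [add_add_add_comm (A' p.1), add_add_add_comm (B' p.1)]
      linarith [norm_add_le (A' p.1 + p.2.1) (A' q.1 + q.2.1),
        norm_add_le (B' p.1 + p.2.2) (B' q.1 + q.2.2)])
    (fun p => by
      obtain ⟨⟨v, e⟩, he⟩ := p
      obtain rfl : e = 0 := he
      simp only [N, Prod.fst_zero, Prod.snd_zero, add_zero]
      have : ‖A' v‖ = ∫ x, ‖A v x‖ ∂μ₁ := L1.norm_of_fun_eq_integral_norm (hA v)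
      have : ‖B' v‖ = ∫ x, ‖B v x‖ ∂μ₂ := L1.norm_of_fun_eq_integral_norm (hB v)
      have := hL v
      show L v ≤ _
      linarith)
  have hF0 : ∀ v, F (v, 0) = L v := fun v => hFf ⟨(v, 0), rfl⟩
  have hFA : ∀ v, F (v, (-A' v, -B' v)) = 0 := by
    have h1 : ∀ v, F (v, (-A' v, -B' v)) ≤ 0 := fun v => (hFN _).trans (by simp [N])
    intro v
    refine le_antisymm (h1 v) ?_
    have := h1 (-v)
    have e : ((-v, (-A' (-v), -B' (-v))) : V × (Lp H₁ 1 μ₁ × Lp H₂ 1 μ₂))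
      = -(v, (-A' v, -B' v)) := by simp
    rw [e, map_neg] at this
    linarith
  have hLF : ∀ v, L v = F (0, (A' v, 0)) + F (0, (0, B' v)) := by
    intro v
    have e : ((v, 0) : V × (Lp H₁ 1 μ₁ × Lp H₂ 1 μ₂))
      = (v, (-A' v, -B' v)) + ((0, (A' v, 0)) + (0, (0, B' v))) := by simp [← Prod.zero_eq_mk]
    rw [← hF0, e, map_add, hFA, zero_add, map_add]
  obtain ⟨g, hgm, hg1, hg⟩ := exists_density_of_linearMap_L1
    (F ∘ₗ LinearMap.inr ℝ V _ ∘ₗ LinearMap.inl ℝ (Lp H₁ 1 μ₁) (Lp H₂ 1 μ₂))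
    (fun e => (hFN _).trans (by simp [N]))
  obtain ⟨h, hhm, hh1, hh⟩ := exists_density_of_linearMap_L1
    (F ∘ₗ LinearMap.inr ℝ V _ ∘ₗ LinearMap.inr ℝ (Lp H₁ 1 μ₁) (Lp H₂ 1 μ₂))
    (fun e => (hFN _).trans (by simp [N]))
  refine ⟨g, h, hgm, hg1, hhm, hh1, fun v => ?_⟩
  rw [hLF, ← hg _ (hA v), ← hh _ (hB v)]
  rfl

/-- The case of a single family of functions in `exists_density_pair`. -/
theorem exists_density {V X H : Type*} [AddCommGroup V] [Module ℝ V]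
    [MeasurableSpace X] {μ : Measure X} [IsFiniteMeasure μ]
    [NormedAddCommGroup H] [InnerProductSpace ℝ H] [CompleteSpace H]
    (A : V →ₗ[ℝ] X → H) (hA : ∀ v, Integrable (A v) μ) (L : V →ₗ[ℝ] ℝ)
    (hL : ∀ v, L v ≤ ∫ x, ‖A v x‖ ∂μ) :
    ∃ g : X → H, StronglyMeasurable g ∧ (∀ x, ‖g x‖ ≤ 1) ∧
      ∀ v, L v = ∫ x, inner ℝ (g x) (A v x) ∂μ := by
  obtain ⟨g, _, hgm, hg1, _, _, hg⟩ := exists_density_pair (μ₂ := (0 : Measure Unit)) (H₂ := ℝ)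
    A 0 hA (by simp) L (by simpa using hL)
  exact ⟨g, hgm, hg1, by simpa using hg⟩

/-! ### Vector measures of finite variation -/

section Polar

variable {X H : Type*} [MeasurableSpace X] [NormedAddCommGroup H] [InnerProductSpace ℝ H]
  [CompleteSpace H]

/-- Polar decomposition of a vector measure `μ` of finite variation: `μ = g |μ|` with `|g| ≤ 1`. -/
theorem exists_polar (μ : VectorMeasure X H) [IsFiniteMeasure μ.variation] :
    ∃ g : X → H, StronglyMeasurable g ∧ (∀ x, ‖g x‖ ≤ 1) ∧
      (∀ f : X → ℝ, Integrable f μ.variation → ∫ᵛ x, f x ∂•μ = ∫ x, f x • g x ∂μ.variation) ∧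
      ∀ B, MeasurableSet B → μ B = ∫ x in B, g x ∂μ.variation := by
  let F : Lp H 1 μ.variation →ₗ[ℝ] ℝ :=
    { toFun := fun f => ∫ᵛ x, f x ∂[innerSL ℝ; μ]
      map_add' := fun f f' => by
        rw [← VectorMeasure.integral_add (L1.integrable_coeFn f) (L1.integrable_coeFn f')]
        exact VectorMeasure.integral_congr_ae (Lp.coeFn_add f f')
      map_smul' := fun c f => by
        rw [RingHom.id_apply, ← VectorMeasure.integral_smul]
        exact VectorMeasure.integral_congr_ae (Lp.coeFn_smul c f) }
  obtain ⟨g, hgm, hg1, hg⟩ := exists_density_of_linearMap_L1 F (fun f => by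
    refine (Real.le_norm_self _).trans ?_
    refine (VectorMeasure.norm_integral_le_integral_norm).trans ?_
    rw [L1.norm_eq_integral_norm]
    refine mul_le_of_le_one_left (integral_nonneg fun _ => norm_nonneg _) ?_
    exact norm_innerSL_le _)
  have hF : ∀ f (hf : Integrable f μ.variation),
      ∫ᵛ x, f x ∂[innerSL ℝ; μ] = ∫ x, inner ℝ (g x) (f x) ∂μ.variation := fun f hf => by
    rw [← hg f hf]
    exact VectorMeasure.integral_congr_ae hf.coeFn_toL1.symm
  have hgi : Integrable g μ.variation :=
    Integrable.of_bound hgm.aestronglyMeasurable 1 (Eventually.of_forall hg1)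
  have key : ∀ f : X → ℝ, Integrable f μ.variation →
      ∫ᵛ x, f x ∂•μ = ∫ x, f x • g x ∂μ.variation := by
    intro f hf
    have hfg : Integrable (fun x => f x • g x) μ.variation := by
      refine hf.norm.mono' (hf.1.smul hgm.aestronglyMeasurable) (Eventually.of_forall fun x => ?_)
      rw [norm_smul]
      exact mul_le_of_le_one_right (norm_nonneg _) (hg1 x)
    refine ext_inner_left ℝ fun v => ?_
    rw [← integral_inner hfg]
    have h1 := VectorMeasure.continuousLinearMap_apply_integral
      (B := ContinuousLinearMap.lsmul ℝ ℝ) (μ := μ) (C := innerSL ℝ v) hf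
    rw [innerSL_apply_apply] at h1
    rw [h1]
    have h2 := VectorMeasure.integral_continuousLinearMap_comp (B := innerSL ℝ) (μ := μ)
      (C := ContinuousLinearMap.toSpanSingleton ℝ v) hf
    have h3 : ((ContinuousLinearMap.compL ℝ H H ℝ (innerSL ℝ v)) ∘L
        (ContinuousLinearMap.lsmul ℝ ℝ)) =
        (innerSL ℝ : H →L[ℝ] H →L[ℝ] ℝ) ∘L ContinuousLinearMap.toSpanSingleton ℝ v := by
      ext x
      simp
      rfl
    rw [h3, ← h2, hF _ ((ContinuousLinearMap.toSpanSingleton ℝ v).integrable_comp hf)]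
    refine integral_congr_ae (Eventually.of_forall fun x => ?_)
    simp [inner_smul_right, real_inner_comm]
  refine ⟨g, hgm, hg1, key, fun B hB => ?_⟩
  have h := key (B.indicator fun _ => 1) ((integrable_const 1).indicator hB)
  rw [VectorMeasure.integral_indicator_const _ hB] at h
  rw [← integral_indicator hB]
  simp only [ContinuousLinearMap.lsmul_apply, one_smul] at h
  rw [h]
  refine integral_congr_ae (Eventually.of_forall fun x => ?_)
  by_cases hx : x ∈ B <;> simp [hx]

theorem isFiniteMeasure_variation_withDensityᵥ {ν : Measure X} {g : X → H} (hg : Integrable g ν) :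
    IsFiniteMeasure (ν.withDensityᵥ g).variation := by
  rw [Measure.variation_withDensityᵥ hg]
  exact isFiniteMeasure_withDensity hg.2.ne

/-- Integration against a vector measure with density. The polar density `h` of `g ν` satisfies
`|g| h = g`, because both have the same integrals over measurable sets. -/
theorem integral_withDensityᵥ {ν : Measure X} {g : X → H} (hg : Integrable g ν)
    {f : X → ℝ} (hf : Integrable f (ν.withDensityᵥ g).variation) :
    ∫ᵛ x, f x ∂•(ν.withDensityᵥ g) = ∫ x, f x • g x ∂ν := by
  have := isFiniteMeasure_variation_withDensityᵥ hg
  obtain ⟨h, hhm, hh1, h2, h3⟩ := exists_polar (ν.withDensityᵥ g)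
  have hv := Measure.variation_withDensityᵥ hg
  have hm : AEMeasurable (fun x => ‖g x‖ₑ) ν := hg.1.enorm
  have hlt : ∀ᵐ x ∂ν, ‖g x‖ₑ < ∞ := Eventually.of_forall fun x => enorm_lt_top
  have hgh : Integrable (fun x => ‖g x‖ • h x) ν := by
    refine hg.norm.mono' (hg.1.norm.smul hhm.aestronglyMeasurable)
      (Eventually.of_forall fun x => ?_)
    rw [norm_smul, norm_norm]
    exact mul_le_of_le_one_right (norm_nonneg _) (hh1 x)
  have hae : (fun x => ‖g x‖ • h x) =ᵐ[ν] g := by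
    refine hgh.ae_eq_of_forall_setIntegral_eq _ _ hg fun s hs _ => ?_
    have := h3 s hs
    rw [withDensityᵥ_apply hg hs, hv, setIntegral_withDensity_eq_setIntegral_toReal_smul₀
      hm.restrict (ae_restrict_of_ae hlt) _ hs] at this
    simpa using this.symm
  rw [h2 f hf, hv, integral_withDensity_eq_integral_toReal_smul₀ hm hlt]
  refine integral_congr_ae ?_
  filter_upwards [hae] with x hx
  rw [toReal_enorm, smul_comm]
  exact congrArg _ hx

end Polar

/-! ### Test functions -/

theorem gradient_add' {f g : Plane → ℝ} {x : Plane} (hf : DifferentiableAt ℝ f x)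
    (hg : DifferentiableAt ℝ g x) : gradient (f + g) x = gradient f x + gradient g x := by
  refine ext_inner_right ℝ fun v => ?_
  rw [inner_add_left, inner_gradient_left, inner_gradient_left, inner_gradient_left,
    fderiv_add hf hg]
  rfl

theorem gradient_const_smul' {f : Plane → ℝ} {x : Plane} (hf : DifferentiableAt ℝ f x) (c : ℝ) :
    gradient (c • f) x = c • gradient f x := by
  refine ext_inner_right ℝ fun v => ?_
  rw [inner_smul_left, inner_gradient_left, inner_gradient_left, fderiv_const_smul hf]
  rfl

theorem gradient_mul' {f g : Plane → ℝ} {x : Plane} (hf : DifferentiableAt ℝ f x)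
    (hg : DifferentiableAt ℝ g x) :
    gradient (fun y => f y * g y) x = f x • gradient g x + g x • gradient f x := by
  refine ext_inner_right ℝ fun v => ?_
  rw [inner_add_left, inner_smul_left, inner_smul_left, inner_gradient_left, inner_gradient_left,
    inner_gradient_left, fderiv_fun_mul hf hg]
  simp

theorem norm_gradient (f : Plane → ℝ) (x : Plane) : ‖gradient f x‖ = ‖fderiv ℝ f x‖ := by
  rw [gradient, LinearIsometryEquiv.norm_map]

theorem _root_.ContDiff.continuous_gradient {f : Plane → ℝ} (hf : ContDiff ℝ 1 f) :
    Continuous (gradient f) :=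
  (InnerProductSpace.toDual ℝ Plane).symm.continuous.comp (hf.continuous_fderiv one_ne_zero)

theorem _root_.HasCompactSupport.gradient {f : Plane → ℝ} (hf : HasCompactSupport f) :
    HasCompactSupport (gradient f) :=
  (hf.fderiv ℝ).comp_left (g := (InnerProductSpace.toDual ℝ Plane).symm) (map_zero _)

theorem gradient_eq_zero_of_notMem_tsupport {f : Plane → ℝ} {x : Plane} (hx : x ∉ tsupport f) :
    gradient f x = 0 := by
  have : fderiv ℝ f x = 0 := by
    by_contra h
    exact hx (support_fderiv_subset ℝ h)
  rw [gradient, this, map_zero]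

namespace IsTestFunction

variable {U : Set Plane} {φ ψ : Plane → ℝ}

theorem contDiff_one (h : IsTestFunction U φ) : ContDiff ℝ 1 φ := h.smooth.of_le (by simp)

theorem differentiable (h : IsTestFunction U φ) : Differentiable ℝ φ :=
  h.contDiff_one.differentiable (by simp)

theorem continuous (h : IsTestFunction U φ) : Continuous φ := h.smooth.continuous

theorem continuous_gradient (h : IsTestFunction U φ) : Continuous (gradient φ) :=
  h.contDiff_one.continuous_gradient

theorem integrable (h : IsTestFunction U φ) {μ : Measure Plane} [IsFiniteMeasureOnCompacts μ] :
    Integrable φ μ := h.continuous.integrable_of_hasCompactSupport h.compactSupport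

theorem integrable_gradient (h : IsTestFunction U φ) {μ : Measure Plane}
    [IsFiniteMeasureOnCompacts μ] : Integrable (gradient φ) μ :=
  h.continuous_gradient.integrable_of_hasCompactSupport h.compactSupport.gradient

theorem exists_bound (h : IsTestFunction U φ) : ∃ C, ∀ x, ‖φ x‖ ≤ C :=
  h.compactSupport.exists_bound_of_continuous h.continuous

theorem exists_bound_gradient (h : IsTestFunction U φ) : ∃ C, ∀ x, ‖gradient φ x‖ ≤ C :=
  h.compactSupport.gradient.exists_bound_of_continuous h.continuous_gradient

theorem mono {V : Set Plane} (h : IsTestFunction U φ) (hUV : U ⊆ V) : IsTestFunction V φ :=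
  ⟨h.smooth, h.compactSupport, h.tsupport_subset.trans hUV⟩

theorem zero : IsTestFunction U 0 :=
  ⟨contDiff_const, HasCompactSupport.zero, by simp [tsupport]⟩

theorem add (h : IsTestFunction U φ) (h' : IsTestFunction U ψ) : IsTestFunction U (φ + ψ) :=
  ⟨h.smooth.add h'.smooth, h.compactSupport.add h'.compactSupport,
    (tsupport_add φ ψ).trans (union_subset h.tsupport_subset h'.tsupport_subset)⟩

theorem const_smul (h : IsTestFunction U φ) (c : ℝ) : IsTestFunction U (c • φ) :=
  ⟨h.smooth.const_smul c, h.compactSupport.smul_left (f := fun _ => c),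
    (tsupport_smul_subset_right (fun _ => c) φ).trans h.tsupport_subset⟩

theorem mul_left {f : Plane → ℝ} (h : IsTestFunction U φ) (hf : ContDiff ℝ (⊤ : ℕ∞) f) :
    IsTestFunction U (fun x => f x * φ x) :=
  ⟨hf.mul h.smooth, h.compactSupport.mul_left,
    (tsupport_mul_subset_right (f := f)).trans h.tsupport_subset⟩

theorem eq_zero_of_notMem (h : IsTestFunction U φ) {x : Plane} (hx : x ∉ U) : φ x = 0 :=
  image_eq_zero_of_notMem_tsupport fun h' => hx (h.tsupport_subset h')

theorem gradient_eq_zero_of_notMem (h : IsTestFunction U φ) {x : Plane} (hx : x ∉ U) :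
    gradient φ x = 0 :=
  gradient_eq_zero_of_notMem_tsupport fun h' => hx (h.tsupport_subset h')

theorem integrable_mul_gradient (h : IsTestFunction U φ) {f : Plane → ℝ} {μ : Measure Plane}
    (hf : Integrable f μ) : Integrable (fun x => f x • gradient φ x) μ := by
  obtain ⟨C, hC⟩ := h.exists_bound_gradient
  refine (hf.norm.mul_const C).mono' (hf.1.smul h.continuous_gradient.aestronglyMeasurable)
    (Eventually.of_forall fun x => ?_)
  rw [norm_smul]
  gcongr
  exact hC x

end IsTestFunction

/-- The space `𝒟(U)` of test functions. -/
def testSpace (U : Set Plane) : Submodule ℝ (Plane → ℝ) where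
  carrier := {φ | IsTestFunction U φ}
  add_mem' := fun h h' => h.add h'
  zero_mem' := IsTestFunction.zero
  smul_mem' := fun c _ h => h.const_smul c

/-- The gradient as a linear map on test functions. -/
noncomputable def gradientₗ (U : Set Plane) : testSpace U →ₗ[ℝ] Plane → Plane where
  toFun φ := gradient (φ : Plane → ℝ)
  map_add' φ ψ := funext fun x => gradient_add' (φ.2.differentiable x) (ψ.2.differentiable x)
  map_smul' c φ := funext fun x => gradient_const_smul' (φ.2.differentiable x) c

/-! ### Measures determined by test functions -/

section Unique

variable {H : Type*} [NormedAddCommGroup H]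

/-- On an open set, a vector measure of finite variation is determined by its integrals of test
functions. -/
theorem vectorMeasure_eq_on_of_forall_integral_eq [InnerProductSpace ℝ H] [CompleteSpace H]
    {U : Set Plane} (hU : IsOpen U)
    {μ₁ μ₂ : VectorMeasure Plane H} [IsFiniteMeasure μ₁.variation] [IsFiniteMeasure μ₂.variation]
    (h : ∀ φ, IsTestFunction U φ → ∫ᵛ x, φ x ∂•μ₁ = ∫ᵛ x, φ x ∂•μ₂)
    {B : Set Plane} (hB : MeasurableSet B) (hBU : B ⊆ U) : μ₁ B = μ₂ B := by
  have hfin : IsFiniteMeasure (μ₁ - μ₂).variation :=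
    isFiniteMeasure_of_le _ VectorMeasure.variation_sub_le
  obtain ⟨g, hgm, hg1, hg, hgB⟩ := exists_polar (μ₁ - μ₂)
  have hgi : Integrable g (μ₁ - μ₂).variation :=
    Integrable.of_bound hgm.aestronglyMeasurable 1 (Eventually.of_forall hg1)
  have h0 := hU.ae_eq_zero_of_integral_contDiff_smul_eq_zero
    (hgi.locallyIntegrable.locallyIntegrableOn U) (fun φ h1 h2 h3 => by
      have hφ : IsTestFunction U φ := ⟨h1, h2, h3⟩
      rw [← hg φ hφ.integrable,
        VectorMeasure.integral_sub_vectorMeasure hφ.integrable hφ.integrable, h φ hφ, sub_self])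
  have h1 : (μ₁ - μ₂) B = 0 := by
    rw [hgB B hB]
    refine integral_eq_zero_of_ae ?_
    rw [EventuallyEq, ae_restrict_iff' hB]
    filter_upwards [h0] with x hx hxB using hx (hBU hxB)
  exact sub_eq_zero.1 h1

theorem variation_eq_on_of_eq_on {U : Set Plane} (hU : MeasurableSet U)
    {μ₁ μ₂ : VectorMeasure Plane H} (h : ∀ B, MeasurableSet B → B ⊆ U → μ₁ B = μ₂ B)
    {B : Set Plane} (hB : MeasurableSet B) (hBU : B ⊆ U) :
    μ₁.variation B = μ₂.variation B := by
  have e : μ₁.restrict U = μ₂.restrict U := by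
    ext C hC
    rw [VectorMeasure.restrict_apply _ hU hC, VectorMeasure.restrict_apply _ hU hC,
      h _ (hC.inter hU) inter_subset_right]
  have := congrArg (fun m => VectorMeasure.variation m B) e
  simpa [VectorMeasure.variation_restrict hU, Measure.restrict_apply hB,
    inter_eq_left.2 hBU] using this

end Unique

/-- If `f dx`, as a functional on test functions, is dominated by the measure `ν`, then
`|f| dx ≤ ν`. -/
theorem lintegral_enorm_le_of_forall_integral_le {V : Set Plane} (hV : IsOpen V) {f : Plane → ℝ}
    (hf : IntegrableOn f V) {ν : Measure Plane} [IsFiniteMeasure ν]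
    (h : ∀ φ, IsTestFunction V φ → ∫ x in V, f x * φ x ≤ ∫ x, ‖φ x‖ ∂ν)
    {B : Set Plane} (hB : MeasurableSet B) (hBV : B ⊆ V) :
    ∫⁻ x in B, ‖f x‖ₑ ≤ ν B := by
  have hfφ : ∀ φ : testSpace V, Integrable (fun x => f x * (φ : Plane → ℝ) x)
      (volume.restrict V) := fun φ => by
    obtain ⟨C, hC⟩ := φ.2.exists_bound
    exact hf.mul_bdd (c := C) φ.2.continuous.aestronglyMeasurable (Eventually.of_forall hC)
  obtain ⟨g, hgm, hg1, hg⟩ := exists_density (μ := ν) (H := ℝ) (testSpace V).subtype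
    (fun φ => φ.2.integrable)
    { toFun := fun φ => ∫ x in V, f x * (φ : Plane → ℝ) x
      map_add' := fun φ ψ => by
        rw [← integral_add (hfφ φ) (hfφ ψ)]
        exact integral_congr_ae (Eventually.of_forall fun x => mul_add _ _ _)
      map_smul' := fun c φ => by
        rw [RingHom.id_apply, smul_eq_mul, ← integral_const_mul]
        exact integral_congr_ae (Eventually.of_forall fun x => mul_left_comm _ _ _) }
    (fun φ => h φ φ.2)
  have hgi : Integrable g ν :=
    Integrable.of_bound hgm.aestronglyMeasurable 1 (Eventually.of_forall hg1)
  have := isFiniteMeasure_variation_withDensityᵥ hf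
  have := isFiniteMeasure_variation_withDensityᵥ hgi
  have key := variation_eq_on_of_eq_on hV.measurableSet
    (fun C hC hCV => vectorMeasure_eq_on_of_forall_integral_eq hV
      (μ₁ := (volume.restrict V).withDensityᵥ f) (μ₂ := ν.withDensityᵥ g) (fun φ hφ => by
        rw [integral_withDensityᵥ hf hφ.integrable, integral_withDensityᵥ hgi hφ.integrable]
        have := hg ⟨φ, hφ⟩
        simp only [LinearMap.coe_mk, AddHom.coe_mk, Submodule.subtype_apply] at this
        simpa [mul_comm] using this) hC hCV) hB hBV
  rw [Measure.variation_withDensityᵥ hf, Measure.variation_withDensityᵥ hgi,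
    withDensity_apply _ hB, withDensity_apply _ hB, Measure.restrict_restrict hB,
    inter_eq_left.2 hBV] at key
  rw [key]
  calc ∫⁻ x in B, ‖g x‖ₑ ∂ν ≤ ∫⁻ x in B, 1 ∂ν := by
        refine lintegral_mono fun x => ?_
        rw [← ofReal_norm, ← ENNReal.ofReal_one]
        exact ENNReal.ofReal_le_ofReal (hg1 x)
    _ = ν B := by simp

/-! ### Gradient measures -/

namespace IsGradientMeasure

variable {ω : Set Plane} {u : Plane → ℝ} {μ μ' : VectorMeasure Plane Plane}

theorem isFiniteMeasure (h : IsGradientMeasure ω u μ) : IsFiniteMeasure μ.variation := ⟨h.finite⟩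

/-- The gradient measure is unique: it is determined inside `ω` by test functions, and it does not
charge the complement of `ω`. -/
theorem unique (h : IsGradientMeasure ω u μ) (h' : IsGradientMeasure ω u μ') (hω : IsOpen ω) :
    μ = μ' := by
  have := h.isFiniteMeasure
  have := h'.isFiniteMeasure
  ext B hB : 1
  have e := vectorMeasure_eq_on_of_forall_integral_eq hω (μ₁ := μ) (μ₂ := μ') (fun φ hφ => by
    rw [← neg_inj, ← h.integral_eq φ hφ, h'.integral_eq φ hφ]) (hB.inter hω.measurableSet)
    inter_subset_right
  rw [← VectorMeasure.of_add_of_sdiff (v := μ) (hB.inter hω.measurableSet) hB inter_subset_left,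
    ← VectorMeasure.of_add_of_sdiff (v := μ') (hB.inter hω.measurableSet) hB inter_subset_left, e,
    sdiff_self_inter, h.carried _ (hB.diff hω.measurableSet) disjoint_sdiff_left,
    h'.carried _ (hB.diff hω.measurableSet) disjoint_sdiff_left]

end IsGradientMeasure

theorem IsBV.isGradientMeasure {ω : Set Plane} {u : Plane → ℝ} (hu : IsBV ω u) :
    IsGradientMeasure ω u (gradientMeasure ω u) := by
  rw [gradientMeasure, dif_pos hu.2]
  exact hu.2.choose_spec

theorem integral_mul_gradient_eq_neg {φ ψ : Plane → ℝ} (hφ : IsTestFunction univ φ)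
    (hψ : IsTestFunction univ ψ) :
    ∫ x, φ x • gradient ψ x = -∫ x, ψ x • gradient φ x := by
  refine ext_inner_right ℝ fun v => ?_
  have h1 := hψ.integrable_mul_gradient (hφ.integrable (μ := volume))
  have h2 := hφ.integrable_mul_gradient (hψ.integrable (μ := volume))
  rw [inner_neg_left, real_inner_comm, real_inner_comm v, ← integral_inner h1, ← integral_inner h2]
  simp_rw [inner_smul_right, fun x => real_inner_comm (gradient φ x) v,
    fun x => real_inner_comm (gradient ψ x) v, inner_gradient_left]
  have e : ∀ x, φ x * fderiv ℝ ψ x v = inner ℝ v (φ x • gradient ψ x) := fun x => by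
    rw [inner_smul_right, real_inner_comm, inner_gradient_left]
  have e' : ∀ x, fderiv ℝ φ x v * ψ x = inner ℝ v (ψ x • gradient φ x) := fun x => by
    rw [inner_smul_right, real_inner_comm, inner_gradient_left, mul_comm]
  rw [integral_mul_fderiv_eq_neg_fderiv_mul_of_integrable (v := v) ?_ ?_ ?_
    (fun x _ => hφ.differentiable x) (fun x _ => hψ.differentiable x)]
  · simp_rw [mul_comm]
  · simp_rw [e']
    exact h2.const_inner v
  · simp_rw [e]
    exact h1.const_inner v
  · have hc := hψ.continuous.mul hφ.continuous |>.congr fun x => mul_comm _ _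
    exact hc.integrable_of_hasCompactSupport hφ.compactSupport.mul_right

/-- The gradient measure of a smooth function is `∇φ dx`. -/
theorem IsTestFunction.isGradientMeasure {ω : Set Plane} {φ : Plane → ℝ}
    (hφ : IsTestFunction univ φ) :
    IsGradientMeasure ω φ ((volume.restrict ω).withDensityᵥ (gradient φ)) where
  finite := (isFiniteMeasure_variation_withDensityᵥ hφ.integrable_gradient).1
  carried := fun B hB hBω => by
    rw [withDensityᵥ_apply hφ.integrable_gradient hB, Measure.restrict_restrict hB,
      hBω.inter_eq, Measure.restrict_empty, integral_zero_measure]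
  integral_eq := fun ψ hψ => by
    have := isFiniteMeasure_variation_withDensityᵥ
      (hφ.integrable_gradient (μ := volume.restrict ω))
    rw [integral_withDensityᵥ hφ.integrable_gradient hψ.integrable,
      setIntegral_eq_integral_of_forall_compl_eq_zero (fun x hx => by
        rw [hψ.gradient_eq_zero_of_notMem hx, smul_zero]),
      setIntegral_eq_integral_of_forall_compl_eq_zero (fun x hx => by
        rw [hψ.eq_zero_of_notMem hx, zero_smul])]
    exact integral_mul_gradient_eq_neg hφ (hψ.mono (subset_univ _))

theorem IsTestFunction.isBV {ω : Set Plane} {φ : Plane → ℝ}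
    (hφ : IsTestFunction univ φ) : IsBV ω φ :=
  ⟨hφ.integrable, _, hφ.isGradientMeasure⟩

theorem IsTestFunction.variation_gradientMeasure {ω : Set Plane} (hω : IsOpen ω) {φ : Plane → ℝ}
    (hφ : IsTestFunction univ φ) :
    (gradientMeasure ω φ).variation ω = ∫⁻ x in ω, ‖gradient φ x‖ₑ := by
  rw [(hφ.isBV).isGradientMeasure.unique (hφ.isGradientMeasure) hω,
    Measure.variation_withDensityᵥ hφ.integrable_gradient, withDensity_apply _ hω.measurableSet,
    Measure.restrict_restrict hω.measurableSet, inter_self]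

/-! ### Mollification of divergence-free fields -/

/-- A divergence-free field of length at most `1` in `ω`, extended by zero to a Borel field on the
plane. Every admissible field agrees almost everywhere with such a field. -/
structure IsUnitField (ω : Set Plane) (T : Plane → Plane) : Prop where
  measurable : StronglyMeasurable T
  norm_le_one : ∀ x, ‖T x‖ ≤ 1
  eq_zero : ∀ x ∉ ω, T x = 0
  divFree : ∀ φ, IsTestFunction ω φ → ∫ x, inner ℝ (T x) (gradient φ x) = 0

theorem norm_planar_le (s : Space) : ‖planar s‖ ≤ ‖s‖ := by
  rw [EuclideanSpace.norm_eq, EuclideanSpace.norm_eq, Fin.sum_univ_two, Fin.sum_univ_three]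
  refine Real.sqrt_le_sqrt ?_
  simp [planar]
  positivity

theorem continuous_planar : Continuous planar := by
  unfold planar
  refine (PiLp.continuous_toLp 2 _).comp (continuous_pi fun i => ?_)
  fin_cases i <;> simp <;> fun_prop

/-- The planar part of an admissible field, modified on a negligible set and extended by zero. -/
theorem IsAdmissible.exists_isUnitField {ω : Set Plane} (hω : MeasurableSet ω)
    {σ : Plane → Space} (h : IsAdmissible ω σ) :
    ∃ T, IsUnitField ω T ∧ ∀ᵐ x ∂volume.restrict ω, planar (σ x) = T x := by
  classical
  have hm : AEStronglyMeasurable (fun x => planar (σ x)) (volume.restrict ω) :=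
    continuous_planar.comp_aestronglyMeasurable h.memLp.1
  set τ := hm.mk _ with hτ
  set B : Set Plane := ω ∩ {x | ‖τ x‖ ≤ 1}
  have hB : MeasurableSet B :=
    hω.inter (measurableSet_le hm.stronglyMeasurable_mk.norm.measurable measurable_const)
  have hae : ∀ᵐ x ∂volume.restrict ω, planar (σ x) = B.indicator τ x := by
    filter_upwards [hm.ae_eq_mk, h.norm_le_one, ae_restrict_mem hω] with x h1 h2 h3
    have : x ∈ B := ⟨h3, by
      show ‖τ x‖ ≤ 1
      rw [hτ, ← h1]
      exact (norm_planar_le _).trans h2⟩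
    rw [indicator_of_mem this, h1]
  have h0 : ∀ x ∉ ω, B.indicator τ x = 0 := fun x hx =>
    indicator_of_notMem (fun h => hx h.1) _
  refine ⟨B.indicator τ, ⟨hm.stronglyMeasurable_mk.indicator hB, fun x => ?_, h0, fun φ hφ => ?_⟩,
    hae⟩
  · by_cases hx : x ∈ B
    · rw [indicator_of_mem hx]; exact hx.2
    · simp [hx]
  · rw [← setIntegral_eq_integral_of_forall_compl_eq_zero (s := ω)
      (fun x hx => by rw [h0 x hx, inner_zero_left]), ← h.divFree φ hφ]
    refine integral_congr_ae ?_
    filter_upwards [hae] with x hx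
    rw [hx]

/-- A smooth bump function supported in the ball of radius `δ` around the origin. -/
noncomputable def bump {δ : ℝ} (hδ : 0 < δ) : ContDiffBump (0 : Plane) :=
  ⟨δ / 2, δ, half_pos hδ, half_lt_self hδ⟩

/-- The mollifier `ρ_δ`: a smooth probability density supported in the ball of radius `δ`. -/
noncomputable def mollifier {δ : ℝ} (hδ : 0 < δ) : Plane → ℝ := (bump hδ).normed volume

section Mollifier

variable {δ : ℝ} (hδ : 0 < δ)

theorem contDiff_mollifier : ContDiff ℝ (⊤ : ℕ∞) (mollifier hδ) := (bump hδ).contDiff_normed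

theorem hasCompactSupport_mollifier : HasCompactSupport (mollifier hδ) :=
  (bump hδ).hasCompactSupport_normed

theorem mollifier_nonneg (x : Plane) : 0 ≤ mollifier hδ x := (bump hδ).nonneg_normed x

theorem integral_mollifier : ∫ x, mollifier hδ x = 1 := (bump hδ).integral_normed

theorem integrable_mollifier : Integrable (mollifier hδ) := (bump hδ).integrable_normed

theorem mollifier_eq_zero {x : Plane} (hx : δ ≤ ‖x‖) : mollifier hδ x = 0 := by
  have : x ∉ Function.support (mollifier hδ) := by
    rw [mollifier, (bump hδ).support_normed_eq]
    simpa [bump] using hx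
  simpa using this

theorem integral_mollifier_sub (x : Plane) : ∫ y, mollifier hδ (x - y) = 1 := by
  rw [integral_sub_left_eq_self (mollifier hδ) volume x, integral_mollifier]

theorem integrable_mollifier_sub (x : Plane) : Integrable fun y => mollifier hδ (x - y) :=
  (integrable_mollifier hδ).comp_sub_left x

theorem isTestFunction_mollifier_sub {U : Set Plane} {x : Plane} (hx : Metric.closedBall x δ ⊆ U) :
    IsTestFunction U fun y => mollifier hδ (x - y) := by
  have hsub : tsupport (fun y => mollifier hδ (x - y)) ⊆ Metric.closedBall x δ := by
    refine closure_minimal (fun y hy => ?_) Metric.isClosed_closedBall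
    by_contra h
    refine hy (mollifier_eq_zero hδ ?_)
    rw [Metric.mem_closedBall, dist_comm, dist_eq_norm, not_le] at h
    exact h.le
  refine ⟨(contDiff_mollifier hδ).comp (contDiff_const.sub contDiff_id), ?_, hsub.trans hx⟩
  exact IsCompact.of_isClosed_subset (isCompact_closedBall x δ) (isClosed_tsupport _) hsub

end Mollifier

/-- The mollified field `ρ_δ * T`. -/
noncomputable def mollify {E : Type*} [NormedAddCommGroup E] [NormedSpace ℝ E] {δ : ℝ} (hδ : 0 < δ)
    (T : Plane → E) (x : Plane) : E := ∫ y, mollifier hδ (x - y) • T y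

section Mollify

variable {E : Type*} [NormedAddCommGroup E] [NormedSpace ℝ E] {δ : ℝ} (hδ : 0 < δ) {T : Plane → E}

theorem mollify_eq_convolution :
    mollify hδ T = convolution (mollifier hδ) T (ContinuousLinearMap.lsmul ℝ ℝ) volume := by
  funext x
  rw [mollify, convolution_lsmul_swap]

theorem mollify_eq_convolution' :
    mollify hδ T = convolution T (mollifier hδ) (ContinuousLinearMap.lsmul ℝ ℝ).flip volume := by
  rw [mollify_eq_convolution, convolution_flip]

theorem integrable_mollifier_smul (hT : Integrable T) (x : Plane) :
    Integrable fun y => mollifier hδ (x - y) • T y := by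
  obtain ⟨C, hC⟩ := (hasCompactSupport_mollifier hδ).exists_bound_of_continuous
    (contDiff_mollifier hδ).continuous
  exact hT.bdd_smul C ((contDiff_mollifier hδ).continuous.comp
    (continuous_const.sub continuous_id)).aestronglyMeasurable (Eventually.of_forall fun y => hC _)

theorem norm_mollify_le {C : ℝ} (hT : ∀ x, ‖T x‖ ≤ C) (x : Plane) : ‖mollify hδ T x‖ ≤ C := by
  have h := (integrable_mollifier_sub hδ x).mul_const C
  calc ‖mollify hδ T x‖ ≤ ∫ y, mollifier hδ (x - y) * C := by
        refine norm_integral_le_of_norm_le h (Eventually.of_forall fun y => ?_)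
        rw [norm_smul, Real.norm_eq_abs, abs_of_nonneg (mollifier_nonneg hδ _)]
        exact mul_le_mul_of_nonneg_left (hT y) (mollifier_nonneg hδ _)
    _ = C := by rw [integral_mul_const, integral_mollifier_sub, one_mul]

theorem contDiff_mollify [CompleteSpace E] (hT : LocallyIntegrable T) :
    ContDiff ℝ (⊤ : ℕ∞) (mollify hδ T) := by
  rw [mollify_eq_convolution']
  exact (hasCompactSupport_mollifier hδ).contDiff_convolution_right _ hT (contDiff_mollifier hδ)

theorem ae_tendsto_mollify [CompleteSpace E] (hT : LocallyIntegrable T) :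
    ∀ᵐ x, Tendsto (fun n : ℕ => mollify (Nat.one_div_pos_of_nat (α := ℝ) (n := n)) T x) atTop
      (𝓝 (T x)) := by
  have := ContDiffBump.ae_convolution_tendsto_right_of_locallyIntegrable (μ := volume)
    (φ := fun n : ℕ => bump (Nat.one_div_pos_of_nat (α := ℝ) (n := n))) (l := atTop) (K := 2)
    tendsto_one_div_add_atTop_nhds_zero_nat
    (Eventually.of_forall fun n => by simp only [bump]; linarith) hT
  filter_upwards [this] with x hx
  simpa only [mollify_eq_convolution] using! hx

theorem fderiv_mollify_real {f : Plane → ℝ} (hf : LocallyIntegrable f) (x v : Plane) :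
    fderiv ℝ (mollify hδ f) x v = ∫ y, f y * fderiv ℝ (mollifier hδ) (x - y) v := by
  have h := (hasCompactSupport_mollifier hδ).hasFDerivAt_convolution_right
    (ContinuousLinearMap.lsmul ℝ ℝ).flip hf
    ((contDiff_mollifier hδ).of_le (by simp)) x
  rw [← mollify_eq_convolution'] at h
  rw [h.fderiv, convolution_precompR_apply _ hf ((hasCompactSupport_mollifier hδ).fderiv ℝ)
    ((contDiff_mollifier hδ).continuous_fderiv (by simp)), convolution_def]
  simp [mul_comm]

end Mollify

namespace IsUnitField

variable {ω : Set Plane} {T : Plane → Plane}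

theorem integrable (h : IsUnitField ω T) (hωb : Bornology.IsBounded ω) :
    Integrable T := by
  have : IsFiniteMeasure (volume.restrict ω) := ⟨by simpa using hωb.measure_lt_top⟩
  refine (integrableOn_iff_integrable_of_support_subset (s := ω) ?_).1 ?_
  · intro x hx
    by_contra hx'
    exact hx (h.eq_zero x hx')
  · exact Integrable.of_bound h.measurable.aestronglyMeasurable 1
      (Eventually.of_forall h.norm_le_one)

theorem norm_inner_le (h : IsUnitField ω T) (x v : Plane) : ‖inner ℝ (T x) v‖ ≤ ‖v‖ :=
  (norm_inner_le_norm _ _).trans (mul_le_of_le_one_left (norm_nonneg _) (h.norm_le_one x))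

theorem integrable_inner (h : IsUnitField ω T) {F : Plane → Plane} {μ : Measure Plane}
    (hF : Integrable F μ) : Integrable (fun x => inner ℝ (T x) (F x)) μ :=
  hF.norm.mono' (h.measurable.aestronglyMeasurable.inner hF.1)
    (Eventually.of_forall fun x => h.norm_inner_le x (F x))

/-- The mollified field is divergence free at points of distance more than `δ` from the
complement of `ω`: there, the mollifier is a test function in `ω`. -/
theorem sum_fderiv_mollify (h : IsUnitField ω T) (hT : Integrable T) {δ : ℝ} (hδ : 0 < δ)
    {x : Plane} (hx : Metric.closedBall x δ ⊆ ω) :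
    ∑ i, fderiv ℝ (mollify hδ fun y => T y i) x (EuclideanSpace.single i 1) = 0 := by
  have hTi : ∀ i, Integrable fun y => T y i := fun i =>
    (EuclideanSpace.proj (𝕜 := ℝ) i).integrable_comp hT
  have hρ := isTestFunction_mollifier_sub hδ hx
  have hρ' : ∀ y,
      gradient (fun z => mollifier hδ (x - z)) y = -gradient (mollifier hδ) (x - y) := by
    intro y
    refine ext_inner_right ℝ fun v => ?_
    rw [inner_neg_left, inner_gradient_left, inner_gradient_left]
    have hd : DifferentiableAt ℝ (mollifier hδ) (x - y) :=
      ((contDiff_mollifier hδ).differentiable (by simp)) _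
    have : fderiv ℝ (fun z => mollifier hδ (x - z)) y = _ :=
      (hd.hasFDerivAt.comp y ((hasFDerivAt_id y).const_sub x)).fderiv
    rw [this]
    simp
  have hb : ∃ C, ∀ y, ‖fderiv ℝ (mollifier hδ) (x - y)‖ ≤ C := by
    obtain ⟨C, hC⟩ := ((hasCompactSupport_mollifier hδ).fderiv ℝ).exists_bound_of_continuous
      ((contDiff_mollifier hδ).continuous_fderiv (by simp))
    exact ⟨C, fun y => hC _⟩
  obtain ⟨C, hC⟩ := hb
  have hint : ∀ i v, Integrable fun y => T y i * fderiv ℝ (mollifier hδ) (x - y) v := fun i v => by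
    refine (hTi i).mul_bdd (c := C * ‖v‖) ?_ (Eventually.of_forall fun y => ?_)
    · have := (contDiff_mollifier hδ).continuous_fderiv (by simp)
      exact Continuous.aestronglyMeasurable (by fun_prop)
    · exact ((fderiv ℝ (mollifier hδ) (x - y)).le_opNorm v).trans (by gcongr; exact hC y)
  simp_rw [fun i => fderiv_mollify_real hδ (hTi i).locallyIntegrable x (EuclideanSpace.single i 1)]
  rw [← integral_finsetSum _ fun i _ => hint i _]
  have e : ∀ y, ∑ i, T y i * fderiv ℝ (mollifier hδ) (x - y) (EuclideanSpace.single i 1)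
      = -inner ℝ (T y) (gradient (fun z => mollifier hδ (x - z)) y) := by
    intro y
    rw [hρ', inner_neg_right, neg_neg, real_inner_comm, inner_gradient_left]
    conv_rhs => rw [← (EuclideanSpace.basisFun (Fin 2) ℝ).sum_repr (T y), map_sum]
    refine Finset.sum_congr rfl fun i _ => ?_
    simp
  simp_rw [e]
  rw [integral_neg, h.divFree _ hρ, neg_zero]

/-- If `∇u = g ν` in `ω` with `|g| ≤ 1`, then `|T · Du| ≤ ν` for divergence-free fields `T` with
`|T| ≤ 1`. The field is mollified, which keeps both the bound and, inside `ω`, the vanishing of the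
divergence. -/
theorem abs_integral_inner_gradient_mul_le (h : IsUnitField ω T) (hω : IsOpen ω)
    (hωb : Bornology.IsBounded ω) {u : Plane → ℝ} (hu : IntegrableOn u ω)
    {ν : Measure Plane} [IsFiniteMeasure ν] {g : Plane → Plane} (hgm : StronglyMeasurable g)
    (hg1 : ∀ x, ‖g x‖ ≤ 1)
    (hg : ∀ φ, IsTestFunction ω φ → ∫ x in ω, u x • gradient φ x = -∫ x, φ x • g x ∂ν)
    {φ : Plane → ℝ} (hφ : IsTestFunction ω φ) :
    |∫ x in ω, inner ℝ (T x) (gradient φ x) * u x| ≤ ∫ x, ‖φ x‖ ∂ν := by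
  have hTint := h.integrable hωb
  have hTi : ∀ i, Integrable fun y => T y i := fun i =>
    (EuclideanSpace.proj (𝕜 := ℝ) i).integrable_comp hTint
  have hgi : Integrable g ν :=
    Integrable.of_bound hgm.aestronglyMeasurable 1 (Eventually.of_forall hg1)
  obtain ⟨ε, hε, hεω⟩ := hφ.compactSupport.exists_cthickening_subset_open hω hφ.tsupport_subset
  have hcomp : ∀ {δ : ℝ} (hδ : 0 < δ) x i, mollify hδ T x i = mollify hδ (fun y => T y i) x := by
    intro δ hδ x i
    exact ((EuclideanSpace.proj (𝕜 := ℝ) i).integral_comp_comm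
      (integrable_mollifier_smul hδ hTint x)).symm
  -- The definition of `Du` is applied to the test functions `(ρ_δ * T)ᵢ φ` and summed over `i`; the
  -- terms in which the field is differentiated add up to its divergence, which vanishes.
  have key : ∀ {δ : ℝ} (hδ : 0 < δ), δ ≤ ε →
      ∫ x in ω, inner ℝ (mollify hδ T x) (gradient φ x) * u x
        = -∫ x, φ x * inner ℝ (mollify hδ T x) (g x) ∂ν := by
    intro δ hδ hδε
    have ht : ∀ i, IsTestFunction ω fun x => mollify hδ (fun y => T y i) x * φ x := fun i =>
      hφ.mul_left (contDiff_mollify hδ (hTi i).locallyIntegrable)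
    have h1 : ∀ i, ∫ x in ω, u x * gradient (fun x => mollify hδ (fun y => T y i) x * φ x) x i
        = -∫ x, (mollify hδ (fun y => T y i) x * φ x) * g x i ∂ν := fun i => by
      have h2 := congrArg (EuclideanSpace.proj (𝕜 := ℝ) i) (hg _ (ht i))
      have i1 : Integrable
          (fun x => u x • gradient (fun x => mollify hδ (fun y => T y i) x * φ x) x)
          (volume.restrict ω) := (ht i).integrable_mul_gradient hu
      have i2 : Integrable (fun x => (mollify hδ (fun y => T y i) x * φ x) • g x) ν := by
        obtain ⟨C, hC⟩ := (ht i).exists_bound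
        exact hgi.bdd_smul C (ht i).continuous.aestronglyMeasurable (Eventually.of_forall hC)
      rw [map_neg, ← (EuclideanSpace.proj (𝕜 := ℝ) i).integral_comp_comm i1,
        ← (EuclideanSpace.proj (𝕜 := ℝ) i).integral_comp_comm i2] at h2
      simpa using h2
    have i1 : ∀ i, Integrable (fun x => u x * gradient
        (fun x => mollify hδ (fun y => T y i) x * φ x) x i) (volume.restrict ω) := fun i =>
      (EuclideanSpace.proj (𝕜 := ℝ) i).integrable_comp ((ht i).integrable_mul_gradient hu)
    have i2 : ∀ i,
        Integrable (fun x => (mollify hδ (fun y => T y i) x * φ x) * g x i) ν := fun i => by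
      obtain ⟨C, hC⟩ := (ht i).exists_bound
      exact ((EuclideanSpace.proj (𝕜 := ℝ) i).integrable_comp hgi).bdd_mul
        (ht i).continuous.aestronglyMeasurable (Eventually.of_forall hC)
    have h3 := Finset.sum_congr (rfl : (Finset.univ : Finset (Fin 2)) = _) fun i _ => h1 i
    rw [← integral_finsetSum _ fun i _ => i1 i, Finset.sum_neg_distrib,
      ← integral_finsetSum _ fun i _ => i2 i] at h3
    have e1 : ∀ x, ∑ i, u x * gradient (fun x => mollify hδ (fun y => T y i) x * φ x) x i
        = inner ℝ (mollify hδ T x) (gradient φ x) * u x := by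
      intro x
      have e2 : ∀ i, gradient (fun x => mollify hδ (fun y => T y i) x * φ x) x i
          = mollify hδ T x i * gradient φ x i
            + φ x * fderiv ℝ (mollify hδ fun y => T y i) x (EuclideanSpace.single i 1) := by
        intro i
        rw [gradient_mul' ((contDiff_mollify hδ (hTi i).locallyIntegrable).differentiable
          (by simp) x) (hφ.differentiable x), ← inner_gradient_left, hcomp, PiLp.add_apply,
          PiLp.smul_apply, PiLp.smul_apply, EuclideanSpace.inner_single_right]
        simp
      simp_rw [e2, ← Finset.mul_sum, Finset.sum_add_distrib, ← Finset.mul_sum]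
      have e3 :
          φ x * ∑ i, fderiv ℝ (mollify hδ fun y => T y i) x (EuclideanSpace.single i 1) = 0 := by
        by_cases hx : x ∈ tsupport φ
        · rw [h.sum_fderiv_mollify hTint hδ, mul_zero]
          exact ((Metric.closedBall_subset_closedBall hδε).trans
            (Metric.closedBall_subset_cthickening hx ε)).trans hεω
        · rw [image_eq_zero_of_notMem_tsupport hx, zero_mul]
      rw [e3, add_zero, mul_comm, PiLp.inner_apply]
      simp [mul_comm]
    have e4 : ∀ x, ∑ i, (mollify hδ (fun y => T y i) x * φ x) * g x i
        = φ x * inner ℝ (mollify hδ T x) (g x) := by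
      intro x
      rw [PiLp.inner_apply, Finset.mul_sum]
      refine Finset.sum_congr rfl fun i _ => ?_
      rw [← hcomp]
      simp
      ring
    simp_rw [e1, e4] at h3
    exact h3
  have hlim : Tendsto (fun n : ℕ => ∫ x in ω,
      inner ℝ (mollify (Nat.one_div_pos_of_nat (α := ℝ) (n := n)) T x) (gradient φ x) * u x) atTop
      (𝓝 (∫ x in ω, inner ℝ (T x) (gradient φ x) * u x)) := by
    obtain ⟨C, hC⟩ := hφ.exists_bound_gradient
    refine tendsto_integral_of_dominated_convergence (fun x => C * ‖u x‖) (fun n => ?_)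
      (hu.norm.const_mul C) (fun n => Eventually.of_forall fun x => ?_) ?_
    · exact (((contDiff_mollify _ hTint.locallyIntegrable).continuous.inner
        hφ.continuous_gradient).aestronglyMeasurable).mul hu.1
    · rw [norm_mul]
      gcongr
      exact (norm_inner_le_norm _ _).trans ((mul_le_of_le_one_left (norm_nonneg _)
        (norm_mollify_le _ h.norm_le_one x)).trans (hC x))
    · filter_upwards [ae_restrict_of_ae (ae_tendsto_mollify hTint.locallyIntegrable)] with x hx
      exact (hx.inner tendsto_const_nhds).mul_const _
  refine le_of_tendsto hlim.abs ?_
  have : ∀ᶠ n : ℕ in atTop, (1 : ℝ) / (n + 1) ≤ ε :=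
    (tendsto_one_div_add_atTop_nhds_zero_nat (𝕜 := ℝ)).eventually (ge_mem_nhds hε)
  filter_upwards [this] with n hn
  rw [key _ hn, abs_neg]
  rw [← Real.norm_eq_abs]
  refine norm_integral_le_of_norm_le hφ.integrable.norm (Eventually.of_forall fun x => ?_)
  rw [norm_mul]
  refine mul_le_of_le_one_right (norm_nonneg _) ((norm_inner_le_norm _ _).trans ?_)
  exact mul_le_one₀ (norm_mollify_le _ h.norm_le_one x) (norm_nonneg _) (hg1 x)

/-- The distributional equation `div T = 0` may be tested with `C¹` functions. -/
theorem integral_inner_gradient_eq_zero (h : IsUnitField ω T) (hω : IsOpen ω)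
    (hωb : Bornology.IsBounded ω) {ψ : Plane → ℝ} (hψ : ContDiff ℝ 1 ψ)
    (hψc : HasCompactSupport ψ) (hψω : tsupport ψ ⊆ ω) :
    ∫ x, inner ℝ (T x) (gradient ψ x) = 0 := by
  have hTint := h.integrable hωb
  obtain ⟨ε, hε, hεω⟩ := hψc.isCompact.exists_cthickening_subset_open hω hψω
  have hψi : LocallyIntegrable ψ := hψ.continuous.locallyIntegrable
  have hmem : ∀ {δ : ℝ} (hδ : 0 < δ), δ ≤ ε → IsTestFunction ω (mollify hδ ψ) := by
    intro δ hδ hδε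
    have hsub : tsupport (mollify hδ ψ) ⊆ Metric.cthickening ε (tsupport ψ) := by
      refine closure_minimal (fun x hx => ?_) Metric.isClosed_cthickening
      by_contra hx'
      refine hx (integral_eq_zero_of_ae (Eventually.of_forall fun y => ?_))
      by_cases hy : y ∈ tsupport ψ
      · show mollifier hδ (x - y) • ψ y = 0
        rw [mollifier_eq_zero hδ, zero_smul]
        by_contra hlt
        exact hx' (Metric.mem_cthickening_of_dist_le x y ε _ hy
          (by rw [dist_eq_norm]; linarith))
      · show mollifier hδ (x - y) • ψ y = 0
        rw [image_eq_zero_of_notMem_tsupport hy, smul_zero]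
    exact ⟨contDiff_mollify hδ hψi, IsCompact.of_isClosed_subset
      hψc.isCompact.cthickening (isClosed_tsupport _) hsub, hsub.trans hεω⟩
  have hgc := hψ.continuous_gradient
  have hgi : Integrable (gradient ψ) := hgc.integrable_of_hasCompactSupport hψc.gradient
  obtain ⟨C, hC⟩ := hψc.gradient.exists_bound_of_continuous hgc
  have hgrad : ∀ {δ : ℝ} (hδ : 0 < δ) x, gradient (mollify hδ ψ) x = mollify hδ (gradient ψ) x := by
    intro δ hδ x
    refine ext_inner_left ℝ fun v => ?_
    rw [mollify, ← integral_inner (integrable_mollifier_smul hδ hgi x), real_inner_comm,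
      inner_gradient_left]
    have h1 := hψc.hasFDerivAt_convolution_right (ContinuousLinearMap.lsmul ℝ ℝ)
      (integrable_mollifier hδ).locallyIntegrable hψ x
    rw [← mollify_eq_convolution] at h1
    rw [h1.fderiv, convolution_precompR_apply _ (integrable_mollifier hδ).locallyIntegrable
      (hψc.fderiv ℝ) (hψ.continuous_fderiv (by simp)), convolution_lsmul_swap]
    refine integral_congr_ae (Eventually.of_forall fun y => ?_)
    simp only [inner_smul_right, smul_eq_mul]
    rw [real_inner_comm, inner_gradient_left]
  have hlim : Tendsto (fun n : ℕ => ∫ x, inner ℝ (T x)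
      (gradient (mollify (Nat.one_div_pos_of_nat (α := ℝ) (n := n)) ψ) x)) atTop
      (𝓝 (∫ x, inner ℝ (T x) (gradient ψ x))) := by
    simp_rw [hgrad]
    refine tendsto_integral_of_dominated_convergence (fun x => ‖T x‖ * C) (fun n => ?_)
      (hTint.norm.mul_const C) (fun n => Eventually.of_forall fun x => ?_) ?_
    · exact hTint.1.inner (contDiff_mollify _ hgi.locallyIntegrable).continuous.aestronglyMeasurable
    · refine (norm_inner_le_norm _ _).trans ?_
      gcongr
      exact norm_mollify_le _ hC x
    · filter_upwards [ae_tendsto_mollify hgi.locallyIntegrable] with x hx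
      exact tendsto_const_nhds.inner hx
  refine tendsto_nhds_unique hlim (tendsto_const_nhds.congr' ?_)
  have : ∀ᶠ n : ℕ in atTop, (1 : ℝ) / (n + 1) ≤ ε :=
    (tendsto_one_div_add_atTop_nhds_zero_nat (𝕜 := ℝ)).eventually (ge_mem_nhds hε)
  filter_upwards [this] with n hn
  exact (h.divFree _ (hmem _ hn)).symm

end IsUnitField

/-! ### Graph charts of the boundary -/

theorem dist_symm_apply_le (e : Plane ≃ₗᵢ[ℝ] Plane) {K : NNReal} {γ : ℝ → ℝ}
    (hγ : LipschitzWith K γ) (t s t' s' : ℝ) :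
    dist (e.symm !₂[t, γ t + s]) (e.symm !₂[t', γ t' + s'])
      ≤ (1 + K) * |t - t'| + |s - s'| := by
  rw [LinearIsometryEquiv.dist_map, EuclideanSpace.dist_eq, Fin.sum_univ_two]
  simp only [Real.dist_eq, sq_abs]
  have h : |γ t - γ t'| ≤ K * |t - t'| := by simpa [Real.dist_eq] using hγ.dist_le_mul t t'
  have h1 : |γ t + s - (γ t' + s')| ≤ K * |t - t'| + |s - s'| := by
    rw [add_sub_add_comm]
    exact (abs_add_le _ _).trans (by linarith)
  calc √((t - t') ^ 2 + (γ t + s - (γ t' + s')) ^ 2)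
      ≤ |t - t'| + |γ t + s - (γ t' + s')| := by
        rw [Real.sqrt_le_left (by positivity), ← sq_abs (t - t'),
          ← sq_abs (γ t + s - (γ t' + s'))]
        nlinarith [abs_nonneg (t - t'), abs_nonneg (γ t + s - (γ t' + s'))]
    _ ≤ _ := by linarith

/-- A chart of `ω` near a boundary point: in the orthonormal coordinates `e`, and inside the box of
points with abscissa in `(t₀ - ρ, t₀ + ρ)` and height over the graph of `γ` in `(-ρ, ρ)`, the set
`ω` consists of the points of positive height. -/
structure GraphChart (ω : Set Plane) where
  /-- The orthonormal coordinates. -/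
  e : Plane ≃ₗᵢ[ℝ] Plane
  /-- The Lipschitz constant of `γ`. -/
  K : NNReal
  /-- The function whose graph is the boundary. -/
  γ : ℝ → ℝ
  lip : LipschitzWith K γ
  /-- The centre of the interval of abscissas. -/
  t₀ : ℝ
  /-- The half size of the box. -/
  ρ : ℝ
  ρ_pos : 0 < ρ
  mem_iff : ∀ t s, |t - t₀| < ρ → |s| < ρ → (e.symm !₂[t, γ t + s] ∈ ω ↔ 0 < s)

namespace GraphChart

variable {ω : Set Plane} (c : GraphChart ω)

/-- The point with abscissa `p.1` and height `p.2`. -/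
noncomputable def param (p : ℝ × ℝ) : Plane := c.e.symm !₂[p.1, c.γ p.1 + p.2]

/-- The abscissa of a point. -/
noncomputable def absc (x : Plane) : ℝ := c.e x 0

/-- The (vertical) height of a point over the graph. -/
noncomputable def height (x : Plane) : ℝ := c.e x 1 - c.γ (c.e x 0)

/-- The point of the graph with a given abscissa. -/
noncomputable def graph (t : ℝ) : Plane := c.param (t, 0)

/-- The vertical unit vector, which points into `ω`. -/
noncomputable def dir : Plane := c.e.symm !₂[0, 1]

/-- The interval of abscissas of the chart. -/
def interval : Set ℝ := Ioo (c.t₀ - c.ρ) (c.t₀ + c.ρ)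

/-- The box in which the chart describes `ω`. -/
def box : Set Plane := {x | |c.absc x - c.t₀| < c.ρ ∧ |c.height x| < c.ρ}

/-- The box of half the size. -/
def halfBox : Set Plane := {x | |c.absc x - c.t₀| < c.ρ / 2 ∧ |c.height x| < c.ρ / 2}

theorem mem_interval {t : ℝ} : t ∈ c.interval ↔ |t - c.t₀| < c.ρ := by
  rw [interval, mem_Ioo, abs_sub_lt_iff]
  constructor <;> rintro ⟨h1, h2⟩ <;> constructor <;> linarith

@[simp] theorem absc_param (p : ℝ × ℝ) : c.absc (c.param p) = p.1 := by simp [absc, param]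

@[simp] theorem height_param (p : ℝ × ℝ) : c.height (c.param p) = p.2 := by simp [height, param]

@[simp] theorem param_absc_height (x : Plane) : c.param (c.absc x, c.height x) = x := by
  have : (!₂[c.e x 0, c.e x 1] : Plane) = c.e x := by
    ext i; fin_cases i <;> rfl
  simp [absc, height, param, this]

@[simp] theorem absc_graph (t : ℝ) : c.absc (c.graph t) = t := c.absc_param _

@[simp] theorem height_graph (t : ℝ) : c.height (c.graph t) = 0 := c.height_param _

theorem norm_dir : ‖c.dir‖ = 1 := by
  rw [dir, LinearIsometryEquiv.norm_map, EuclideanSpace.norm_eq]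
  simp

theorem param_add (t s h : ℝ) : c.param (t, s + h) = c.param (t, s) + h • c.dir := by
  rw [param, param, dir, ← map_smul, ← map_add]
  congr 1
  ext i; fin_cases i <;> simp [add_assoc]

theorem abs_e_apply_sub_le (x y : Plane) (i : Fin 2) : |c.e x i - c.e y i| ≤ dist x y := by
  rw [dist_eq_norm, ← c.e.norm_map, map_sub, ← Real.norm_eq_abs]
  exact PiLp.norm_apply_le (c.e x - c.e y) i

theorem lipschitz_absc : LipschitzWith 1 c.absc :=
  LipschitzWith.of_dist_le_mul fun x y => by
    simpa [Real.dist_eq, absc] using c.abs_e_apply_sub_le x y 0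

theorem abs_γ_sub_le (t t' : ℝ) : |c.γ t - c.γ t'| ≤ c.K * |t - t'| := by
  simpa [Real.dist_eq] using c.lip.dist_le_mul t t'

theorem lipschitz_height : LipschitzWith (1 + c.K) c.height :=
  LipschitzWith.of_dist_le_mul fun x y => by
    have h1 := c.abs_e_apply_sub_le x y 1
    have h2 := (c.abs_γ_sub_le (c.e x 0) (c.e y 0)).trans
      (mul_le_mul_of_nonneg_left (c.abs_e_apply_sub_le x y 0) c.K.2)
    rw [Real.dist_eq, height, height]
    have h3 : c.e x 1 - c.γ (c.e x 0) - (c.e y 1 - c.γ (c.e y 0))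
      = (c.e x 1 - c.e y 1) - (c.γ (c.e x 0) - c.γ (c.e y 0)) := by ring
    rw [h3]
    refine (abs_sub _ _).trans ?_
    push_cast
    linarith

theorem dist_param_le (t s t' s' : ℝ) :
    dist (c.param (t, s)) (c.param (t', s')) ≤ (1 + c.K) * |t - t'| + |s - s'| :=
  dist_symm_apply_le c.e c.lip t s t' s'

theorem continuous_param : Continuous c.param := by
  have := c.lip.continuous
  unfold param
  refine c.e.symm.continuous.comp ((PiLp.continuous_toLp 2 _).comp (continuous_pi fun i => ?_))
  fin_cases i <;> simp <;> fun_prop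

/-- The coordinates `(abscissa, height)` as a homeomorphism. -/
noncomputable def homeo : ℝ × ℝ ≃ₜ Plane where
  toFun := c.param
  invFun x := (c.absc x, c.height x)
  left_inv p := by simp
  right_inv x := by simp
  continuous_toFun := c.continuous_param
  continuous_invFun := c.lipschitz_absc.continuous.prodMk c.lipschitz_height.continuous

theorem measurableEmbedding_param : MeasurableEmbedding c.param := c.homeo.measurableEmbedding

/-- The vertical shear `(t, s) ↦ (t, γ t + s)` preserves the area, so `param` does. -/
theorem measurePreserving_param :
    MeasurePreserving c.param (volume : Measure (ℝ × ℝ)) (volume : Measure Plane) := by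
  have h1 : MeasurePreserving (fun p : ℝ × ℝ => (p.1, c.γ p.1 + p.2))
      ((volume : Measure ℝ).prod (volume : Measure ℝ)) ((volume : Measure ℝ).prod volume) := by
    have hm := c.lip.continuous.measurable
    exact (MeasurePreserving.id (volume : Measure ℝ)).skew_product
      (g := fun t s => c.γ t + s) ((hm.comp measurable_fst).add measurable_snd)
      (Eventually.of_forall fun t =>
        (measurePreserving_add_left (volume : Measure ℝ) (c.γ t)).map_eq)
  have h2 : MeasurePreserving (MeasurableEquiv.finTwoArrow (α := ℝ)).symm
      (volume : Measure (ℝ × ℝ)) (volume : Measure (Fin 2 → ℝ)) :=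
    (volume_preserving_finTwoArrow ℝ).symm
  have h3 := PiLp.volume_preserving_toLp (Fin 2)
  exact ((c.e.symm.measurePreserving.comp h3).comp h2).comp h1

theorem isOpen_box : IsOpen c.box := by
  have h1 := c.lipschitz_absc.continuous
  have h2 := c.lipschitz_height.continuous
  exact (isOpen_lt (h1.sub continuous_const).abs continuous_const).inter
    (isOpen_lt h2.abs continuous_const)

theorem isOpen_halfBox : IsOpen c.halfBox := by
  have h1 := c.lipschitz_absc.continuous
  have h2 := c.lipschitz_height.continuous
  exact (isOpen_lt (h1.sub continuous_const).abs continuous_const).inter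
    (isOpen_lt h2.abs continuous_const)

theorem halfBox_subset_box : c.halfBox ⊆ c.box := fun _ hx =>
  ⟨hx.1.trans (half_lt_self c.ρ_pos), hx.2.trans (half_lt_self c.ρ_pos)⟩

theorem mem_iff_height_pos {x : Plane} (hx : x ∈ c.box) : x ∈ ω ↔ 0 < c.height x := by
  have := c.mem_iff (c.absc x) (c.height x) hx.1 hx.2
  rwa [show c.e.symm !₂[c.absc x, c.γ (c.absc x) + c.height x] = x from
    c.param_absc_height x] at this

theorem param_mem {t s : ℝ} (ht : t ∈ c.interval) (hs : s ∈ Ioo 0 c.ρ) : c.param (t, s) ∈ ω :=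
  (c.mem_iff t s (c.mem_interval.1 ht) (by rw [abs_of_pos hs.1]; exact hs.2)).2 hs.1

theorem mem_frontier_iff (hω : IsOpen ω) {x : Plane} (hx : x ∈ c.box) :
    x ∈ frontier ω ↔ c.height x = 0 := by
  rw [hω.frontier_eq, Set.mem_sdiff]
  constructor
  · rintro ⟨h1, h2⟩
    rw [c.mem_iff_height_pos hx, not_lt] at h2
    by_contra h3
    have hneg : c.height x < 0 := lt_of_le_of_ne h2 h3
    have ho : IsOpen {y | y ∈ c.box ∧ c.height y < 0} :=
      c.isOpen_box.inter (isOpen_lt c.lipschitz_height.continuous continuous_const)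
    obtain ⟨y, hy, hyω⟩ := mem_closure_iff.1 h1 _ ho ⟨hx, hneg⟩
    exact lt_asymm hy.2 ((c.mem_iff_height_pos hy.1).1 hyω)
  · intro h
    refine ⟨?_, by rw [c.mem_iff_height_pos hx, h]; exact lt_irrefl _⟩
    have hlim : Tendsto (fun s => c.param (c.absc x, s)) (𝓝[>] 0) (𝓝 x) := by
      have : Continuous fun s => c.param (c.absc x, s) := c.continuous_param.comp (by fun_prop)
      have h2 := (this.tendsto 0).mono_left (nhdsWithin_le_nhds (s := Ioi 0))
      have h3 : c.param (c.absc x, 0) = x := by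
        have := c.param_absc_height x
        rwa [h] at this
      rwa [h3] at h2
    refine mem_closure_of_tendsto hlim ?_
    filter_upwards [Ioo_mem_nhdsGT c.ρ_pos] with s hs
    exact c.param_mem (c.mem_interval.2 hx.1) hs

theorem graph_mem_frontier (hω : IsOpen ω) {t : ℝ} (ht : t ∈ c.interval) :
    c.graph t ∈ frontier ω := by
  rw [c.mem_frontier_iff hω] <;> simp [box, c.mem_interval.1 ht, c.ρ_pos]

theorem frontier_inter_box (hω : IsOpen ω) : frontier ω ∩ c.box = c.graph '' c.interval := by
  ext x
  constructor
  · rintro ⟨h1, h2⟩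
    refine ⟨c.absc x, c.mem_interval.2 h2.1, ?_⟩
    rw [graph, ← (c.mem_frontier_iff hω h2).1 h1, param_absc_height]
  · rintro ⟨t, ht, rfl⟩
    refine ⟨c.graph_mem_frontier hω ht, ?_⟩
    simp [box, c.mem_interval.1 ht, c.ρ_pos]

/-! ### Length on graphs -/

theorem lipschitz_graph : LipschitzWith (1 + c.K) c.graph :=
  LipschitzWith.of_dist_le_mul fun t t' => by
    simpa [graph, Real.dist_eq] using c.dist_param_le t 0 t' 0

theorem isClosedEmbedding_graph : IsClosedEmbedding c.graph :=
  c.homeo.isClosedEmbedding.comp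
    (g := c.homeo) (f := fun t : ℝ => (t, (0 : ℝ))) <|
    Topology.IsClosedEmbedding.of_continuous_injective_isClosedMap (by fun_prop)
      (fun a b h => (Prod.ext_iff.1 h).1)
      (fun s hs => by
        have : (fun t : ℝ => (t, (0 : ℝ))) '' s = s ×ˢ {0} := by
          ext ⟨a, b⟩; simp [eq_comm]
        rw [this]
        exact hs.prod isClosed_singleton)

theorem measurableEmbedding_graph : MeasurableEmbedding c.graph :=
  c.isClosedEmbedding_graph.measurableEmbedding

theorem hausdorffMeasure_graph_image_le (A : Set ℝ) :
    μH[1] (c.graph '' A) ≤ (1 + c.K : NNReal) * volume A := by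
  simpa [hausdorffMeasure_real] using c.lipschitz_graph.hausdorffMeasure_image_le zero_le_one A

/-- The length measure of the graph, in terms of the abscissa. -/
noncomputable def lengthMeasure : Measure ℝ := Measure.comap c.graph μH[1]

theorem lengthMeasure_apply (A : Set ℝ) : c.lengthMeasure A = μH[1] (c.graph '' A) :=
  c.measurableEmbedding_graph.comap_apply _ _

theorem lengthMeasure_le : c.lengthMeasure ≤ (1 + c.K : NNReal) • (volume : Measure ℝ) :=
  Measure.le_iff'.2 fun A => by
    rw [c.lengthMeasure_apply]
    exact c.hausdorffMeasure_graph_image_le A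

instance : IsLocallyFiniteMeasure c.lengthMeasure :=
  Measure.isLocallyFiniteMeasure_of_le c.lengthMeasure_le

/-- An arc is at least as long as its chord. -/
theorem dist_graph_le {a b : ℝ} (hab : a ≤ b) :
    ENNReal.ofReal (dist (c.graph a) (c.graph b)) ≤ c.lengthMeasure (Icc a b) := by
  have hl : LipschitzWith 1 (fun x => dist (c.graph a) x) := LipschitzWith.dist_right _
  have h1 := hl.hausdorffMeasure_image_le (d := 1) zero_le_one (c.graph '' Icc a b)
  rw [hausdorffMeasure_real, ← c.lengthMeasure_apply] at h1
  have h2 : Icc 0 (dist (c.graph a) (c.graph b)) ⊆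
      (fun x => dist (c.graph a) x) '' (c.graph '' Icc a b) := by
    have hc : ContinuousOn (fun t => dist (c.graph a) (c.graph t)) (Icc a b) :=
      (continuous_const.dist c.lipschitz_graph.continuous).continuousOn
    have := intermediate_value_Icc hab hc
    rw [dist_self] at this
    rwa [image_image]
  have h3 := (measure_mono h2).trans h1
  simpa using h3

/-- The length element `√(1 + γ'²)`. -/
noncomputable def speed (t : ℝ) : ℝ := √(1 + deriv c.γ t ^ 2)

theorem one_le_speed (t : ℝ) : 1 ≤ c.speed t := by
  rw [speed, Real.one_le_sqrt]
  nlinarith [sq_nonneg (deriv c.γ t)]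

theorem measurable_speed : Measurable c.speed :=
  ((measurable_deriv c.γ).pow_const 2 |>.const_add 1).sqrt

/-- At almost every point, the density of the length is at least the length element: short arcs are
at least as long as their chords. -/
theorem ae_speed_le_rnDeriv :
    ∀ᵐ t, ENNReal.ofReal (c.speed t) ≤ c.lengthMeasure.rnDeriv volume t := by
  filter_upwards [c.lip.ae_differentiableAt_of_real,
    Besicovitch.ae_tendsto_rnDeriv c.lengthMeasure volume] with t hd ht
  have hG : HasDerivAt c.graph (c.e.symm !₂[1, deriv c.γ t]) t := by
    have h1 : HasDerivAt (fun t => (!₂[t, c.γ t] : Plane)) !₂[1, deriv c.γ t] t := by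
      have h0 : HasDerivAt (fun t => ![t, c.γ t]) ![1, deriv c.γ t] t := by
        refine hasDerivAt_pi.2 fun i => ?_
        fin_cases i
        · exact hasDerivAt_id t
        · exact hd.hasDerivAt
      exact (PiLp.continuousLinearEquiv 2 ℝ
        (fun _ : Fin 2 => ℝ)).symm.hasFDerivAt.comp_hasDerivAt t h0
    have h2 :=
      (c.e.symm.toContinuousLinearEquiv : Plane →L[ℝ] Plane).hasFDerivAt.comp_hasDerivAt t h1
    refine h2.congr_of_eventuallyEq (Eventually.of_forall fun s => ?_)
    simp [graph, param]
  have hnorm : ‖c.e.symm !₂[1, deriv c.γ t]‖ = c.speed t := by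
    rw [LinearIsometryEquiv.norm_map, EuclideanSpace.norm_eq, Fin.sum_univ_two]
    simp [speed]
  -- The symmetric difference quotient, as the mean of the two one-sided ones.
  have hlim : Tendsto (fun r : ℝ => ENNReal.ofReal
      ‖(2 : ℝ)⁻¹ • (r⁻¹ • (c.graph (t + r) - c.graph t)
        + (-r)⁻¹ • (c.graph (t + -r) - c.graph t))‖) (𝓝[>] 0) (𝓝 (ENNReal.ofReal (c.speed t))) := by
    have h1 := (hasDerivAt_iff_tendsto_slope_zero.1 hG)
    have h2 : Tendsto (fun r : ℝ => -r) (𝓝[>] 0) (𝓝[≠] 0) := by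
      refine tendsto_nhdsWithin_iff.2 ⟨?_, ?_⟩
      · have : Tendsto (fun r : ℝ => -r) (𝓝 0) (𝓝 (-0)) := (continuous_neg.tendsto 0)
        rw [neg_zero] at this
        exact this.mono_left nhdsWithin_le_nhds
      · filter_upwards [self_mem_nhdsWithin] with r hr
        exact neg_ne_zero.2 (ne_of_gt hr)
    have h3 := ((h1.mono_left (nhdsGT_le_nhdsNE 0)).add (h1.comp h2)).const_smul ((2 : ℝ)⁻¹)
    rw [← two_smul ℝ (c.e.symm _), smul_smul, inv_mul_cancel₀ two_ne_zero, one_smul] at h3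
    rw [← hnorm]
    exact (ENNReal.continuous_ofReal.tendsto _).comp h3.norm
  refine le_of_tendsto_of_tendsto hlim ht ?_
  filter_upwards [self_mem_nhdsWithin] with r hr
  have hr : 0 < r := hr
  rw [Real.closedBall_eq_Icc, Real.volume_Icc, ENNReal.le_div_iff_mul_le (by left; simp; linarith)
    (by simp), ← ENNReal.ofReal_mul (norm_nonneg _)]
  refine le_trans (ENNReal.ofReal_le_ofReal ?_) (c.dist_graph_le (by linarith))
  rw [dist_comm, dist_eq_norm, norm_smul, ← sub_eq_add_neg]
  have : r⁻¹ • (c.graph (t + r) - c.graph t) + (-r)⁻¹ • (c.graph (t - r) - c.graph t)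
      = r⁻¹ • (c.graph (t + r) - c.graph (t - r)) := by
    rw [inv_neg, neg_smul, ← sub_eq_add_neg, ← smul_sub, sub_sub_sub_cancel_right]
  rw [this, norm_smul, Real.norm_of_nonneg (by positivity), Real.norm_of_nonneg (by positivity)]
  refine le_of_eq ?_
  field_simp
  ring

theorem withDensity_speed_le : (volume.withDensity fun t => ENNReal.ofReal (c.speed t))
    ≤ c.lengthMeasure :=
  (withDensity_mono c.ae_speed_le_rnDeriv).trans (Measure.withDensity_rnDeriv_le _ _)

/-- Half of the area formula for graphs: the sharp one, used for the bound `|σ · ν| ≤ 1`. -/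
theorem lintegral_speed_mul_le (hω : IsOpen ω) {F : Plane → ℝ≥0∞} (hF : Measurable F) :
    ∫⁻ t in c.interval, ENNReal.ofReal (c.speed t) * F (c.graph t)
      ≤ ∫⁻ x, F x ∂boundaryMeasure ω := by
  have hI : MeasurableSet c.interval := measurableSet_Ioo
  have hFG : Measurable fun t => F (c.graph t) := hF.comp c.measurableEmbedding_graph.measurable
  calc ∫⁻ t in c.interval, ENNReal.ofReal (c.speed t) * F (c.graph t)
      = ∫⁻ t in c.interval, F (c.graph t)
          ∂(volume.withDensity fun t => ENNReal.ofReal (c.speed t)) := by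
        rw [restrict_withDensity hI, lintegral_withDensity_eq_lintegral_mul _
          c.measurable_speed.ennreal_ofReal hFG]
        rfl
    _ ≤ ∫⁻ t in c.interval, F (c.graph t) ∂c.lengthMeasure :=
        lintegral_mono' (Measure.restrict_mono le_rfl c.withDensity_speed_le) le_rfl
    _ = ∫⁻ x in c.graph '' c.interval, F x ∂μH[1] := by
        rw [← c.measurableEmbedding_graph.lintegral_map, lengthMeasure]
        congr 1
        conv_lhs => rw [← preimage_image_eq c.interval c.isClosedEmbedding_graph.injective]
        rw [← c.measurableEmbedding_graph.restrict_map, c.measurableEmbedding_graph.map_comap,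
          Measure.restrict_restrict (c.measurableEmbedding_graph.measurableSet_image.2 hI),
          inter_eq_left.2 (image_subset_range _ _)]
    _ ≤ ∫⁻ x, F x ∂boundaryMeasure ω := by
        refine lintegral_mono' (Measure.restrict_mono ?_ le_rfl) le_rfl
        rintro _ ⟨t, ht, rfl⟩
        exact c.graph_mem_frontier hω ht

theorem lintegral_graph_le (hω : IsOpen ω) {F : Plane → ℝ≥0∞} (hF : Measurable F) :
    ∫⁻ t in c.interval, F (c.graph t) ≤ ∫⁻ x, F x ∂boundaryMeasure ω := by
  refine le_trans (lintegral_mono fun t => ?_) (c.lintegral_speed_mul_le hω hF)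
  refine le_mul_of_one_le_left (zero_le) ?_
  rw [← ENNReal.ofReal_one]
  exact ENNReal.ofReal_le_ofReal (c.one_le_speed t)

theorem boundaryMeasure_restrict_box_le (hω : IsOpen ω) :
    (boundaryMeasure ω).restrict c.box
      ≤ (1 + c.K : NNReal) • (volume.restrict c.interval).map c.graph := by
  refine Measure.le_iff.2 fun S hS => ?_
  rw [boundaryMeasure, Measure.restrict_restrict c.isOpen_box.measurableSet,
    Measure.restrict_apply hS, inter_comm c.box, c.frontier_inter_box hω, Measure.smul_apply,
    Measure.map_apply c.measurableEmbedding_graph.measurable hS,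
    Measure.restrict_apply (c.measurableEmbedding_graph.measurable hS)]
  refine le_trans (measure_mono ?_) (c.hausdorffMeasure_graph_image_le _)
  rintro _ ⟨h1, t, ht, rfl⟩
  exact ⟨t, ⟨h1, ht⟩, rfl⟩

theorem ae_box_of_ae_interval (hω : IsOpen ω) {P : Plane → Prop}
    (h : ∀ᵐ t ∂volume.restrict c.interval, P (c.graph t)) :
    ∀ᵐ x ∂(boundaryMeasure ω).restrict c.box, P x := by
  have h1 : ∀ᵐ x ∂(volume.restrict c.interval).map c.graph, P x :=
    (c.measurableEmbedding_graph.ae_map_iff).2 h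
  exact (Measure.absolutelyContinuous_of_le_smul (c.boundaryMeasure_restrict_box_le hω)) h1

end GraphChart

/-- Every boundary point lies in the half box of a chart. The size `r / (2 + K)` makes the box fit
into the ball of radius `r` given by the definition. -/
theorem HasLipschitzBoundary.exists_chart {ω : Set Plane} (hω : IsOpen ω)
    (hL : HasLipschitzBoundary ω) {x : Plane} (hx : x ∈ frontier ω) :
    ∃ c : GraphChart ω, x ∈ c.halfBox := by
  obtain ⟨r, hr, e, K, γ, hγ, h⟩ := hL x hx
  rw [hω.frontier_eq, Set.mem_sdiff] at hx
  have hc : Continuous fun y : Plane => γ (e y 0) - e y 1 :=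
    (hγ.continuous.comp ((EuclideanSpace.proj (𝕜 := ℝ) (0 : Fin 2)).continuous.comp
      e.continuous)).sub ((EuclideanSpace.proj (𝕜 := ℝ) (1 : Fin 2)).continuous.comp e.continuous)
  have h0 : γ (e x 0) = e x 1 := by
    refine le_antisymm ?_ (not_lt.1 fun hlt => hx.2 ((h x (Metric.mem_ball_self hr)).2 hlt))
    by_contra hlt
    rw [not_le] at hlt
    have ho : IsOpen {y | y ∈ Metric.ball x r ∧ 0 < γ (e y 0) - e y 1} :=
      Metric.isOpen_ball.inter (isOpen_lt continuous_const hc)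
    obtain ⟨y, hy, hyω⟩ := mem_closure_iff.1 hx.1 _ ho
      ⟨Metric.mem_ball_self hr, sub_pos.2 hlt⟩
    have := (h y hy.1).1 hyω
    have := hy.2
    linarith
  have hx' : e.symm !₂[e x 0, γ (e x 0) + 0] = x := by
    rw [add_zero, h0]
    have : (!₂[e x 0, e x 1] : Plane) = e x := by
      ext i; fin_cases i <;> rfl
    simp [this]
  have hK : (0 : ℝ) < 2 + K := by positivity
  let c : GraphChart ω :=
    { e := e, K := K, γ := γ, lip := hγ, t₀ := e x 0, ρ := r / (2 + K), ρ_pos := by positivity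
      mem_iff := fun t s ht hs => by
        have hd := dist_symm_apply_le e hγ t s (e x 0) 0
        rw [hx', sub_zero] at hd
        have : dist (e.symm !₂[t, γ t + s]) x < r := by
          have h1 : (1 + K) * |t - e x 0| ≤ (1 + K) * (r / (2 + K)) := by gcongr
          have h2 : (1 + (K : ℝ)) * (r / (2 + K)) + r / (2 + K) = r := by
            field_simp
            ring
          linarith
        rw [h _ this]
        simp }
  have hρ : 0 < c.ρ / 2 := half_pos c.ρ_pos
  refine ⟨c, ?_, ?_⟩
  · show |e x 0 - e x 0| < c.ρ / 2
    simpa using hρ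
  · show |e x 1 - γ (e x 0)| < c.ρ / 2
    rw [h0, sub_self, abs_zero]
    exact hρ

/-- The boundary is covered by finitely many half boxes. -/
theorem HasLipschitzBoundary.exists_cover {ω : Set Plane} (hω : IsOpen ω)
    (hωb : Bornology.IsBounded ω) (hL : HasLipschitzBoundary ω) :
    ∃ (ι : Type) (_ : Fintype ι) (c : ι → GraphChart ω), frontier ω ⊆ ⋃ i, (c i).halfBox := by
  choose c hc using fun x (hx : x ∈ frontier ω) => hL.exists_chart hω hx
  have hK : IsCompact (frontier ω) := Metric.isCompact_of_isClosed_isBounded isClosed_frontier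
    (hωb.closure.subset frontier_subset_closure)
  obtain ⟨s, hs⟩ := hK.elim_nhds_subcover' (fun x hx => (c x hx).halfBox)
    (fun x hx => (c x hx).isOpen_halfBox.mem_nhds (hc x hx))
  exact ⟨s, inferInstance, fun x => c x x.1.2, by simpa [iUnion_subtype] using hs⟩

theorem isFiniteMeasure_boundaryMeasure {ω : Set Plane} (hω : IsOpen ω)
    (hωb : Bornology.IsBounded ω) (hL : HasLipschitzBoundary ω) :
    IsFiniteMeasure (boundaryMeasure ω) := by
  obtain ⟨ι, _, c, hc⟩ := hL.exists_cover hω hωb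
  refine ⟨?_⟩
  rw [boundaryMeasure, Measure.restrict_apply_univ]
  have h1 : frontier ω ⊆ ⋃ i, (c i).graph '' (c i).interval := fun x hx => by
    obtain ⟨i, hi⟩ := mem_iUnion.1 (hc hx)
    refine mem_iUnion.2 ⟨i, ?_⟩
    rw [← (c i).frontier_inter_box hω]
    exact ⟨hx, (c i).halfBox_subset_box hi⟩
  refine (measure_mono h1).trans_lt ((measure_iUnion_le _).trans_lt ?_)
  rw [tsum_fintype]
  refine ENNReal.sum_lt_top.2 fun i _ => ((c i).hausdorffMeasure_graph_image_le _).trans_lt ?_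
  exact ENNReal.mul_lt_top (by simp) (by simp [GraphChart.interval])

/-! ### Vertical variation near the boundary -/

theorem IsTestFunction.translate {V ω : Set Plane} {φ : Plane → ℝ} (hφ : IsTestFunction V φ)
    {a : Plane} (ha : ∀ x ∈ V, x + a ∈ ω) : IsTestFunction ω fun x => φ (x - a) := by
  have hts : tsupport (fun x => φ (x - a)) = (Homeomorph.subRight a) ⁻¹' tsupport φ :=
    tsupport_comp_eq_preimage φ (Homeomorph.subRight a)
  refine ⟨hφ.smooth.comp (contDiff_id.sub contDiff_const),
    hφ.compactSupport.comp_homeomorph (Homeomorph.subRight a), fun x hx => ?_⟩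
  rw [hts] at hx
  simpa using ha _ (hφ.tsupport_subset hx)

theorem gradient_comp_sub_right (φ : Plane → ℝ) (a x : Plane) :
    gradient (fun y => φ (y - a)) x = gradient φ (x - a) := by
  rw [gradient, gradient, fderiv_comp_sub]

/-- The variation of `u` in the direction `v`: the difference quotients of `u` are dominated by the
averages of `|Du|` over segments. -/
theorem lintegral_translate_sub_le {ω : Set Plane} {u : Plane → ℝ} (hu : Integrable u)
    {ν : Measure Plane} [IsFiniteMeasure ν] {g : Plane → Plane} (hgm : StronglyMeasurable g)
    (hg1 : ∀ x, ‖g x‖ ≤ 1)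
    (hg : ∀ φ, IsTestFunction ω φ → ∫ x in ω, u x • gradient φ x = -∫ x, φ x • g x ∂ν)
    {v : Plane} (hv : ‖v‖ ≤ 1) {h : ℝ} (hh : 0 ≤ h) {V : Set Plane} (hV : IsOpen V)
    (hVω : ∀ x ∈ V, ∀ τ ∈ Icc 0 h, x + τ • v ∈ ω) {B : Set Plane} (hB : MeasurableSet B)
    (hBV : B ⊆ V) :
    ∫⁻ x in B, ‖u (x + h • v) - u x‖ₑ
      ≤ ((ν.prod (volume.restrict (Ioc 0 h))).map fun p => p.1 - p.2 • v) B := by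
  have hmap : Measurable fun p : Plane × ℝ => p.1 - p.2 • v := by fun_prop
  have hgi : Integrable g ν :=
    Integrable.of_bound hgm.aestronglyMeasurable 1 (Eventually.of_forall hg1)
  have : IsFiniteMeasure (volume.restrict (Ioc 0 h)) := ⟨by simp⟩
  refine lintegral_enorm_le_of_forall_integral_le hV
    ((hu.comp_add_right (h • v)).sub hu).integrableOn (fun φ hφ => ?_) hB hBV
  obtain ⟨C, hC⟩ := hφ.exists_bound
  obtain ⟨C', hC'⟩ := hφ.exists_bound_gradient
  have hφt : ∀ τ ∈ Icc 0 h, IsTestFunction ω fun x => φ (x - τ • v) := fun τ hτ =>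
    hφ.translate fun x hx => hVω x hx τ hτ
  have hgc := hφ.continuous_gradient
  have hφc := hφ.continuous
  -- For fixed `τ`, the definition of `Du` is applied to the translate of `φ` by `τ v`.
  have hslice : ∀ τ ∈ Icc 0 h, ∫ x, u x * -inner ℝ (gradient φ (x - τ • v)) v
      = ∫ x, φ (x - τ • v) * inner ℝ (g x) v ∂ν := by
    intro τ hτ
    have i1 : Integrable (fun x => u x • gradient (fun y => φ (y - τ • v)) x)
      (volume.restrict ω) := (hφt τ hτ).integrable_mul_gradient hu.integrableOn
    have i2 : Integrable (fun x => φ (x - τ • v) • g x) ν :=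
      hgi.bdd_smul C (hφt τ hτ).continuous.aestronglyMeasurable
        (Eventually.of_forall fun x => hC _)
    have h1 := congrArg (fun z => inner ℝ v z) (hg _ (hφt τ hτ))
    simp only [inner_neg_right] at h1
    rw [← integral_inner i1, ← integral_inner i2] at h1
    simp only [inner_smul_right] at h1
    rw [setIntegral_eq_integral_of_forall_compl_eq_zero (fun x hx => by
      rw [(hφt τ hτ).gradient_eq_zero_of_notMem hx, inner_zero_right, mul_zero])] at h1
    simp only [gradient_comp_sub_right] at h1
    simp_rw [mul_neg, integral_neg, fun x => real_inner_comm v (gradient φ (x - τ • v)),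
      fun x => real_inner_comm v (g x)]
    linarith
  have hFTC : ∀ x, φ (x - h • v) - φ x = ∫ τ in 0..h, -inner ℝ (gradient φ (x - τ • v)) v := by
    intro x
    have hd : ∀ τ ∈ uIcc 0 h, HasDerivAt (fun τ : ℝ => φ (x - τ • v))
        (-inner ℝ (gradient φ (x - τ • v)) v) τ := by
      intro τ _
      have h1 : HasDerivAt (fun τ : ℝ => x - τ • v) (-((1 : ℝ) • v)) τ :=
        ((hasDerivAt_id τ).smul_const v).const_sub x
      have h2 := (hφ.differentiable (x - τ • v)).hasFDerivAt.comp_hasDerivAt τ h1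
      rw [inner_gradient_left]
      rw [one_smul, map_neg] at h2
      exact h2
    rw [intervalIntegral.integral_eq_sub_of_hasDerivAt hd (by
      apply Continuous.intervalIntegrable; fun_prop)]
    simp
  have hprod : Integrable (fun p : Plane × ℝ => u p.1 * -inner ℝ (gradient φ (p.1 - p.2 • v)) v)
      (volume.prod (volume.restrict (Ioc 0 h))) := by
    refine (hu.comp_fst _).mul_bdd (c := C') ?_ (Eventually.of_forall fun p => ?_)
    · exact Continuous.aestronglyMeasurable (by fun_prop)
    · rw [norm_neg]
      refine (norm_inner_le_norm _ _).trans ?_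
      exact (mul_le_of_le_one_right (norm_nonneg _) hv).trans (hC' _)
  have hib : Integrable (fun p : Plane × ℝ => ‖φ (p.1 - p.2 • v)‖)
      (ν.prod (volume.restrict (Ioc 0 h))) :=
    Integrable.of_bound (Continuous.aestronglyMeasurable (by fun_prop)) C
      (Eventually.of_forall fun p => by rw [norm_norm]; exact hC _)
  have j1 : Integrable fun x => u (x + h • v) * φ x :=
    (hu.comp_add_right (h • v)).mul_bdd (c := C) hφc.aestronglyMeasurable (Eventually.of_forall hC)
  have j2 : Integrable fun x => u x * φ x :=
    hu.mul_bdd (c := C) hφc.aestronglyMeasurable (Eventually.of_forall hC)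
  have j3 : Integrable fun x => u x * φ (x - h • v) :=
    hu.mul_bdd (c := C) (Continuous.aestronglyMeasurable (by fun_prop))
      (Eventually.of_forall fun x => hC _)
  calc ∫ x in V, (u (x + h • v) - u x) * φ x
      = ∫ x, (u (x + h • v) - u x) * φ x :=
        setIntegral_eq_integral_of_forall_compl_eq_zero fun x hx => by
          rw [hφ.eq_zero_of_notMem hx, mul_zero]
    _ = ∫ x, u x * (φ (x - h • v) - φ x) := by
        simp_rw [sub_mul, mul_sub]
        rw [integral_sub j1 j2, integral_sub j3 j2,
          ← integral_add_right_eq_self (fun x => u x * φ (x - h • v)) (h • v)]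
        simp
    _ = ∫ x, ∫ τ in Ioc 0 h, u x * -inner ℝ (gradient φ (x - τ • v)) v := by
        simp_rw [hFTC, intervalIntegral.integral_of_le hh, integral_const_mul]
    _ = ∫ τ in Ioc 0 h, ∫ x, u x * -inner ℝ (gradient φ (x - τ • v)) v :=
        integral_integral_swap hprod
    _ = ∫ τ in Ioc 0 h, ∫ x, φ (x - τ • v) * inner ℝ (g x) v ∂ν :=
        setIntegral_congr_fun measurableSet_Ioc fun τ hτ => hslice τ ⟨hτ.1.le, hτ.2⟩
    _ ≤ ∫ τ in Ioc 0 h, ∫ x, ‖φ (x - τ • v)‖ ∂ν := by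
        refine (Real.le_norm_self _).trans (norm_integral_le_of_norm_le hib.integral_prod_right
          (Eventually.of_forall fun τ => norm_integral_le_of_norm_le ?_
            (Eventually.of_forall fun x => ?_)))
        · exact Integrable.of_bound (Continuous.aestronglyMeasurable (by fun_prop)) C
            (Eventually.of_forall fun p => by rw [norm_norm]; exact hC _)
        · rw [norm_mul]
          refine mul_le_of_le_one_right (norm_nonneg _) ((norm_inner_le_norm _ _).trans ?_)
          exact mul_le_one₀ (hg1 x) (norm_nonneg _) hv
    _ = ∫ x, ‖φ x‖ ∂((ν.prod (volume.restrict (Ioc 0 h))).map fun p => p.1 - p.2 • v) := by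
        rw [integral_map hmap.aemeasurable hφc.norm.aestronglyMeasurable,
          integral_prod_symm _ hib]

/-- `u` is a Borel function, integrable on the plane, whose gradient in `ω` is `g ν` with
`|g| ≤ 1`. -/
structure IsPolarGradient (ω : Set Plane) (u : Plane → ℝ) (ν : Measure Plane) (g : Plane → Plane) :
    Prop where
  measurable : StronglyMeasurable u
  integrable : Integrable u
  measurable_density : StronglyMeasurable g
  norm_le_one : ∀ x, ‖g x‖ ≤ 1
  integral_eq : ∀ φ, IsTestFunction ω φ → ∫ x in ω, u x • gradient φ x = -∫ x, φ x • g x ∂ν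

namespace GraphChart

variable {ω : Set Plane} (c : GraphChart ω)

theorem sub_smul_dir (x : Plane) (τ : ℝ) :
    x - τ • c.dir = c.param (c.absc x, c.height x - τ) := by
  rw [sub_eq_add_neg (c.height x), c.param_add, c.param_absc_height, neg_smul, sub_eq_add_neg]

theorem mem_image_param {S : Set (ℝ × ℝ)} {x : Plane} :
    x ∈ c.param '' S ↔ (c.absc x, c.height x) ∈ S := by
  constructor
  · rintro ⟨p, hp, rfl⟩
    simpa using hp
  · exact fun h => ⟨_, h, c.param_absc_height x⟩

/-- A measure on the plane, in the coordinates of the chart. -/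
noncomputable def pull (ν : Measure Plane) : Measure (ℝ × ℝ) := ν.comap c.param

theorem pull_apply (ν : Measure Plane) (S : Set (ℝ × ℝ)) : c.pull ν S = ν (c.param '' S) :=
  c.measurableEmbedding_param.comap_apply _ _

instance (ν : Measure Plane) [IsFiniteMeasure ν] : IsFiniteMeasure (c.pull ν) :=
  ⟨by rw [c.pull_apply]; exact measure_lt_top _ _⟩

/-- The estimate for vertical translations in a strip over the graph: for fixed `x`, the heights `τ`
for which `x - τ e₂` lies in the strip form an interval of length at most `ε`. -/
theorem lintegral_shift_sub_le {u : Plane → ℝ} {ν : Measure Plane} [IsFiniteMeasure ν]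
    {g : Plane → Plane} (hu : IsPolarGradient ω u ν g) {A : Set ℝ} (hA : MeasurableSet A)
    (hAI : A ⊆ c.interval) {ε h : ℝ} (hh : 0 ≤ h) (hεh : ε + h ≤ c.ρ) :
    ∫⁻ p in A ×ˢ Ioo 0 ε, ‖u (c.param (p.1, p.2 + h)) - u (c.param p)‖ₑ
      ≤ ENNReal.ofReal ε * c.pull ν (A ×ˢ Ioo 0 (ε + h)) := by
  have hAε : MeasurableSet (A ×ˢ Ioo 0 ε) := hA.prod measurableSet_Ioo
  have hB : MeasurableSet (c.param '' (A ×ˢ Ioo 0 ε)) :=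
    c.measurableEmbedding_param.measurableSet_image.2 hAε
  have hS : MeasurableSet (c.param '' (A ×ˢ Ioo 0 (ε + h))) :=
    c.measurableEmbedding_param.measurableSet_image.2 (hA.prod measurableSet_Ioo)
  have hmap : Measurable fun p : Plane × ℝ => p.1 - p.2 • c.dir := by fun_prop
  have h1 := lintegral_translate_sub_le hu.integrable hu.measurable_density hu.norm_le_one
    hu.integral_eq c.norm_dir.le hh (V := c.param '' (c.interval ×ˢ Ioo 0 (c.ρ - h)))
    (c.homeo.isOpenMap _ (isOpen_Ioo.prod isOpen_Ioo)) (by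
      rintro _ ⟨⟨t, s⟩, ⟨ht, hs⟩, rfl⟩ τ hτ
      rw [← c.param_add]
      refine c.param_mem ht ⟨?_, ?_⟩
      · have := hs.1; have := hτ.1; dsimp only at *; linarith
      · have := hs.2; have := hτ.2; dsimp only at *; linarith) hB
    (image_mono (prod_mono hAI (Ioo_subset_Ioo_right (by linarith))))
  rw [← c.measurePreserving_param.setLIntegral_comp_emb c.measurableEmbedding_param] at h1
  simp_rw [fun p : ℝ × ℝ => show c.param p + h • c.dir = c.param (p.1, p.2 + h) from
    (c.param_add p.1 p.2 h).symm] at h1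
  refine h1.trans ?_
  rw [Measure.map_apply hmap hB, Measure.prod_apply (hmap hB), c.pull_apply,
    ← lintegral_indicator_const hS]
  refine lintegral_mono fun x => ?_
  rw [Measure.restrict_apply (measurable_prodMk_left (hmap hB))]
  have hmem : ∀ τ, τ ∈ Prod.mk x ⁻¹' ((fun p : Plane × ℝ => p.1 - p.2 • c.dir) ⁻¹'
      (c.param '' (A ×ˢ Ioo 0 ε))) ↔ c.absc x ∈ A ∧ 0 < c.height x - τ ∧ c.height x - τ < ε := by
    intro τ
    rw [mem_preimage, mem_preimage, c.sub_smul_dir, c.mem_image_param]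
    simp
  by_cases hx : x ∈ c.param '' (A ×ˢ Ioo 0 (ε + h))
  · rw [indicator_of_mem hx]
    calc volume _ ≤ volume (Ioo (c.height x - ε) (c.height x)) := by
          refine measure_mono fun τ hτ => ?_
          obtain ⟨_, h2, h3⟩ := (hmem τ).1 hτ.1
          exact ⟨by linarith, by linarith⟩
      _ = ENNReal.ofReal ε := by simp
  · rw [indicator_of_notMem hx, nonpos_iff_eq_zero]
    convert measure_empty (μ := (volume : Measure ℝ))
    refine eq_empty_of_forall_notMem fun τ hτ => hx ?_
    obtain ⟨h0, h2, h3⟩ := (hmem τ).1 hτ.1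
    rw [c.mem_image_param]
    exact ⟨h0, by have := hτ.2.1; dsimp only; linarith, by have := hτ.2.2; dsimp only; linarith⟩

end GraphChart

/-- Differences of two values of a function of one variable, in terms of its increments. The pairs
`(s, s')` with `s' ≤ s` are exchanged with those for which `s ≤ s'`. -/
theorem lintegral_lintegral_sub_le {f : ℝ → ℝ} (hf : Measurable f) {ε δ : ℝ}
    (hεδ : ε ≤ δ) :
    ∫⁻ s in Ioo 0 ε, ∫⁻ s' in Ioo 0 δ, ‖f s' - f s‖ₑ
      ≤ 2 * ∫⁻ s in Ioo 0 ε, ∫⁻ h in Ioo 0 δ, ‖f (s + h) - f s‖ₑ := by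
  have hF : Measurable fun p : ℝ × ℝ => ‖f p.2 - f p.1‖ₑ :=
    ((hf.comp measurable_snd).sub (hf.comp measurable_fst)).enorm
  have hshift : ∀ s, ∫⁻ s' in Ioo s (s + δ), ‖f s' - f s‖ₑ
      = ∫⁻ h in Ioo 0 δ, ‖f (s + h) - f s‖ₑ := fun s => by
    rw [← (measurePreserving_add_left (volume : Measure ℝ) s).setLIntegral_comp_preimage_emb
      (measurableEmbedding_addLeft s)]
    simp
  have h1 : ∀ s ∈ Ioo 0 ε, ∫⁻ s' in Ioo 0 δ, ‖f s' - f s‖ₑ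
      ≤ (∫⁻ h in Ioo 0 δ, ‖f (s + h) - f s‖ₑ) + ∫⁻ s' in Ioc 0 s, ‖f s' - f s‖ₑ := by
    intro s hs
    rw [← hshift]
    refine (lintegral_mono_set (t := Ioo s (s + δ) ∪ Ioc 0 s) fun s' hs' => ?_).trans
      (lintegral_union_le _ _ _)
    rcases le_or_gt s' s with h | h
    · exact Or.inr ⟨hs'.1, h⟩
    · exact Or.inl ⟨h, by linarith [hs.1, hs'.2]⟩
  have h2 : ∫⁻ s in Ioo 0 ε, ∫⁻ s' in Ioc 0 s, ‖f s' - f s‖ₑ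
      ≤ ∫⁻ s in Ioo 0 ε, ∫⁻ h in Ioo 0 δ, ‖f (s + h) - f s‖ₑ := by
    let G : ℝ × ℝ → ℝ≥0∞ := {p : ℝ × ℝ | 0 < p.2 ∧ p.2 ≤ p.1 ∧ p.1 < ε}.indicator
      fun p => ‖f p.2 - f p.1‖ₑ
    have hG : Measurable G :=
      hF.indicator <| (measurableSet_lt measurable_const measurable_snd).inter
      ((measurableSet_le measurable_snd measurable_fst).inter
        (measurableSet_lt measurable_fst measurable_const))
    calc ∫⁻ s in Ioo 0 ε, ∫⁻ s' in Ioc 0 s, ‖f s' - f s‖ₑ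
        ≤ ∫⁻ s, ∫⁻ s', G (s, s') := by
          rw [← lintegral_indicator measurableSet_Ioo]
          refine lintegral_mono fun s => ?_
          by_cases hs : s ∈ Ioo 0 ε
          · rw [indicator_of_mem hs, ← lintegral_indicator measurableSet_Ioc]
            refine lintegral_mono fun s' => ?_
            by_cases hs' : s' ∈ Ioc 0 s
            · rw [indicator_of_mem hs', show G (s, s') = ‖f s' - f s‖ₑ from
                indicator_of_mem (a := (s, s'))
                  (s := {p : ℝ × ℝ | 0 < p.2 ∧ p.2 ≤ p.1 ∧ p.1 < ε}) ⟨hs'.1, hs'.2, hs.2⟩ _]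
            · rw [indicator_of_notMem hs']; exact zero_le
          · rw [indicator_of_notMem hs]; exact zero_le
      _ = ∫⁻ s', ∫⁻ s, G (s, s') := lintegral_lintegral_swap hG.aemeasurable
      _ ≤ ∫⁻ s in Ioo 0 ε, ∫⁻ s' in Ico s (s + δ), ‖f s' - f s‖ₑ := by
          rw [← lintegral_indicator measurableSet_Ioo]
          refine lintegral_mono fun s' => ?_
          by_cases hs' : s' ∈ Ioo 0 ε
          · rw [indicator_of_mem hs', ← lintegral_indicator measurableSet_Ico]
            refine lintegral_mono fun s => ?_
            by_cases hs : (s, s') ∈ {p : ℝ × ℝ | 0 < p.2 ∧ p.2 ≤ p.1 ∧ p.1 < ε}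
            · rw [indicator_of_mem (show s ∈ Ico s' (s' + δ) from ⟨hs.2.1, by
                have := hs.2.2; have := hs'.1; dsimp only at *; linarith⟩)]
              refine (indicator_le_self _ _ _).trans ?_
              rw [enorm_sub_rev]
            · rw [show G (s, s') = 0 from indicator_of_notMem hs _]; exact zero_le
          · rw [indicator_of_notMem hs', nonpos_iff_eq_zero]
            refine lintegral_eq_zero_of_ae_eq_zero (Eventually.of_forall fun s => ?_)
            refine indicator_of_notMem (fun h => hs' ⟨h.1, lt_of_le_of_lt h.2.1 h.2.2⟩) _
      _ = _ := by
          refine lintegral_congr fun s => ?_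
          rw [← hshift, setLIntegral_congr Ioo_ae_eq_Ico]
  have hm : Measurable fun s => ∫⁻ h in Ioo 0 δ, ‖f (s + h) - f s‖ₑ := by
    refine Measurable.lintegral_prod_right' (f := fun p : ℝ × ℝ => ‖f (p.1 + p.2) - f p.1‖ₑ) ?_
    exact ((hf.comp (measurable_fst.add measurable_snd)).sub (hf.comp measurable_fst)).enorm
  refine (setLIntegral_mono' measurableSet_Ioo h1).trans ?_
  rw [lintegral_add_left hm, two_mul]
  gcongr

/-! ### Boundary values in a chart -/

namespace GraphChart

variable {ω : Set Plane} (c : GraphChart ω) {u : Plane → ℝ} {ν : Measure Plane}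
  {g : Plane → Plane}

/-- The mean oscillation of `u` on the vertical segments in a strip is controlled by `|Du|`. -/
theorem lintegral_sub_le [IsFiniteMeasure ν] (hu : IsPolarGradient ω u ν g) {A : Set ℝ}
    (hA : MeasurableSet A) (hAI : A ⊆ c.interval) {ε δ : ℝ} (hεδ : ε ≤ δ) (hδ : 2 * δ ≤ c.ρ) :
    ∫⁻ t in A, ∫⁻ s in Ioo 0 ε, ∫⁻ s' in Ioo 0 δ, ‖u (c.param (t, s')) - u (c.param (t, s))‖ₑ
      ≤ 2 * ENNReal.ofReal ε * ENNReal.ofReal δ * c.pull ν (A ×ˢ Ioo 0 (2 * δ)) := by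
  have hw : Measurable fun p => u (c.param p) :=
    hu.measurable.measurable.comp c.continuous_param.measurable
  have h3 : Measurable fun q : (ℝ × ℝ) × ℝ =>
      ‖u (c.param (q.1.1, q.1.2 + q.2)) - u (c.param q.1)‖ₑ :=
    ((hw.comp ((measurable_fst.comp measurable_fst).prodMk
      ((measurable_snd.comp measurable_fst).add measurable_snd))).sub
      (hw.comp measurable_fst)).enorm
  have h4 : Measurable fun p : ℝ × ℝ =>
      ∫⁻ h in Ioo 0 δ, ‖u (c.param (p.1, p.2 + h)) - u (c.param p)‖ₑ :=
    Measurable.lintegral_prod_right' (f := fun q : (ℝ × ℝ) × ℝ =>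
      ‖u (c.param (q.1.1, q.1.2 + q.2)) - u (c.param q.1)‖ₑ) h3
  have h5 : Measurable fun t => ∫⁻ s in Ioo 0 ε, ∫⁻ h in Ioo 0 δ,
      ‖u (c.param (t, s + h)) - u (c.param (t, s))‖ₑ :=
    Measurable.lintegral_prod_right' (f := fun p : ℝ × ℝ =>
      ∫⁻ h in Ioo 0 δ, ‖u (c.param (p.1, p.2 + h)) - u (c.param p)‖ₑ) h4
  calc _ ≤ ∫⁻ t in A, 2 * ∫⁻ s in Ioo 0 ε, ∫⁻ h in Ioo 0 δ,
        ‖u (c.param (t, s + h)) - u (c.param (t, s))‖ₑ :=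
        lintegral_mono fun t =>
          lintegral_lintegral_sub_le (f := fun s => u (c.param (t, s)))
            (hw.comp measurable_prodMk_left) hεδ
    _ = 2 * ∫⁻ h in Ioo 0 δ, ∫⁻ p in A ×ˢ Ioo 0 ε,
        ‖u (c.param (p.1, p.2 + h)) - u (c.param p)‖ₑ := by
        rw [lintegral_const_mul _ h5]
        congr 1
        exact (setLIntegral_prod _ h4.aemeasurable).symm.trans
          (lintegral_lintegral_swap h3.aemeasurable)
    _ ≤ 2 * ∫⁻ h in Ioo 0 δ, ENNReal.ofReal ε * c.pull ν (A ×ˢ Ioo 0 (2 * δ)) := by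
        gcongr 2 * ?_
        refine setLIntegral_mono' measurableSet_Ioo fun h hh => ?_
        refine (c.lintegral_shift_sub_le hu hA hAI hh.1.le (by linarith [hh.2])).trans ?_
        gcongr
        linarith [hh.2]
    _ = _ := by
        rw [setLIntegral_const, Real.volume_Ioo, sub_zero]
        ring

/-- The mean value of `u` over the vertical segment of length `d` that starts at a point of the
graph. -/
noncomputable def segmentAverage (u : Plane → ℝ) (d t : ℝ) : ℝ :=
  d⁻¹ * ∫ s in Ioo 0 d, u (c.param (t, s))

theorem integrable_comp_param (hu : IsPolarGradient ω u ν g) :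
    Integrable (fun p => u (c.param p)) ((volume : Measure ℝ).prod volume) :=
  (c.measurePreserving_param.integrable_comp_emb c.measurableEmbedding_param).2 hu.integrable

theorem integrable_segmentAverage (hu : IsPolarGradient ω u ν g) (d : ℝ) :
    Integrable (c.segmentAverage u d) := by
  have h := (c.integrable_comp_param hu).mono_measure
    (show (volume : Measure ℝ).prod (volume.restrict (Ioo 0 d)) ≤ volume.prod volume by
      have h1 := Measure.prod_restrict (μ := (volume : Measure ℝ)) (ν := (volume : Measure ℝ))
        univ (Ioo 0 d)
      rw [Measure.restrict_univ] at h1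
      rw [h1]
      exact Measure.restrict_le_self)
  exact h.integral_prod_left.const_mul _

/-- On almost every vertical line `u` is integrable, so that its segment averages are genuine mean
values. -/
theorem ae_enorm_segmentAverage_sub_le (hu : IsPolarGradient ω u ν g) :
    ∀ᵐ t, ∀ d > 0, ∀ x, ‖c.segmentAverage u d t - x‖ₑ
      ≤ (ENNReal.ofReal d)⁻¹ * ∫⁻ s in Ioo 0 d, ‖u (c.param (t, s)) - x‖ₑ := by
  filter_upwards [(c.integrable_comp_param hu).prod_right_ae] with t ht d hd x
  have h1 : c.segmentAverage u d t - x = d⁻¹ * ∫ s in Ioo 0 d, (u (c.param (t, s)) - x) := by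
    rw [integral_sub ht.integrableOn (by simp), segmentAverage, mul_sub]
    simp [hd.le, hd.ne']
  rw [h1, enorm_mul, enorm_inv hd.ne', Real.enorm_of_nonneg hd.le]
  gcongr
  exact enorm_integral_le_lintegral_enorm _

theorem lintegral_sub_segmentAverage_le [IsFiniteMeasure ν] (hu : IsPolarGradient ω u ν g)
    {A : Set ℝ} (hA : MeasurableSet A) (hAI : A ⊆ c.interval) {d δ : ℝ} (hd : 0 < d) (hdδ : d ≤ δ)
    (hδ : 2 * δ ≤ c.ρ) :
    ∫⁻ t in A, ∫⁻ s in Ioo 0 δ, ‖u (c.param (t, s)) - c.segmentAverage u d t‖ₑ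
      ≤ 2 * ENNReal.ofReal δ * c.pull ν (A ×ˢ Ioo 0 (2 * δ)) := by
  have hw : Measurable fun p => u (c.param p) :=
    hu.measurable.measurable.comp c.continuous_param.measurable
  have h1 : ∀ t, Measurable fun p : ℝ × ℝ => ‖u (c.param (t, p.2)) - u (c.param (t, p.1))‖ₑ :=
    fun t => ((hw.comp (measurable_const.prodMk measurable_snd)).sub
      (hw.comp (measurable_const.prodMk measurable_fst))).enorm
  have hd0 : ENNReal.ofReal d ≠ 0 := by simpa using hd
  calc _ ≤ ∫⁻ t in A, (ENNReal.ofReal d)⁻¹ * ∫⁻ s in Ioo 0 d, ∫⁻ s' in Ioo 0 δ,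
        ‖u (c.param (t, s')) - u (c.param (t, s))‖ₑ := by
        refine lintegral_mono_ae (ae_restrict_of_ae ?_)
        filter_upwards [c.ae_enorm_segmentAverage_sub_le hu] with t ht
        rw [lintegral_lintegral_swap (h1 t).aemeasurable,
          ← lintegral_const_mul' _ _ (ENNReal.inv_ne_top.2 hd0)]
        refine lintegral_mono fun s => ?_
        rw [enorm_sub_rev]
        exact (ht d hd _).trans_eq
          (congrArg _ (lintegral_congr fun s' => enorm_sub_rev _ _))
    _ = (ENNReal.ofReal d)⁻¹ * ∫⁻ t in A, ∫⁻ s in Ioo 0 d, ∫⁻ s' in Ioo 0 δ,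
        ‖u (c.param (t, s')) - u (c.param (t, s))‖ₑ :=
        lintegral_const_mul' _ _ (ENNReal.inv_ne_top.2 hd0)
    _ ≤ (ENNReal.ofReal d)⁻¹ * (2 * ENNReal.ofReal d * ENNReal.ofReal δ
        * c.pull ν (A ×ˢ Ioo 0 (2 * δ))) := by
        gcongr
        exact c.lintegral_sub_le hu hA hAI hdδ hδ
    _ = ((ENNReal.ofReal d)⁻¹ * ENNReal.ofReal d) * (2 * ENNReal.ofReal δ
        * c.pull ν (A ×ˢ Ioo 0 (2 * δ))) := by ring
    _ = _ := by rw [ENNReal.inv_mul_cancel hd0 ENNReal.ofReal_ne_top, one_mul]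

theorem lintegral_segmentAverage_sub_le [IsFiniteMeasure ν] (hu : IsPolarGradient ω u ν g)
    {A : Set ℝ} (hA : MeasurableSet A) (hAI : A ⊆ c.interval) {d δ : ℝ} (hd : 0 < d) (hdδ : d ≤ δ)
    (hδ : 2 * δ ≤ c.ρ) :
    ∫⁻ t in A, ‖c.segmentAverage u δ t - c.segmentAverage u d t‖ₑ
      ≤ 2 * c.pull ν (A ×ˢ Ioo 0 (2 * δ)) := by
  have hδ0 : ENNReal.ofReal δ ≠ 0 := by simpa using hd.trans_le hdδ
  calc _ ≤ ∫⁻ t in A, (ENNReal.ofReal δ)⁻¹ *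
        ∫⁻ s in Ioo 0 δ, ‖u (c.param (t, s)) - c.segmentAverage u d t‖ₑ := by
        refine lintegral_mono_ae (ae_restrict_of_ae ?_)
        filter_upwards [c.ae_enorm_segmentAverage_sub_le hu] with t ht using
          ht δ (hd.trans_le hdδ) _
    _ = (ENNReal.ofReal δ)⁻¹ * ∫⁻ t in A,
        ∫⁻ s in Ioo 0 δ, ‖u (c.param (t, s)) - c.segmentAverage u d t‖ₑ :=
        lintegral_const_mul' _ _ (by simpa using hδ0)
    _ ≤ (ENNReal.ofReal δ)⁻¹ * (2 * ENNReal.ofReal δ * c.pull ν (A ×ˢ Ioo 0 (2 * δ))) := by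
        gcongr
        exact c.lintegral_sub_segmentAverage_le hu hA hAI hd hdδ hδ
    _ = ((ENNReal.ofReal δ)⁻¹ * ENNReal.ofReal δ) * (2 * c.pull ν (A ×ˢ Ioo 0 (2 * δ))) := by ring
    _ = _ := by rw [ENNReal.inv_mul_cancel hδ0 ENNReal.ofReal_ne_top, one_mul]

/-- A finite measure gives vanishing mass to thin open strips over the graph, because these have
empty intersection. -/
theorem tendsto_pull_strip (ν : Measure Plane) [IsFiniteMeasure ν] {d : ℕ → ℝ} (hd : Antitone d)
    (h0 : Tendsto d atTop (𝓝 0)) {A : Set ℝ} (hA : MeasurableSet A) :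
    Tendsto (fun n => c.pull ν (A ×ˢ Ioo 0 (d n))) atTop (𝓝 0) := by
  have h := tendsto_measure_iInter_atTop (μ := c.pull ν) (s := fun n => A ×ˢ Ioo 0 (d n))
    (fun n => (hA.prod measurableSet_Ioo).nullMeasurableSet)
    (fun m n hmn => prod_mono_right (Ioo_subset_Ioo_right (hd hmn))) ⟨0, measure_ne_top _ _⟩
  have he : ⋂ n, A ×ˢ Ioo 0 (d n) = ∅ := by
    refine eq_empty_of_forall_notMem fun p hp => ?_
    rw [mem_iInter] at hp
    have h1 : p.2 ≤ 0 := ge_of_tendsto' h0 fun n => (hp n).2.2.le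
    exact absurd (hp 0).2.1 (not_lt.2 h1)
  rwa [he, measure_empty] at h

/-- The averages of `u` over short vertical segments converge in `L¹`; the distance of `u` to the
limit near the graph is controlled by `|Du|`. -/
theorem exists_graphTrace [IsFiniteMeasure ν] (hu : IsPolarGradient ω u ν g) :
    ∃ f : ℝ → ℝ, StronglyMeasurable f ∧ Integrable f ∧
      ∀ A, MeasurableSet A → A ⊆ c.interval → ∀ δ, 0 < δ → 2 * δ ≤ c.ρ →
        ∫⁻ t in A, ∫⁻ s in Ioo 0 δ, ‖u (c.param (t, s)) - f t‖ₑ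
          ≤ 2 * ENNReal.ofReal δ * c.pull ν (A ×ˢ Ioo 0 (2 * δ)) := by
  have hρ := c.ρ_pos
  have hI : MeasurableSet c.interval := measurableSet_Ioo
  let d : ℕ → ℝ := fun n => c.ρ / 2 * (1 / ((n : ℝ) + 1))
  have hd0 : ∀ n, 0 < d n := fun n => by positivity
  have hda : Antitone d := fun m n hmn => by
    refine mul_le_mul_of_nonneg_left (one_div_le_one_div_of_le (by positivity) ?_) (by positivity)
    have : (m : ℝ) ≤ n := by exact_mod_cast hmn
    linarith
  have hdρ : ∀ n, 2 * d n ≤ c.ρ := fun n => by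
    have : d n ≤ d 0 := hda (Nat.zero_le n)
    have h0 : d 0 = c.ρ / 2 := by simp [d]
    linarith
  have hdl : Tendsto d atTop (𝓝 0) := by
    have := (tendsto_one_div_add_atTop_nhds_zero_nat (𝕜 := ℝ)).const_mul (c.ρ / 2)
    rwa [mul_zero] at this
  have h2dl : Tendsto (fun n => 2 * d n) atTop (𝓝 0) := by simpa using hdl.const_mul 2
  have h2da : Antitone fun n => 2 * d n := fun m n hmn => by
    have := hda hmn
    dsimp only
    linarith
  have hb := c.tendsto_pull_strip ν h2da h2dl hI
  let a : ℕ → ℝ → ℝ := fun n => c.segmentAverage u (d n)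
  have ha : ∀ n, MemLp (a n) 1 (volume.restrict c.interval) := fun n =>
    memLp_one_iff_integrable.2 (c.integrable_segmentAverage hu _).integrableOn
  have hdist : ∀ m n, m ≤ n → edist ((ha m).toLp) ((ha n).toLp)
      ≤ 2 * c.pull ν (c.interval ×ˢ Ioo 0 (2 * d m)) := fun m n hmn => by
    rw [Lp.edist_toLp_toLp, eLpNorm_one_eq_lintegral_enorm]
    exact c.lintegral_segmentAverage_sub_le hu hI subset_rfl (hd0 n) (hda hmn) (hdρ m)
  have hcau : CauchySeq fun n => (ha n).toLp := by
    rw [EMetric.cauchySeq_iff_le_tendsto_0]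
    refine ⟨fun N => 4 * c.pull ν (c.interval ×ˢ Ioo 0 (2 * d N)), fun n m N hn hm => ?_, ?_⟩
    · refine (edist_triangle_left _ _ ((ha N).toLp)).trans ?_
      refine (add_le_add (hdist N n hn) (hdist N m hm)).trans (le_of_eq ?_)
      rw [← add_mul]
      norm_num
    · simpa using ENNReal.Tendsto.const_mul hb (Or.inr (by simp : (4 : ℝ≥0∞) ≠ ∞))
  obtain ⟨F, hF⟩ := cauchySeq_tendsto_of_complete hcau
  have hFm := Lp.stronglyMeasurable F
  refine ⟨c.interval.indicator F, hFm.indicator hI, IntegrableOn.integrable_indicator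
    (L1.integrable_coeFn F) hI, fun A hA hAI δ hδ hδρ => ?_⟩
  rw [setLIntegral_congr_fun hA (g := fun t => ∫⁻ s in Ioo 0 δ, ‖u (c.param (t, s)) - F t‖ₑ)
    fun t ht => by simp only [indicator_of_mem (hAI ht)]]
  have hlim : Tendsto (fun n => ∫⁻ t in c.interval, ‖a n t - F t‖ₑ) atTop (𝓝 0) := by
    have := (Lp.tendsto_Lp_iff_tendsto_eLpNorm'' a ha F (Lp.memLp F)).1 (by rwa [Lp.toLp_coeFn])
    simpa only [eLpNorm_one_eq_lintegral_enorm] using! this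
  have hlim2 := (ENNReal.Tendsto.const_mul hlim
    (Or.inr (ENNReal.ofReal_ne_top (r := δ)))).const_add
      (2 * ENNReal.ofReal δ * c.pull ν (A ×ˢ Ioo 0 (2 * δ)))
  rw [mul_zero, add_zero] at hlim2
  refine ge_of_tendsto hlim2 ?_
  filter_upwards [hdl.eventually (ge_mem_nhds hδ)] with n hn
  have hw : Measurable fun p => u (c.param p) :=
    hu.measurable.measurable.comp c.continuous_param.measurable
  calc ∫⁻ t in A, ∫⁻ s in Ioo 0 δ, ‖u (c.param (t, s)) - F t‖ₑ
      ≤ ∫⁻ t in A, ((∫⁻ s in Ioo 0 δ, ‖u (c.param (t, s)) - a n t‖ₑ)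
        + ENNReal.ofReal δ * ‖a n t - F t‖ₑ) := by
        refine lintegral_mono fun t => ?_
        have : ENNReal.ofReal δ * ‖a n t - F t‖ₑ = ∫⁻ s in Ioo 0 δ, ‖a n t - F t‖ₑ := by
          rw [setLIntegral_const, Real.volume_Ioo, sub_zero, mul_comm]
        rw [this, ← lintegral_add_right _ measurable_const]
        refine lintegral_mono fun s => ?_
        simpa only [edist_eq_enorm_sub] using edist_triangle (u (c.param (t, s))) (a n t) (F t)
    _ = (∫⁻ t in A, ∫⁻ s in Ioo 0 δ, ‖u (c.param (t, s)) - a n t‖ₑ)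
        + ∫⁻ t in A, ENNReal.ofReal δ * ‖a n t - F t‖ₑ := by
        refine lintegral_add_right' _ (AEMeasurable.const_mul ?_ _)
        exact ((c.integrable_segmentAverage hu _).1.restrict.sub
          hFm.aestronglyMeasurable).enorm
    _ ≤ _ := by
        rw [lintegral_const_mul' _ _ ENNReal.ofReal_ne_top]
        gcongr
        exact c.lintegral_sub_segmentAverage_le hu hA hAI (hd0 n) hn hδρ

end GraphChart

/-! ### Boundary values as approximate limits -/

theorem setAverage_abs_sub_eq {ω : Set Plane} {u : Plane → ℝ}
    (hu : AEStronglyMeasurable u (volume.restrict ω)) (x : Plane) (t r : ℝ) :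
    ⨍ y in ω ∩ Metric.ball x r, |u y - t|
      = ((∫⁻ y in ω ∩ Metric.ball x r, ‖u y - t‖ₑ) / volume (ω ∩ Metric.ball x r)).toReal := by
  have h1 : AEStronglyMeasurable (fun y => u y - t) (volume.restrict (ω ∩ Metric.ball x r)) :=
    (hu.mono_measure (Measure.restrict_mono inter_subset_left le_rfl)).sub
      aestronglyMeasurable_const
  simp_rw [← Real.norm_eq_abs]
  rw [setAverage_eq, integral_norm_eq_lintegral_enorm h1, ENNReal.toReal_div, smul_eq_mul,
    div_eq_inv_mul, Measure.real]

theorem isTraceAt_of_tendsto {ω : Set Plane} {u : Plane → ℝ}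
    (hu : AEStronglyMeasurable u (volume.restrict ω)) {x : Plane} {t : ℝ}
    (h : Tendsto (fun r => (∫⁻ y in ω ∩ Metric.ball x r, ‖u y - t‖ₑ)
      / volume (ω ∩ Metric.ball x r)) (𝓝[>] 0) (𝓝 0)) :
    IsTraceAt ω u x t := by
  unfold IsTraceAt
  simp_rw [setAverage_abs_sub_eq hu]
  exact (ENNReal.tendsto_toReal ENNReal.zero_ne_top).comp h

namespace GraphChart

variable {ω : Set Plane} (c : GraphChart ω)

theorem volume_image_param (S : Set (ℝ × ℝ)) : volume (c.param '' S) = volume S := by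
  rw [← c.measurePreserving_param.measure_preimage_emb c.measurableEmbedding_param,
    preimage_image_eq _ c.measurableEmbedding_param.injective]

/-- The radius below which a ball around a point of the graph stays in the box. -/
noncomputable def radius (t : ℝ) : ℝ := min (c.ρ - |t - c.t₀|) (c.ρ / (1 + c.K))

theorem radius_pos {t : ℝ} (ht : t ∈ c.interval) : 0 < c.radius t := by
  have := c.mem_interval.1 ht
  have := c.ρ_pos
  exact lt_min (by linarith) (by positivity)

theorem mem_interval_of_lt_radius {t t' r : ℝ} (hr : r ≤ c.radius t) (h : |t' - t| < r) :
    t' ∈ c.interval := by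
  rw [c.mem_interval]
  have h1 := hr.trans (min_le_left _ _)
  have h2 := abs_sub_le t' t c.t₀
  linarith

theorem le_of_le_radius {t r : ℝ} (hr : r ≤ c.radius t) : (1 + c.K) * r ≤ c.ρ := by
  have h1 := hr.trans (min_le_right _ _)
  rwa [le_div_iff₀ (by positivity), mul_comm] at h1

/-- `ω` contains a fixed proportion of small balls around boundary points, because it contains a
rectangle, in the coordinates of the chart, of comparable size. -/
theorem le_volume_inter_ball {t r : ℝ} (hr0 : 0 < r) (hr : r ≤ c.radius t) :
    ENNReal.ofReal (2 * r / (2 + c.K)) * ENNReal.ofReal (r / (2 + c.K))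
      ≤ volume (ω ∩ Metric.ball (c.graph t) r) := by
  have hK : (0 : ℝ) ≤ c.K := c.K.2
  set κ := r / (2 + c.K)
  have hκr : κ < r := (div_lt_self hr0 (by linarith))
  have hκ : (1 + (c.K : ℝ)) * κ + κ = r := by
    have : (2 + (c.K : ℝ)) ≠ 0 := by positivity
    simp only [κ]
    field_simp
    ring
  have hκρ : κ ≤ c.ρ := by
    have := c.le_of_le_radius hr
    nlinarith
  calc _ = volume (c.param '' (Ioo (t - κ) (t + κ) ×ˢ Ioo 0 κ)) := by
        rw [c.volume_image_param, Measure.volume_eq_prod, Measure.prod_prod, Real.volume_Ioo,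
          Real.volume_Ioo, sub_zero]
        congr 2
        simp only [κ]
        ring
    _ ≤ _ := by
        refine measure_mono ?_
        rintro _ ⟨⟨t', s⟩, ⟨ht', hs⟩, rfl⟩
        simp only at ht' hs
        have ha : |t' - t| < κ := by
          rw [abs_sub_lt_iff]
          constructor <;> linarith [ht'.1, ht'.2]
        refine ⟨c.param_mem (c.mem_interval_of_lt_radius hr (ha.trans hκr))
          ⟨hs.1, hs.2.trans_le hκρ⟩, ?_⟩
        rw [Metric.mem_ball, graph]
        refine (c.dist_param_le _ _ _ _).trans_lt ?_
        rw [sub_zero, abs_of_pos hs.1]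
        have := mul_le_mul_of_nonneg_left ha.le (by positivity : 0 ≤ 1 + (c.K : ℝ))
        linarith [hs.2]

theorem inter_ball_subset {t r : ℝ} (hr : r ≤ c.radius t) :
    ω ∩ Metric.ball (c.graph t) r
      ⊆ c.param '' (Ioo (t - r) (t + r) ×ˢ Ioo 0 ((1 + c.K) * r)) := by
  rintro x ⟨hxω, hx⟩
  rw [Metric.mem_ball] at hx
  have h1 : |c.absc x - t| < r := by
    have := c.lipschitz_absc.dist_le_mul x (c.graph t)
    rw [c.absc_graph, Real.dist_eq, NNReal.coe_one, one_mul] at this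
    linarith
  have h2 : |c.height x| < (1 + c.K) * r := by
    have := c.lipschitz_height.dist_le_mul x (c.graph t)
    rw [c.height_graph, Real.dist_eq, sub_zero] at this
    refine this.trans_lt ?_
    push_cast
    have : (0 : ℝ) < 1 + c.K := by positivity
    gcongr
  have hbox : x ∈ c.box := ⟨c.mem_interval.1 (c.mem_interval_of_lt_radius hr h1),
    h2.trans_le (c.le_of_le_radius hr)⟩
  rw [c.mem_image_param]
  have h3 := abs_sub_lt_iff.1 h1
  exact ⟨⟨by dsimp only; linarith, by dsimp only; linarith⟩, (c.mem_iff_height_pos hbox).1 hxω,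
    (le_abs_self _).trans_lt h2⟩

theorem lintegral_image_param {F : Plane → ℝ≥0∞} (hF : Measurable F) (A B : Set ℝ) :
    ∫⁻ x in c.param '' (A ×ˢ B), F x = ∫⁻ t in A, ∫⁻ s in B, F (c.param (t, s)) := by
  rw [← c.measurePreserving_param.setLIntegral_comp_emb c.measurableEmbedding_param,
    Measure.volume_eq_prod, setLIntegral_prod]
  exact (hF.comp c.continuous_param.measurable).aemeasurable

/-- Approximate limits may be computed with rectangles of height `(1 + K) r` over the graph in place
of the sets `ω ∩ B_r`. -/
theorem tendsto_of_tendsto_strip {u : Plane → ℝ} (hu : Measurable u) {t a : ℝ}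
    (ht : t ∈ c.interval)
    (h : Tendsto (fun r => (∫⁻ t' in Ioo (t - r) (t + r), ∫⁻ s in Ioo 0 ((1 + c.K) * r),
      ‖u (c.param (t', s)) - a‖ₑ) / (ENNReal.ofReal r * ENNReal.ofReal r)) (𝓝[>] 0) (𝓝 0)) :
    IsTraceAt ω u (c.graph t) a := by
  refine isTraceAt_of_tendsto hu.aestronglyMeasurable ?_
  set M : ℝ≥0∞ := (ENNReal.ofReal (2 / (2 + c.K)) * ENNReal.ofReal (1 / (2 + c.K)))⁻¹
  have hK : (0 : ℝ) < 2 + c.K := by positivity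
  have hM0 : ENNReal.ofReal (2 / (2 + c.K)) * ENNReal.ofReal (1 / (2 + c.K)) ≠ 0 := by
    refine mul_ne_zero ?_ ?_ <;> rw [ENNReal.ofReal_ne_zero_iff] <;> positivity
  have hM : M ≠ ∞ := ENNReal.inv_ne_top.2 hM0
  have h2 := ENNReal.Tendsto.const_mul (a := M) h (Or.inr hM)
  rw [mul_zero] at h2
  refine tendsto_of_tendsto_of_tendsto_of_le_of_le' tendsto_const_nhds h2
    (Eventually.of_forall fun _ => zero_le) ?_
  filter_upwards [Ioo_mem_nhdsGT (c.radius_pos ht)] with r hr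
  have e : (ENNReal.ofReal (2 / (2 + c.K)) * ENNReal.ofReal (1 / (2 + c.K)))
      * (ENNReal.ofReal r * ENNReal.ofReal r)
      = ENNReal.ofReal (2 * r / (2 + c.K)) * ENNReal.ofReal (r / (2 + c.K)) := by
    rw [mul_mul_mul_comm, ← ENNReal.ofReal_mul (by positivity),
      ← ENNReal.ofReal_mul (by positivity)]
    congr 2 <;> ring
  have e2 : ∀ X, M * (X / (ENNReal.ofReal r * ENNReal.ofReal r))
      = X * (ENNReal.ofReal (2 * r / (2 + c.K)) * ENNReal.ofReal (r / (2 + c.K)))⁻¹ := fun X => by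
    rw [← e, ENNReal.mul_inv (Or.inl hM0) (Or.inl (by finiteness)), div_eq_mul_inv]
    exact mul_left_comm _ _ _
  rw [e2, div_eq_mul_inv]
  refine mul_le_mul' ?_ (ENNReal.inv_le_inv.2 (c.le_volume_inter_ball hr.1 hr.2.le))
  rw [← c.lintegral_image_param (F := fun x => ‖u x - a‖ₑ) (hu.sub_const a).enorm]
  exact lintegral_mono_set (c.inter_ball_subset hr.2.le)

/-- A finite measure, such as `|Du|`, gives mass `o(r)` to the rectangle of width `2 r` and height
`C r` over almost every point of the graph. The projections `W n` of the restrictions to strips of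
height tending to `0` have masses tending to `0`, and hence so have the integrals of their
densities. -/
theorem ae_tendsto_pull_div (ν : Measure Plane) [IsFiniteMeasure ν] {C : ℝ} :
    ∀ᵐ t, Tendsto (fun r => c.pull ν (Metric.closedBall t r ×ˢ Ioo 0 (C * r))
      / volume (Metric.closedBall t r)) (𝓝[>] 0) (𝓝 0) := by
  let d : ℕ → ℝ := fun n => 1 / ((n : ℝ) + 1)
  have hd0 : ∀ n, 0 < d n := fun n => by positivity
  have hda : Antitone d := fun m n hmn => by
    refine one_div_le_one_div_of_le (by positivity) ?_
    have : (m : ℝ) ≤ n := by exact_mod_cast hmn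
    linarith
  have hdl : Tendsto d atTop (𝓝 0) := tendsto_one_div_add_atTop_nhds_zero_nat
  let W : ℕ → Measure ℝ := fun n => ((c.pull ν).restrict (univ ×ˢ Ioo 0 (d n))).map Prod.fst
  have hW : ∀ n A, MeasurableSet A → W n A = c.pull ν (A ×ˢ Ioo 0 (d n)) := fun n A hA => by
    rw [Measure.map_apply measurable_fst hA, Measure.restrict_apply (measurable_fst hA)]
    congr 1
    ext p
    simp
  have hfin : ∀ n, IsFiniteMeasure (W n) := fun n => by
    dsimp only [W]
    infer_instance
  have hinf : ∀ᵐ t, ⨅ n, (W n).rnDeriv volume t = 0 := by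
    have hm : Measurable fun t => ⨅ n, (W n).rnDeriv volume t :=
      Measurable.iInf fun n => Measure.measurable_rnDeriv _ _
    have h0 : ∫⁻ t, ⨅ n, (W n).rnDeriv volume t = 0 := by
      refine le_antisymm (ge_of_tendsto' (c.tendsto_pull_strip ν hda hdl MeasurableSet.univ)
        fun n => ?_) zero_le
      rw [← hW n univ MeasurableSet.univ]
      exact (lintegral_mono fun t => iInf_le _ n).trans (Measure.lintegral_rnDeriv_le)
    exact (lintegral_eq_zero_iff hm).1 h0
  filter_upwards [hinf, ae_all_iff.2 fun n => Besicovitch.ae_tendsto_rnDeriv (W n) volume]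
    with t h0 ht
  rw [ENNReal.tendsto_nhds_zero]
  intro ε hε
  obtain ⟨n, hn⟩ := iInf_lt_iff.1 (h0.trans_lt hε)
  have hCr : ∀ᶠ r in 𝓝[>] (0 : ℝ), C * r ≤ d n := by
    have : Tendsto (fun r => C * r) (𝓝[>] (0 : ℝ)) (𝓝 (C * 0)) :=
      ((continuous_const.mul continuous_id).tendsto 0).mono_left nhdsWithin_le_nhds
    rw [mul_zero] at this
    exact this.eventually (ge_mem_nhds (hd0 n))
  filter_upwards [(ht n).eventually (gt_mem_nhds hn), hCr] with r hr hr2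
  refine le_trans ?_ hr.le
  rw [hW n _ Metric.isClosed_closedBall.measurableSet]
  gcongr

/-- The trace of `u` in a chart: at almost every point of the graph, `u` has a one-sided approximate
limit. -/
theorem exists_isTraceAt {u : Plane → ℝ} {ν : Measure Plane} [IsFiniteMeasure ν]
    {g : Plane → Plane} (hu : IsPolarGradient ω u ν g) :
    ∃ f : ℝ → ℝ, StronglyMeasurable f ∧ Integrable f ∧
      (∀ᵐ t ∂volume.restrict c.interval, IsTraceAt ω u (c.graph t) (f t)) ∧
      ∀ δ, 0 < δ → 2 * δ ≤ c.ρ →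
        ∫⁻ t in c.interval, ∫⁻ s in Ioo 0 δ, ‖u (c.param (t, s)) - f t‖ₑ
          ≤ 2 * ENNReal.ofReal δ * c.pull ν (c.interval ×ˢ Ioo 0 (2 * δ)) := by
  obtain ⟨f, hfm, hfi, hf⟩ := c.exists_graphTrace hu
  refine ⟨f, hfm, hfi, ?_, hf _ measurableSet_Ioo subset_rfl⟩
  set C : ℝ := 1 + c.K
  have hC : 0 < C := by positivity
  have hw : Measurable fun p => u (c.param p) :=
    hu.measurable.measurable.comp c.continuous_param.measurable
  filter_upwards [ae_restrict_mem measurableSet_Ioo,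
    ae_restrict_of_ae (c.ae_tendsto_pull_div ν (C := 2 * C)),
    ae_restrict_of_ae ((Besicovitch.vitaliFamily volume).ae_tendsto_lintegral_enorm_sub_div
      hfi.locallyIntegrable)] with t ht h1 h2
  replace h2 := h2.comp (Besicovitch.tendsto_filterAt volume t)
  refine c.tendsto_of_tendsto_strip hu.measurable.measurable ht ?_
  set M : ℝ≥0∞ := ENNReal.ofReal (2 * C)
  have hlim := ENNReal.Tendsto.const_mul (a := M)
    ((ENNReal.Tendsto.const_mul (a := 2) h1 (Or.inr (by simp))).add h2)
    (Or.inr ENNReal.ofReal_ne_top)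
  rw [mul_zero, add_zero, mul_zero] at hlim
  refine tendsto_of_tendsto_of_tendsto_of_le_of_le' tendsto_const_nhds hlim
    (Eventually.of_forall fun _ => zero_le) ?_
  filter_upwards [Ioo_mem_nhdsGT (half_pos (c.radius_pos ht))] with r hr
  have hr0 : 0 < r := hr.1
  have hCr : 2 * (C * r) ≤ c.ρ := by
    have := c.le_of_le_radius (t := t) (r := 2 * r) (by linarith [hr.2])
    linarith
  have hA : MeasurableSet (Ioo (t - r) (t + r)) := measurableSet_Ioo
  have hAI : Ioo (t - r) (t + r) ⊆ c.interval := fun t' ht' =>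
    c.mem_interval_of_lt_radius (t := t) (r := r) (by linarith [hr.2, c.radius_pos ht])
      (by rw [abs_sub_lt_iff]; constructor <;> linarith [ht'.1, ht'.2])
  have hAb : Ioo (t - r) (t + r) ⊆ Metric.closedBall t r := by
    rw [Real.closedBall_eq_Icc]
    exact Ioo_subset_Icc_self
  have hvol : volume (Metric.closedBall t r) = ENNReal.ofReal (2 * r) := Real.volume_closedBall _ _
  have hr1 : ENNReal.ofReal r ≠ 0 := by simpa using hr0
  have hr2 : ENNReal.ofReal r ≠ ∞ := ENNReal.ofReal_ne_top
  -- `|u - f t| ≤ |u - f t'| + |f t' - f t|`: the first term is controlled by `|Du|`, the second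
  -- one is small because `t` is a Lebesgue point of `f`.
  have hmain : ∫⁻ t' in Ioo (t - r) (t + r), ∫⁻ s in Ioo 0 (C * r), ‖u (c.param (t', s)) - f t‖ₑ
      ≤ 2 * ENNReal.ofReal (C * r) * c.pull ν (Metric.closedBall t r ×ˢ Ioo 0 (2 * C * r))
        + ENNReal.ofReal (C * r) * ∫⁻ t' in Metric.closedBall t r, ‖f t' - f t‖ₑ := by
    calc _ ≤ ∫⁻ t' in Ioo (t - r) (t + r), ((∫⁻ s in Ioo 0 (C * r),
            ‖u (c.param (t', s)) - f t'‖ₑ) + ENNReal.ofReal (C * r) * ‖f t' - f t‖ₑ) := by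
          refine lintegral_mono fun t' => ?_
          have : ENNReal.ofReal (C * r) * ‖f t' - f t‖ₑ
              = ∫⁻ s in Ioo 0 (C * r), ‖f t' - f t‖ₑ := by
            rw [setLIntegral_const, Real.volume_Ioo, sub_zero, mul_comm]
          rw [this, ← lintegral_add_right _ measurable_const]
          refine lintegral_mono fun s => ?_
          simpa only [edist_eq_enorm_sub] using edist_triangle (u (c.param (t', s))) (f t') (f t)
      _ = (∫⁻ t' in Ioo (t - r) (t + r), ∫⁻ s in Ioo 0 (C * r), ‖u (c.param (t', s)) - f t'‖ₑ)
          + ENNReal.ofReal (C * r) * ∫⁻ t' in Ioo (t - r) (t + r), ‖f t' - f t‖ₑ := by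
          rw [lintegral_add_right _ ((hfm.measurable.sub_const _).enorm.const_mul _),
            lintegral_const_mul' _ _ ENNReal.ofReal_ne_top]
      _ ≤ _ := by
          refine add_le_add ((hf _ hA hAI _ (by positivity) hCr).trans ?_) ?_
          · rw [← mul_assoc 2 C r]
            gcongr
          · gcongr
  refine (ENNReal.div_le_div_right hmain _).trans (le_of_eq ?_)
  simp only [Function.comp_apply]
  rw [hvol, ENNReal.ofReal_mul hC.le, ENNReal.ofReal_mul zero_le_two,
    show M = ENNReal.ofReal 2 * ENNReal.ofReal C from ENNReal.ofReal_mul zero_le_two]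
  have h20 : ENNReal.ofReal 2 ≠ 0 := by simp
  have h2t : ENNReal.ofReal 2 ≠ ∞ := by simp
  generalize c.pull ν _ = P
  generalize (∫⁻ _ in Metric.closedBall t r, _) = Q
  simp only [div_eq_mul_inv]
  rw [ENNReal.mul_inv (Or.inl hr1) (Or.inl hr2), ENNReal.mul_inv (Or.inl h20) (Or.inl h2t)]
  have e1 : ENNReal.ofReal r * (ENNReal.ofReal r)⁻¹ = 1 := ENNReal.mul_inv_cancel hr1 hr2
  have e2 : ENNReal.ofReal 2 * (ENNReal.ofReal 2)⁻¹ = 1 := ENNReal.mul_inv_cancel h20 h2t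
  generalize ENNReal.ofReal r = R at *
  generalize ENNReal.ofReal 2 = T at *
  calc _ = (R * R⁻¹) * (ENNReal.ofReal C * R⁻¹ * (2 * P + Q)) := by ring
    _ = (T * T⁻¹) * (ENNReal.ofReal C * R⁻¹ * (2 * P + Q)) := by rw [e1, e2]
    _ = _ := by ring

end GraphChart

/-! ### Traces of functions of bounded variation -/

theorem IsBV.isFiniteMeasure {ω : Set Plane} {u : Plane → ℝ} (hu : IsBV ω u) :
    IsFiniteMeasure (gradientMeasure ω u).variation := hu.isGradientMeasure.isFiniteMeasure

/-- A function of bounded variation, extended by zero, has a Borel representative whose gradient is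
given in polar form. -/
theorem IsBV.exists_isPolarGradient {ω : Set Plane} (hω : MeasurableSet ω) {u : Plane → ℝ}
    (hu : IsBV ω u) :
    ∃ w g, IsPolarGradient ω w (gradientMeasure ω u).variation g ∧ u =ᵐ[volume.restrict ω] w := by
  have := hu.isFiniteMeasure
  obtain ⟨g, hgm, hg1, hg, _⟩ := exists_polar (gradientMeasure ω u)
  have hae : u =ᵐ[volume.restrict ω] ω.indicator (hu.1.1.mk u) := by
    filter_upwards [hu.1.1.ae_eq_mk, ae_restrict_mem hω] with x h1 h2
    rw [indicator_of_mem h2, h1]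
  refine ⟨ω.indicator (hu.1.1.mk u), g, ⟨hu.1.1.stronglyMeasurable_mk.indicator hω, ?_, hgm, hg1,
    fun φ hφ => ?_⟩, hae⟩
  · exact IntegrableOn.integrable_indicator (hu.1.congr hu.1.1.ae_eq_mk) hω
  · rw [← hg φ hφ.integrable, ← hu.isGradientMeasure.integral_eq φ hφ]
    refine integral_congr_ae ?_
    filter_upwards [hae] with x hx
    rw [hx]

theorem IsTraceAt.congr {ω : Set Plane} {u w : Plane → ℝ} (h : u =ᵐ[volume.restrict ω] w)
    {x : Plane} {t : ℝ} (hu : IsTraceAt ω u x t) : IsTraceAt ω w x t := by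
  refine Tendsto.congr (fun r => average_congr ?_) hu
  filter_upwards [ae_mono (Measure.restrict_mono inter_subset_left le_rfl) h] with y hy
  rw [hy]

/-- If `ω` misses a ball around `x`, the averages are `0` by convention, and the claim still
holds. -/
theorem isTraceAt_of_continuous {ω : Set Plane} {φ : Plane → ℝ} (hφ : Continuous φ) (x : Plane) :
    IsTraceAt ω φ x (φ x) := by
  rw [IsTraceAt, Metric.tendsto_nhds]
  intro ε hε
  obtain ⟨r₀, hr₀, h⟩ := Metric.continuous_iff.1 hφ x (ε / 2) (half_pos hε)
  filter_upwards [Ioo_mem_nhdsGT hr₀] with r hr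
  have hb : ∀ y ∈ ω ∩ Metric.ball x r, ‖|φ y - φ x|‖ ≤ ε / 2 := fun y hy => by
    rw [norm_abs_eq_norm]
    exact (h y ((Metric.mem_ball.1 hy.2).trans hr.2)).le
  have hfin : volume (ω ∩ Metric.ball x r) < ∞ :=
    (measure_mono inter_subset_right).trans_lt measure_ball_lt_top
  have h1 := norm_setIntegral_le_of_norm_le_const hfin hb
  rw [dist_zero_right, setAverage_eq, norm_smul, norm_inv, Real.norm_of_nonneg measureReal_nonneg]
  refine lt_of_le_of_lt ?_ (half_lt_self hε)
  rcases eq_or_ne (volume.real (ω ∩ Metric.ball x r)) 0 with h0 | h0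
  · rw [h0, inv_zero, zero_mul]
    positivity
  · have hpos : 0 < volume.real (ω ∩ Metric.ball x r) := lt_of_le_of_ne measureReal_nonneg h0.symm
    rw [inv_mul_le_iff₀ hpos, mul_comm]
    exact h1

namespace GraphChart

variable {ω : Set Plane} (c : GraphChart ω)

/-- At boundary points, `ω ∩ B_r` has positive area, so that approximate limits are unique. -/
theorem isTraceAt_unique {u : Plane → ℝ} (hu : IntegrableOn u ω) {t : ℝ} (ht : t ∈ c.interval)
    {a b : ℝ} (ha : IsTraceAt ω u (c.graph t) a) (hb : IsTraceAt ω u (c.graph t) b) : a = b := by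
  have h := ha.add hb
  rw [add_zero] at h
  have h0 : |a - b| ≤ 0 := by
    refine ge_of_tendsto h ?_
    filter_upwards [Ioo_mem_nhdsGT (c.radius_pos ht)] with r hr
    set S := ω ∩ Metric.ball (c.graph t) r
    have hfin : volume S ≠ ∞ :=
      ((measure_mono inter_subset_right).trans_lt measure_ball_lt_top).ne
    have hpos : volume S ≠ 0 := by
      have h1 := c.le_volume_inter_ball hr.1 hr.2.le
      have hr0 := hr.1
      have hK : (0 : ℝ) < 2 + c.K := by positivity
      refine ne_of_gt (lt_of_lt_of_le (pos_iff_ne_zero.2 (mul_ne_zero ?_ ?_)) h1) <;>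
        rw [ENNReal.ofReal_ne_zero_iff] <;> positivity
    have huS : IntegrableOn u S := hu.mono_set inter_subset_left
    have i0 : ∀ a : ℝ, IntegrableOn (fun _ => a) S := fun a => integrableOn_const hfin
    have i1 : ∀ a : ℝ, IntegrableOn (fun y => |u y - a|) S := fun a => (huS.sub (i0 a)).abs
    calc |a - b| = ⨍ _ in S, |a - b| := (setAverage_const hpos hfin _).symm
      _ ≤ ⨍ y in S, (|u y - a| + |u y - b|) := by
          rw [setAverage_eq, setAverage_eq, smul_eq_mul, smul_eq_mul]
          refine mul_le_mul_of_nonneg_left (integral_mono (i0 _) ((i1 a).add (i1 b)) fun y => ?_)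
            (inv_nonneg.2 measureReal_nonneg)
          have := abs_sub_le a (u y) b
          rwa [abs_sub_comm a (u y)] at this
      _ = _ := by
          rw [setAverage_eq, setAverage_eq, setAverage_eq, integral_add (i1 a) (i1 b), smul_add]
  exact sub_eq_zero.1 (abs_eq_zero.1 (le_antisymm h0 (abs_nonneg _)))

theorem trace_eq {u : Plane → ℝ} (hu : IntegrableOn u ω) {t : ℝ} (ht : t ∈ c.interval)
    {a : ℝ} (ha : IsTraceAt ω u (c.graph t) a) : trace ω u (c.graph t) = a := by
  have h : ∃ a, IsTraceAt ω u (c.graph t) a := ⟨a, ha⟩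
  rw [trace, dif_pos h]
  exact c.isTraceAt_unique hu ht h.choose_spec ha

/-- The trace in a chart, and the distance of `u` to it in a strip of height `δ`. -/
theorem exists_trace_eq (hω : MeasurableSet ω) {u : Plane → ℝ} (hu : IsBV ω u) :
    ∃ f : ℝ → ℝ, StronglyMeasurable f ∧ Integrable f ∧
      (∀ᵐ t ∂volume.restrict c.interval, trace ω u (c.graph t) = f t) ∧
      ∀ δ, 0 < δ → 2 * δ ≤ c.ρ →
        ∫⁻ x in c.param '' (c.interval ×ˢ Ioo 0 δ), ‖u x - f (c.absc x)‖ₑ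
          ≤ 2 * ENNReal.ofReal δ
            * c.pull (gradientMeasure ω u).variation (c.interval ×ˢ Ioo 0 (2 * δ)) := by
  have := hu.isFiniteMeasure
  obtain ⟨w, g, hw, hae⟩ := hu.exists_isPolarGradient hω
  obtain ⟨f, hfm, hfi, hf, hest⟩ := c.exists_isTraceAt hw
  refine ⟨f, hfm, hfi, ?_, fun δ hδ hδρ => ?_⟩
  · filter_upwards [hf, ae_restrict_mem measurableSet_Ioo] with t h1 h2
    exact c.trace_eq hu.1 h2 (h1.congr hae.symm)
  · refine le_trans (le_of_eq ?_) (hest δ hδ hδρ)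
    have hF : Measurable fun x => ‖w x - f (c.absc x)‖ₑ :=
      (hw.measurable.measurable.sub
        (hfm.measurable.comp c.lipschitz_absc.continuous.measurable)).enorm
    have h1 := c.lintegral_image_param hF c.interval (Ioo 0 δ)
    simp only [absc_param] at h1
    rw [← h1]
    have hsub : c.param '' (c.interval ×ˢ Ioo 0 δ) ⊆ ω := by
      rintro _ ⟨⟨t, s⟩, ⟨ht, hs⟩, rfl⟩
      exact c.param_mem ht ⟨hs.1, hs.2.trans_le (by linarith)⟩
    refine lintegral_congr_ae ?_
    filter_upwards [ae_mono (Measure.restrict_mono hsub le_rfl) hae] with x hx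
    rw [hx]

theorem integrableOn_trace (hω : IsOpen ω) {u : Plane → ℝ} (hu : IsBV ω u) :
    IntegrableOn (trace ω u) c.box (boundaryMeasure ω) := by
  obtain ⟨f, hfm, hfi, hf, _⟩ := c.exists_trace_eq hω.measurableSet hu
  have h1 : trace ω u =ᵐ[(boundaryMeasure ω).restrict c.box] fun x => f (c.absc x) := by
    refine c.ae_box_of_ae_interval hω ?_
    filter_upwards [hf] with t ht
    rw [ht, c.absc_graph]
  refine Integrable.congr ?_ h1.symm
  refine Integrable.mono_measure ?_ (c.boundaryMeasure_restrict_box_le hω)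
  refine Integrable.smul_measure_nnreal ?_
  rw [c.measurableEmbedding_graph.integrable_map_iff]
  refine (hfi.integrableOn (s := c.interval)).congr (Eventually.of_forall fun t => ?_)
  simp

/-- Near the boundary, the mean distance of `u` to a smooth function is controlled by the distance
of their traces. -/
theorem exists_lintegral_sub_le (hω : IsOpen ω) {u : Plane → ℝ} (hu : IsBV ω u) {φ : Plane → ℝ}
    (hφ : UniformContinuous φ) {η : ℝ} (hη : 0 < η) :
    ∃ δ₀ > 0, ∀ δ, 0 < δ → δ ≤ δ₀ →
      ∫⁻ x in c.param '' (c.interval ×ˢ Ioo 0 δ), ‖u x - φ x‖ₑ ≤ ENNReal.ofReal δ *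
        ((∫⁻ x, ‖trace ω u x - φ x‖ₑ ∂boundaryMeasure ω) + ENNReal.ofReal η) := by
  have := hu.isFiniteMeasure
  have hρ := c.ρ_pos
  have hI : MeasurableSet c.interval := measurableSet_Ioo
  obtain ⟨f, hfm, hfi, hf, hest⟩ := c.exists_trace_eq hω.measurableSet hu
  obtain ⟨δ₁, hδ₁, hφδ⟩ := Metric.uniformContinuous_iff.1 hφ (η / (4 * c.ρ)) (by positivity)
  have hd : Antitone fun n : ℕ => 1 / ((n : ℝ) + 1) := fun m n hmn => by
    refine one_div_le_one_div_of_le (by positivity) ?_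
    have : (m : ℝ) ≤ n := by exact_mod_cast hmn
    linarith
  obtain ⟨n, hn⟩ := ((c.tendsto_pull_strip (gradientMeasure ω u).variation hd
    tendsto_one_div_add_atTop_nhds_zero_nat hI).eventually
      (ge_mem_nhds (show (0 : ℝ≥0∞) < ENNReal.ofReal (η / 4) by simpa using hη))).exists
  have hac := c.lipschitz_absc.continuous.measurable
  have hgr := c.lipschitz_graph.continuous.measurable
  have hφm := hφ.continuous.measurable
  refine ⟨min (c.ρ / 2) (min (δ₁ / 2) (1 / ((n : ℝ) + 1) / 2)), by positivity,
    fun δ hδ hδ₀ => ?_⟩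
  have h1 : δ ≤ c.ρ / 2 := hδ₀.trans (min_le_left _ _)
  have h2 : δ ≤ δ₁ / 2 := hδ₀.trans ((min_le_right _ _).trans (min_le_left _ _))
  have h3 : δ ≤ 1 / ((n : ℝ) + 1) / 2 := hδ₀.trans ((min_le_right _ _).trans (min_le_right _ _))
  set S := c.param '' (c.interval ×ˢ Ioo 0 δ)
  have hS : MeasurableSet S :=
    c.measurableEmbedding_param.measurableSet_image.2 (hI.prod measurableSet_Ioo)
  have hSvol : volume S = ENNReal.ofReal (2 * c.ρ) * ENNReal.ofReal δ := by
    rw [c.volume_image_param, Measure.volume_eq_prod, Measure.prod_prod, interval, Real.volume_Ioo,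
      Real.volume_Ioo, sub_zero]
    congr 2
    ring
  have hsecond : ∫⁻ x in S, ‖f (c.absc x) - φ (c.graph (c.absc x))‖ₑ
      ≤ ENNReal.ofReal δ * ∫⁻ x, ‖trace ω u x - φ x‖ₑ ∂boundaryMeasure ω := by
    have hm : Measurable fun x => ‖f (c.absc x) - φ (c.graph (c.absc x))‖ₑ :=
      ((hfm.measurable.comp hac).sub (hφm.comp (hgr.comp hac))).enorm
    have hm' : Measurable fun x => ‖f (c.absc x) - φ x‖ₑ :=
      ((hfm.measurable.comp hac).sub hφm).enorm
    have e := c.lintegral_image_param hm c.interval (Ioo 0 δ)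
    simp only [absc_param, setLIntegral_const, Real.volume_Ioo, sub_zero] at e
    rw [e, lintegral_mul_const' _ _ ENNReal.ofReal_ne_top, mul_comm]
    gcongr
    have hbox : MeasurableSet c.box := c.isOpen_box.measurableSet
    have e2 := c.lintegral_graph_le hω (hm'.indicator hbox)
    rw [lintegral_indicator hbox] at e2
    calc ∫⁻ t in c.interval, ‖f t - φ (c.graph t)‖ₑ
        = ∫⁻ t in c.interval, c.box.indicator (fun x => ‖f (c.absc x) - φ x‖ₑ) (c.graph t) := by
          refine setLIntegral_congr_fun hI fun t ht => ?_
          rw [indicator_of_mem, c.absc_graph]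
          simp [box, c.mem_interval.1 ht, hρ]
      _ ≤ ∫⁻ x in c.box, ‖f (c.absc x) - φ x‖ₑ ∂boundaryMeasure ω := e2
      _ = ∫⁻ x in c.box, ‖trace ω u x - φ x‖ₑ ∂boundaryMeasure ω := by
          refine lintegral_congr_ae ?_
          have : ∀ᵐ x ∂(boundaryMeasure ω).restrict c.box, trace ω u x = f (c.absc x) := by
            refine c.ae_box_of_ae_interval hω ?_
            filter_upwards [hf] with t ht
            rw [ht, c.absc_graph]
          filter_upwards [this] with x hx
          rw [hx]
      _ ≤ _ := setLIntegral_le_lintegral _ _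
  have hfirst : ∫⁻ x in S, ‖u x - f (c.absc x)‖ₑ
      ≤ ENNReal.ofReal δ * ENNReal.ofReal (η / 2) := by
    refine (hest δ hδ (by linarith)).trans ?_
    have : c.pull (gradientMeasure ω u).variation (c.interval ×ˢ Ioo 0 (2 * δ))
        ≤ ENNReal.ofReal (η / 4) := by
      refine le_trans (measure_mono (prod_mono_right (Ioo_subset_Ioo_right ?_))) hn
      linarith
    calc _ ≤ 2 * ENNReal.ofReal δ * ENNReal.ofReal (η / 4) := by gcongr
      _ = ENNReal.ofReal δ * (ENNReal.ofReal 2 * ENNReal.ofReal (η / 4)) := by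
          rw [ENNReal.ofReal_ofNat]; ring
      _ = _ := by
          rw [← ENNReal.ofReal_mul zero_le_two]
          congr 2
          ring
  have hthird : ∫⁻ x in S, ‖φ (c.graph (c.absc x)) - φ x‖ₑ
      ≤ ENNReal.ofReal δ * ENNReal.ofReal (η / 2) := by
    calc _ ≤ ∫⁻ x in S, ENNReal.ofReal (η / (4 * c.ρ)) := by
          refine setLIntegral_mono' hS fun x hx => ?_
          obtain ⟨⟨t, s⟩, ⟨ht, hs⟩, rfl⟩ := hx
          rw [c.absc_param, ← ofReal_norm, ← dist_eq_norm]
          refine ENNReal.ofReal_le_ofReal (hφδ ?_).le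
          refine (c.dist_param_le _ _ _ _).trans_lt ?_
          have := hs.1
          have := hs.2
          dsimp only at *
          rw [sub_self, abs_zero, mul_zero, zero_add, zero_sub, abs_neg, abs_of_pos hs.1]
          linarith
      _ = ENNReal.ofReal δ * (ENNReal.ofReal (η / (4 * c.ρ)) * ENNReal.ofReal (2 * c.ρ)) := by
          rw [setLIntegral_const, hSvol]
          ring
      _ = _ := by
          rw [← ENNReal.ofReal_mul (by positivity)]
          congr 2
          field_simp
          ring
  calc ∫⁻ x in S, ‖u x - φ x‖ₑ
      ≤ ∫⁻ x in S, (‖u x - f (c.absc x)‖ₑ + (‖f (c.absc x) - φ (c.graph (c.absc x))‖ₑ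
        + ‖φ (c.graph (c.absc x)) - φ x‖ₑ)) := by
        refine lintegral_mono fun x => ?_
        simp only [← edist_eq_enorm_sub]
        exact (edist_triangle _ _ _).trans (add_le_add_right (edist_triangle _ _ _) _)
    _ = (∫⁻ x in S, ‖u x - f (c.absc x)‖ₑ)
        + ((∫⁻ x in S, ‖f (c.absc x) - φ (c.graph (c.absc x))‖ₑ)
        + ∫⁻ x in S, ‖φ (c.graph (c.absc x)) - φ x‖ₑ) := by
        rw [lintegral_add_right, lintegral_add_left]
        · exact ((hfm.measurable.comp hac).sub (hφm.comp (hgr.comp hac))).enorm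
        · exact (((hfm.measurable.comp hac).sub (hφm.comp (hgr.comp hac))).enorm).add
            ((hφm.comp (hgr.comp hac)).sub hφm).enorm
    _ ≤ _ := add_le_add hfirst (add_le_add hsecond hthird)
    _ = _ := by
        rw [← add_halves η, ENNReal.ofReal_add (by positivity) (by positivity), add_halves]
        ring

end GraphChart

theorem integrable_trace {ω : Set Plane} (hω : IsOpen ω) (hωb : Bornology.IsBounded ω)
    (hL : HasLipschitzBoundary ω) {u : Plane → ℝ} (hu : IsBV ω u) :
    Integrable (trace ω u) (boundaryMeasure ω) := by
  obtain ⟨ι, _, c, hc⟩ := hL.exists_cover hω hωb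
  have h1 : IntegrableOn (trace ω u) (⋃ i, (c i).box) (boundaryMeasure ω) :=
    integrableOn_finite_iUnion.2 fun i => (c i).integrableOn_trace hω hu
  have h2 : frontier ω ⊆ ⋃ i, (c i).box :=
    hc.trans (iUnion_mono fun i => (c i).halfBox_subset_box)
  rwa [IntegrableOn, boundaryMeasure, Measure.restrict_restrict
    (MeasurableSet.iUnion fun i => (c i).isOpen_box.measurableSet), inter_eq_right.2 h2] at h1

/-! ### Normal traces of divergence-free fields -/

/-- A smooth step from `0` to `1`, which takes place in the interval `[1, 2]`. -/
noncomputable def step (z : ℝ) : ℝ := Real.smoothTransition (z - 1)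

theorem contDiff_step : ContDiff ℝ 1 step :=
  (Real.smoothTransition.contDiff (n := 1)).comp (contDiff_id.sub contDiff_const)

theorem step_eq_zero {z : ℝ} (hz : z ≤ 1) : step z = 0 :=
  Real.smoothTransition.zero_of_nonpos (by linarith)

theorem step_eq_one {z : ℝ} (hz : 2 ≤ z) : step z = 1 :=
  Real.smoothTransition.one_of_one_le (by linarith)

theorem step_nonneg (z : ℝ) : 0 ≤ step z := Real.smoothTransition.nonneg _

theorem step_le_one (z : ℝ) : step z ≤ 1 := Real.smoothTransition.le_one _

theorem monotone_step : Monotone step := fun a b h =>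
  Real.smoothTransition.monotone (by linarith)

theorem deriv_step_nonneg (z : ℝ) : 0 ≤ deriv step z := monotone_step.deriv_nonneg

theorem continuous_deriv_step : Continuous (deriv step) := contDiff_step.continuous_deriv_one

theorem deriv_step_eq_zero {z : ℝ} (hz : z ∉ Icc 1 2) : deriv step z = 0 := by
  rw [mem_Icc, not_and_or, not_le, not_le] at hz
  rcases hz with h | h
  · have : step =ᶠ[𝓝 z] fun _ => 0 := by
      filter_upwards [Iio_mem_nhds h] with y hy using step_eq_zero (le_of_lt hy)
    rw [this.deriv_eq, deriv_const]
  · have : step =ᶠ[𝓝 z] fun _ => 1 := by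
      filter_upwards [Ioi_mem_nhds h] with y hy using step_eq_one (le_of_lt hy)
    rw [this.deriv_eq, deriv_const]

theorem lintegral_deriv_step_le {δ : ℝ} (hδ : 0 < δ) (b : ℝ) :
    ∫⁻ s, ENNReal.ofReal (deriv step ((s - b) / δ) / δ) ≤ 1 := by
  have hd : ∀ s, HasDerivAt (fun s => step ((s - b) / δ)) (deriv step ((s - b) / δ) / δ) s := by
    intro s
    have h1 : HasDerivAt (fun s => (s - b) / δ) (1 / δ) s :=
      ((hasDerivAt_id s).sub_const b).div_const δ
    have h2 := ((contDiff_step.differentiable one_ne_zero) ((s - b) / δ)).hasDerivAt.comp s h1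
    exact h2.congr_deriv (mul_one_div _ _)
  have hc : Continuous fun s => deriv step ((s - b) / δ) / δ := by
    have := continuous_deriv_step
    fun_prop
  have hle : b + δ / 2 ≤ b + 2 * δ := by linarith
  have hsupp : ∀ s ∉ Ioc (b + δ / 2) (b + 2 * δ),
      ENNReal.ofReal (deriv step ((s - b) / δ) / δ) = 0 := by
    intro s hs
    rw [deriv_step_eq_zero, zero_div, ENNReal.ofReal_zero]
    rintro ⟨h1, h2⟩
    rw [le_div_iff₀ hδ] at h1
    rw [div_le_iff₀ hδ] at h2
    exact hs ⟨by linarith, by linarith⟩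
  rw [← setLIntegral_eq_of_support_subset (s := Ioc (b + δ / 2) (b + 2 * δ))
    (fun s hs => by by_contra h; exact hs (hsupp s h)),
    ← ofReal_integral_eq_lintegral_ofReal (hc.integrableOn_Ioc)
      (Eventually.of_forall fun s => div_nonneg (deriv_step_nonneg _) hδ.le),
    ← intervalIntegral.integral_of_le hle,
    intervalIntegral.integral_eq_sub_of_hasDerivAt (fun s _ => hd s) (hc.intervalIntegrable _ _)]
  rw [← ENNReal.ofReal_one]
  refine ENNReal.ofReal_le_ofReal ?_
  linarith [step_nonneg ((b + δ / 2 - b) / δ), step_le_one ((b + 2 * δ - b) / δ)]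

namespace GraphChart

variable {ω : Set Plane} (c : GraphChart ω) {T : Plane → Plane}

/-- The average of `γ` over `[t, t + δ]`, raised by `K δ`: a `C¹` function which is a little larger
than `γ`, and whose derivative is a difference quotient of `γ`. As `δ` tends to `0`, the derivatives
converge to `γ'` almost everywhere. -/
noncomputable def smoothγ (δ t : ℝ) : ℝ := δ⁻¹ * (∫ s in t..t + δ, c.γ s) + c.K * δ

theorem hasDerivAt_smoothγ (δ t : ℝ) :
    HasDerivAt (c.smoothγ δ) (δ⁻¹ * (c.γ (t + δ) - c.γ t)) t := by
  have hc := c.lip.continuous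
  have hi : ∀ a b, IntervalIntegrable c.γ volume a b := hc.intervalIntegrable
  have h1 : ∀ t, HasDerivAt (fun t => ∫ s in (0 : ℝ)..t, c.γ s) (c.γ t) t := fun t =>
    intervalIntegral.integral_hasDerivAt_right (hi _ _)
      (hc.stronglyMeasurableAtFilter _ _) hc.continuousAt
  have h2 := (h1 (t + δ)).comp_add_const t δ
  refine (((h2.sub (h1 t)).const_mul δ⁻¹).add_const (c.K * δ)).congr_of_eventuallyEq
    (Eventually.of_forall fun t => ?_)
  simp only [smoothγ, Pi.sub_apply]
  rw [intervalIntegral.integral_interval_sub_left (hi _ _) (hi _ _)]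

theorem contDiff_smoothγ (δ : ℝ) : ContDiff ℝ 1 (c.smoothγ δ) := by
  have hc := c.lip.continuous
  rw [contDiff_one_iff_deriv]
  refine ⟨fun t => (c.hasDerivAt_smoothγ δ t).differentiableAt, ?_⟩
  rw [funext fun t => (c.hasDerivAt_smoothγ δ t).deriv]
  fun_prop

theorem abs_deriv_smoothγ_le {δ : ℝ} (hδ : 0 < δ) (t : ℝ) : |deriv (c.smoothγ δ) t| ≤ c.K := by
  rw [(c.hasDerivAt_smoothγ δ t).deriv, abs_mul, abs_inv, abs_of_pos hδ, inv_mul_le_iff₀ hδ,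
    mul_comm]
  have := c.abs_γ_sub_le (t + δ) t
  rwa [add_sub_cancel_left, abs_of_pos hδ] at this

theorem smoothγ_mem_Icc {δ : ℝ} (hδ : 0 < δ) (t : ℝ) :
    c.smoothγ δ t ∈ Icc (c.γ t) (c.γ t + 2 * c.K * δ) := by
  have hc := c.lip.continuous
  have hle : t ≤ t + δ := by linarith
  have hb : ∀ s ∈ Icc t (t + δ), |c.γ s - c.γ t| ≤ c.K * δ := fun s hs => by
    refine (c.abs_γ_sub_le s t).trans (mul_le_mul_of_nonneg_left ?_ c.K.2)
    rw [abs_of_nonneg (by linarith [hs.1])]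
    linarith [hs.2]
  have h1 : ∫ s in t..t + δ, (c.γ t - c.K * δ) ≤ ∫ s in t..t + δ, c.γ s :=
    intervalIntegral.integral_mono_on hle (by simp) (hc.intervalIntegrable _ _)
      fun s hs => by linarith [(abs_le.1 (hb s hs)).1]
  have h2 : ∫ s in t..t + δ, c.γ s ≤ ∫ s in t..t + δ, (c.γ t + c.K * δ) :=
    intervalIntegral.integral_mono_on hle (hc.intervalIntegrable _ _) (by simp)
      fun s hs => by linarith [(abs_le.1 (hb s hs)).2]
  rw [intervalIntegral.integral_const, smul_eq_mul, add_sub_cancel_left] at h1 h2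
  have h3 : c.γ t - c.K * δ ≤ δ⁻¹ * ∫ s in t..t + δ, c.γ s := by
    rwa [le_inv_mul_iff₀ hδ]
  have h4 : δ⁻¹ * ∫ s in t..t + δ, c.γ s ≤ c.γ t + c.K * δ := by
    rwa [inv_mul_le_iff₀ hδ]
  rw [smoothγ]
  constructor <;> linarith

/-- A `C¹` cutoff which vanishes below height `δ` and is `1` at heights above a multiple of `δ`. Its
level sets are unions of translates of the graph of `smoothγ`, so that the length of its gradient is
the vertical derivative times a factor which converges to `√(1 + γ'²)`. -/
noncomputable def cutoff (δ : ℝ) (x : Plane) : ℝ :=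
  step ((c.e x 1 - c.smoothγ δ (c.absc x)) / δ)

theorem contDiff_e_apply (i : Fin 2) : ContDiff ℝ 1 fun x => c.e x i :=
  ((EuclideanSpace.proj (𝕜 := ℝ) i).comp
    (c.e.toContinuousLinearEquiv : Plane →L[ℝ] Plane)).contDiff

theorem contDiff_cutoff (δ : ℝ) : ContDiff ℝ 1 (c.cutoff δ) :=
  contDiff_step.comp (((c.contDiff_e_apply 1).sub
    ((c.contDiff_smoothγ δ).comp (c.contDiff_e_apply 0))).div_const δ)

theorem norm_gradient_cutoff_le {δ : ℝ} (hδ : 0 < δ) (x : Plane) :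
    ‖gradient (c.cutoff δ) x‖ ≤ √(1 + deriv (c.smoothγ δ) (c.absc x) ^ 2)
      * (deriv step ((c.e x 1 - c.smoothγ δ (c.absc x)) / δ) / δ) := by
  set a := deriv (c.smoothγ δ) (c.absc x)
  set b := deriv step ((c.e x 1 - c.smoothγ δ (c.absc x)) / δ)
  have hb : 0 ≤ b := deriv_step_nonneg _
  let P : Fin 2 → Plane →L[ℝ] ℝ := fun i => (EuclideanSpace.proj (𝕜 := ℝ) i).comp
    (c.e.toContinuousLinearEquiv : Plane →L[ℝ] Plane)
  have hP : ∀ i, HasFDerivAt (fun x => c.e x i) (P i) x := fun i => (P i).hasFDerivAt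
  have hs : HasDerivAt (c.smoothγ δ) a (c.absc x) :=
    (c.hasDerivAt_smoothγ δ _).differentiableAt.hasDerivAt
  have h1 : HasFDerivAt (fun x => (c.e x 1 - c.smoothγ δ (c.absc x)) / δ)
      (δ⁻¹ • (P 1 - a • P 0)) x := by
    have h2 := ((hP 1).sub (hs.comp_hasFDerivAt x (hP 0))).const_smul δ⁻¹
    refine h2.congr_of_eventuallyEq (Eventually.of_forall fun y => ?_)
    simp [absc, div_eq_inv_mul]
  have h3 : HasFDerivAt (c.cutoff δ) (b • (δ⁻¹ • (P 1 - a • P 0))) x :=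
    ((contDiff_step.differentiable one_ne_zero) _).hasDerivAt.comp_hasFDerivAt x h1
  rw [norm_gradient, h3.fderiv]
  refine ContinuousLinearMap.opNorm_le_bound _ (by positivity) fun v => ?_
  have h4 : (b • (δ⁻¹ • (P 1 - a • P 0))) v = b / δ * inner ℝ (!₂[-a, 1] : Plane) (c.e v) := by
    simp [P, PiLp.inner_apply, Fin.sum_univ_two]
    ring
  have h5 : ‖(!₂[-a, 1] : Plane)‖ = √(1 + a ^ 2) := by
    rw [EuclideanSpace.norm_eq, Fin.sum_univ_two]
    simp [add_comm]
  rw [h4, norm_mul, Real.norm_of_nonneg (by positivity)]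
  calc b / δ * ‖inner ℝ (!₂[-a, 1] : Plane) (c.e v)‖ ≤ b / δ * (√(1 + a ^ 2) * ‖v‖) := by
        gcongr
        refine (norm_inner_le_norm _ _).trans_eq ?_
        rw [h5, c.e.norm_map]
    _ = _ := by ring

theorem tsupport_mul_cutoff_subset {δ : ℝ} (hδ : 0 < δ) {φ : Plane → ℝ}
    (hφ : IsTestFunction c.box φ) : tsupport (fun x => φ x * c.cutoff δ x) ⊆ ω := by
  have h1 : tsupport (fun x => φ x * c.cutoff δ x) ⊆ {x | δ ≤ c.height x} := by
    refine closure_minimal (fun x hx => ?_)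
      (isClosed_le continuous_const c.lipschitz_height.continuous)
    have h2 : c.cutoff δ x ≠ 0 := right_ne_zero_of_mul hx
    have h3 : 1 < (c.e x 1 - c.smoothγ δ (c.absc x)) / δ := by
      by_contra h
      exact h2 (step_eq_zero (not_lt.1 h))
    rw [lt_div_iff₀ hδ] at h3
    have h4 := (c.smoothγ_mem_Icc hδ (c.absc x)).1
    show δ ≤ c.e x 1 - c.γ (c.absc x)
    linarith
  intro x hx
  exact (c.mem_iff_height_pos (hφ.tsupport_subset (tsupport_mul_subset_left hx))).2
    (hδ.trans_le (h1 hx))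

theorem cutoff_eventually_eq_one {x : Plane} (hx : 0 < c.height x) :
    ∀ᶠ δ in 𝓝[>] (0 : ℝ), c.cutoff δ x = 1 := by
  have hK : (0 : ℝ) < 2 * c.K + 2 := by positivity
  filter_upwards [Ioo_mem_nhdsGT (div_pos hx hK)] with δ hδ
  refine step_eq_one ?_
  rw [le_div_iff₀ hδ.1]
  have h1 := (c.smoothγ_mem_Icc hδ.1 (c.absc x)).2
  have h2 := hδ.2
  rw [lt_div_iff₀ hK] at h2
  have h3 : c.height x = c.e x 1 - c.γ (c.absc x) := rfl
  linarith

theorem integral_cutoff_mul_eq (hT : IsUnitField ω T) (hω : IsOpen ω)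
    (hωb : Bornology.IsBounded ω) {φ : Plane → ℝ} (hφ : IsTestFunction c.box φ) {δ : ℝ}
    (hδ : 0 < δ) :
    ∫ x, c.cutoff δ x * inner ℝ (T x) (gradient φ x)
      = -∫ x, inner ℝ (T x) (φ x • gradient (c.cutoff δ) x) := by
  have hc := c.contDiff_cutoff δ
  have h := hT.integral_inner_gradient_eq_zero hω hωb (hφ.contDiff_one.mul hc)
    hφ.compactSupport.mul_right (c.tsupport_mul_cutoff_subset hδ hφ)
  have e : ∀ x, gradient (fun y => φ y * c.cutoff δ y) x
      = φ x • gradient (c.cutoff δ) x + c.cutoff δ x • gradient φ x := fun x =>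
    gradient_mul' (hφ.differentiable x) (hc.differentiable one_ne_zero x)
  have i1 : Integrable fun x => inner ℝ (T x) (φ x • gradient (c.cutoff δ) x) :=
    hT.integrable_inner ((hφ.continuous.smul hc.continuous_gradient).integrable_of_hasCompactSupport
      hφ.compactSupport.smul_right)
  have i2 : Integrable fun x => inner ℝ (T x) (c.cutoff δ x • gradient φ x) :=
    hT.integrable_inner ((hc.continuous.smul hφ.continuous_gradient).integrable_of_hasCompactSupport
      hφ.compactSupport.gradient.smul_left)
  change ∫ x, inner ℝ (T x) (gradient (fun y => φ y * c.cutoff δ y) x) = 0 at h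
  simp_rw [e, inner_add_right] at h
  rw [integral_add i1 i2] at h
  simp_rw [inner_smul_right (T _) _ (c.cutoff δ _)] at h
  linarith

/-- The flux through the transition layer of the cutoff. The variation of the cutoff along each
vertical line is at most `1`, and `φ` differs by at most `κ` from its value on the graph. -/
theorem ofReal_abs_integral_cutoff_mul_le (hT : IsUnitField ω T) (hω : IsOpen ω)
    (hωb : Bornology.IsBounded ω) {φ : Plane → ℝ} (hφ : IsTestFunction c.box φ) {δ κ : ℝ}
    (hδ : 0 < δ)
    (hκ : ∀ x y, dist x y ≤ (2 * c.K + 2) * δ → dist (φ x) (φ y) ≤ κ) :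
    ENNReal.ofReal |∫ x, c.cutoff δ x * inner ℝ (T x) (gradient φ x)|
      ≤ ∫⁻ t in c.interval, ENNReal.ofReal √(1 + deriv (c.smoothγ δ) t ^ 2)
        * (‖φ (c.graph t)‖ₑ + ENNReal.ofReal κ) := by
  have hI : MeasurableSet c.interval := measurableSet_Ioo
  have hc := c.contDiff_cutoff δ
  have hsm := (c.contDiff_smoothγ δ).continuous
  have hsm' := (c.contDiff_smoothγ δ).continuous_deriv_one
  have hst := continuous_deriv_step
  have hφc := hφ.continuous
  have habs := c.lipschitz_absc.continuous
  have hgr := c.lipschitz_graph.continuous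
  have he1 : Continuous fun x => c.e x 1 := (c.contDiff_e_apply 1).continuous
  let F : Plane → ℝ≥0∞ := fun x => ‖φ x‖ₑ * ENNReal.ofReal
    (√(1 + deriv (c.smoothγ δ) (c.absc x) ^ 2)
      * (deriv step ((c.e x 1 - c.smoothγ δ (c.absc x)) / δ) / δ))
  have hF : Measurable F := by
    refine hφc.measurable.enorm.mul (Continuous.measurable ?_).ennreal_ofReal
    fun_prop
  have hF1 : ENNReal.ofReal |∫ x, c.cutoff δ x * inner ℝ (T x) (gradient φ x)| ≤ ∫⁻ x, F x := by
    rw [c.integral_cutoff_mul_eq hT hω hωb hφ hδ, abs_neg, ← Real.norm_eq_abs, ofReal_norm]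
    refine (enorm_integral_le_lintegral_enorm _).trans (lintegral_mono fun x => ?_)
    simp only [F]
    rw [← ofReal_norm, ← ofReal_norm, ← ENNReal.ofReal_mul (norm_nonneg _)]
    refine ENNReal.ofReal_le_ofReal ((hT.norm_inner_le _ _).trans ?_)
    rw [norm_smul]
    gcongr
    exact c.norm_gradient_cutoff_le hδ x
  have hF2 : ∫⁻ x, F x = ∫⁻ t, ∫⁻ s, F (c.param (t, s)) := by
    have := c.lintegral_image_param hF univ univ
    have hr : range c.param = univ := c.homeo.surjective.range_eq
    rwa [univ_prod_univ, image_univ, hr, Measure.restrict_univ,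
      Measure.restrict_univ] at this
  rw [hF2] at hF1
  refine hF1.trans ?_
  rw [← lintegral_indicator hI]
  refine lintegral_mono fun t => ?_
  by_cases ht : t ∈ c.interval
  · rw [indicator_of_mem ht]
    have hval : ∀ s, F (c.param (t, s)) ≤ (ENNReal.ofReal √(1 + deriv (c.smoothγ δ) t ^ 2)
        * (‖φ (c.graph t)‖ₑ + ENNReal.ofReal κ)) *
          ENNReal.ofReal (deriv step ((s - (c.smoothγ δ t - c.γ t)) / δ) / δ) := by
      intro s
      have e1 : c.e (c.param (t, s)) 1 - c.smoothγ δ t = s - (c.smoothγ δ t - c.γ t) := by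
        simp [param]
        ring
      simp only [F, absc_param]
      rw [e1, ENNReal.ofReal_mul (Real.sqrt_nonneg _)]
      set z := (s - (c.smoothγ δ t - c.γ t)) / δ with hz
      by_cases hz2 : z ∈ Icc 1 2
      · have h1 := c.smoothγ_mem_Icc hδ t
        have h2 : δ ≤ s - (c.smoothγ δ t - c.γ t) := by
          have := hz2.1
          rwa [hz, le_div_iff₀ hδ, one_mul] at this
        have h3 : s - (c.smoothγ δ t - c.γ t) ≤ 2 * δ := by
          have := hz2.2
          rwa [hz, div_le_iff₀ hδ] at this
        have hd : dist (c.param (t, s)) (c.graph t) ≤ (2 * c.K + 2) * δ := by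
          refine (c.dist_param_le _ _ _ _).trans ?_
          rw [sub_self, abs_zero, mul_zero, zero_add, sub_zero, abs_of_nonneg (by linarith [h1.1])]
          linarith [h1.2]
        have h4 : ‖φ (c.param (t, s))‖ₑ ≤ ‖φ (c.graph t)‖ₑ + ENNReal.ofReal κ := by
          have h5 := hκ _ _ hd
          rw [dist_eq_norm] at h5
          calc ‖φ (c.param (t, s))‖ₑ
              = ‖φ (c.graph t) + (φ (c.param (t, s)) - φ (c.graph t))‖ₑ := by
                rw [add_sub_cancel]
            _ ≤ ‖φ (c.graph t)‖ₑ + ‖φ (c.param (t, s)) - φ (c.graph t)‖ₑ := enorm_add_le _ _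
            _ ≤ _ := by
                gcongr
                rw [← ofReal_norm]
                exact ENNReal.ofReal_le_ofReal h5
        calc _ ≤ (‖φ (c.graph t)‖ₑ + ENNReal.ofReal κ) *
              (ENNReal.ofReal √(1 + deriv (c.smoothγ δ) t ^ 2)
                * ENNReal.ofReal (deriv step z / δ)) := by
              gcongr
          _ = _ := by ring
      · rw [deriv_step_eq_zero hz2]
        simp
    calc ∫⁻ s, F (c.param (t, s)) ≤ ∫⁻ s, (ENNReal.ofReal √(1 + deriv (c.smoothγ δ) t ^ 2)
        * (‖φ (c.graph t)‖ₑ + ENNReal.ofReal κ)) *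
          ENNReal.ofReal (deriv step ((s - (c.smoothγ δ t - c.γ t)) / δ) / δ) := lintegral_mono hval
      _ = (ENNReal.ofReal √(1 + deriv (c.smoothγ δ) t ^ 2)
        * (‖φ (c.graph t)‖ₑ + ENNReal.ofReal κ)) * ∫⁻ s,
          ENNReal.ofReal (deriv step ((s - (c.smoothγ δ t - c.γ t)) / δ) / δ) := by
          refine lintegral_const_mul' _ _ (by finiteness)
      _ ≤ _ := mul_le_of_le_one_right zero_le (lintegral_deriv_step_le hδ _)
  · rw [indicator_of_notMem ht, nonpos_iff_eq_zero]
    refine lintegral_eq_zero_of_ae_eq_zero (Eventually.of_forall fun s => ?_)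
    have : φ (c.param (t, s)) = 0 := hφ.eq_zero_of_notMem fun h => ht (by
      have := h.1
      rwa [absc_param, ← mem_interval] at this)
    simp [F, this]

/-- Near a chart, the flux of a field of length at most `1` through the boundary is bounded by the
length of the boundary. -/
theorem ofReal_abs_integral_inner_gradient_le (hT : IsUnitField ω T) (hω : IsOpen ω)
    (hωb : Bornology.IsBounded ω) [IsFiniteMeasure (boundaryMeasure ω)] {φ : Plane → ℝ}
    (hφ : IsTestFunction c.box φ) :
    ENNReal.ofReal |∫ x, inner ℝ (T x) (gradient φ x)| ≤ ∫⁻ x, ‖φ x‖ₑ ∂boundaryMeasure ω := by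
  have hI : MeasurableSet c.interval := measurableSet_Ioo
  have hφc := hφ.continuous
  have hgr := c.lipschitz_graph.continuous
  obtain ⟨C, hC⟩ := hφ.exists_bound
  let d : ℕ → ℝ := fun n => 1 / ((n : ℝ) + 1)
  have hd0 : ∀ n, 0 < d n := fun n => by positivity
  have hdl : Tendsto d atTop (𝓝 0) := tendsto_one_div_add_atTop_nhds_zero_nat
  have hdl' : Tendsto d atTop (𝓝[>] 0) :=
    tendsto_nhdsWithin_iff.2 ⟨hdl, Eventually.of_forall hd0⟩
  have hint : Integrable fun x => inner ℝ (T x) (gradient φ x) :=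
    hT.integrable_inner hφ.integrable_gradient
  have hlim1 : Tendsto (fun n => ENNReal.ofReal
      |∫ x, c.cutoff (d n) x * inner ℝ (T x) (gradient φ x)|) atTop
      (𝓝 (ENNReal.ofReal |∫ x, inner ℝ (T x) (gradient φ x)|)) := by
    refine (ENNReal.continuous_ofReal.tendsto _).comp (Tendsto.abs ?_)
    refine tendsto_integral_of_dominated_convergence _ (fun n => ?_) hint.norm
      (fun n => Eventually.of_forall fun x => ?_) (Eventually.of_forall fun x => ?_)
    · exact (c.contDiff_cutoff _).continuous.aestronglyMeasurable.mul hint.1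
    · rw [norm_mul, cutoff, Real.norm_of_nonneg (step_nonneg _)]
      exact mul_le_of_le_one_left (norm_nonneg _) (step_le_one _)
    · by_cases hx : x ∈ c.box ∩ ω
      · refine tendsto_const_nhds.congr' ?_
        filter_upwards [hdl'.eventually
          (c.cutoff_eventually_eq_one ((c.mem_iff_height_pos hx.1).1 hx.2))] with n hn
        rw [hn, one_mul]
      · have : inner ℝ (T x) (gradient φ x) = 0 := by
          rw [mem_inter_iff, not_and_or] at hx
          rcases hx with hx | hx
          · rw [hφ.gradient_eq_zero_of_notMem hx, inner_zero_right]
          · rw [hT.eq_zero x hx, inner_zero_left]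
        simp [this]
  have key : ∀ κ : ℝ, 0 < κ → ENNReal.ofReal |∫ x, inner ℝ (T x) (gradient φ x)|
      ≤ ∫⁻ x, (‖φ x‖ₑ + ENNReal.ofReal κ) ∂boundaryMeasure ω := by
    intro κ hκ
    have hlim2 : Tendsto (fun n => ∫⁻ t in c.interval,
        ENNReal.ofReal √(1 + deriv (c.smoothγ (d n)) t ^ 2)
          * (‖φ (c.graph t)‖ₑ + ENNReal.ofReal κ)) atTop
        (𝓝 (∫⁻ t in c.interval, ENNReal.ofReal (c.speed t)
          * (‖φ (c.graph t)‖ₑ + ENNReal.ofReal κ))) := by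
      refine tendsto_lintegral_of_dominated_convergence'
        (fun _ => ENNReal.ofReal √(1 + c.K ^ 2) * (ENNReal.ofReal C + ENNReal.ofReal κ))
        (fun n => ?_) (fun n => Eventually.of_forall fun t => ?_) ?_ ?_
      · have := (c.contDiff_smoothγ (d n)).continuous_deriv_one
        refine Measurable.aemeasurable ?_
        refine Measurable.mul (Continuous.measurable ?_).ennreal_ofReal
          (Measurable.add_const (hφc.comp hgr).measurable.enorm _)
        fun_prop
      · have h1 := pow_le_pow_left₀ (abs_nonneg _) (c.abs_deriv_smoothγ_le (hd0 n) t) 2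
        rw [sq_abs] at h1
        refine mul_le_mul' (ENNReal.ofReal_le_ofReal (Real.sqrt_le_sqrt (by linarith)))
          (add_le_add_left ?_ _)
        rw [← ofReal_norm]
        exact ENNReal.ofReal_le_ofReal (hC _)
      · rw [setLIntegral_const]
        refine ENNReal.mul_ne_top (by finiteness) ?_
        rw [interval, Real.volume_Ioo]
        exact ENNReal.ofReal_ne_top
      · filter_upwards [ae_restrict_of_ae c.lip.ae_differentiableAt_of_real] with t ht
        refine ENNReal.Tendsto.mul_const ?_ (Or.inr (by finiteness))
        refine (ENNReal.continuous_ofReal.tendsto _).comp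
          ((Real.continuous_sqrt.tendsto _).comp (Tendsto.const_add _ (Tendsto.pow ?_ 2)))
        have h1 := (hasDerivAt_iff_tendsto_slope_zero.1 ht.hasDerivAt).comp
          (hdl'.mono_right (nhdsGT_le_nhdsNE 0))
        refine h1.congr fun n => ?_
        rw [(c.hasDerivAt_smoothγ _ t).deriv]
        rfl
    refine (le_of_tendsto_of_tendsto hlim1 hlim2 ?_).trans
      (c.lintegral_speed_mul_le hω (hφc.measurable.enorm.add_const _))
    obtain ⟨r, hr, hφr⟩ := Metric.uniformContinuous_iff.1
      (hφ.compactSupport.uniformContinuous_of_continuous hφc) κ hκ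
    have hK : (0 : ℝ) < 2 * c.K + 2 := by positivity
    filter_upwards [hdl.eventually (gt_mem_nhds (div_pos hr hK))] with n hn
    refine c.ofReal_abs_integral_cutoff_mul_le hT hω hωb hφ (hd0 n) fun x y hxy => (hφr ?_).le
    rw [lt_div_iff₀ hK] at hn
    linarith
  have hlim3 : Tendsto (fun n => ∫⁻ x, (‖φ x‖ₑ + ENNReal.ofReal (d n)) ∂boundaryMeasure ω) atTop
      (𝓝 (∫⁻ x, ‖φ x‖ₑ ∂boundaryMeasure ω)) := by
    simp_rw [lintegral_add_right _ measurable_const, lintegral_const]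
    have h1 : Tendsto (fun n => ENNReal.ofReal (d n)) atTop (𝓝 0) := by
      have := (ENNReal.continuous_ofReal.tendsto 0).comp hdl
      rwa [ENNReal.ofReal_zero] at this
    have h2 := (ENNReal.Tendsto.mul_const h1
      (Or.inr (measure_ne_top (boundaryMeasure ω) univ))).const_add
      (∫⁻ x, ‖φ x‖ₑ ∂boundaryMeasure ω)
    rwa [zero_mul, add_zero] at h2
  exact ge_of_tendsto' hlim3 fun n => key _ (hd0 n)

end GraphChart

/-- The flux of a field of length at most `1`, tested with `φ`, is bounded by the integral of `|φ|`
over the boundary. A partition of unity reduces the estimate to the charts. -/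
theorem IsUnitField.integral_inner_gradient_le {ω : Set Plane} {T : Plane → Plane}
    (hT : IsUnitField ω T) (hω : IsOpen ω) (hωb : Bornology.IsBounded ω)
    (hL : HasLipschitzBoundary ω) {φ : Plane → ℝ} (hφ : IsTestFunction univ φ) :
    ∫ x, inner ℝ (T x) (gradient φ x) ≤ ∫ x, ‖φ x‖ ∂boundaryMeasure ω := by
  have := isFiniteMeasure_boundaryMeasure hω hωb hL
  obtain ⟨ι, _, c, hc⟩ := hL.exists_cover hω hωb
  -- A partition of unity on the closure of `ω`: the function of index `none` is supported in `ω`,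
  -- where the divergence vanishes, and the others are supported in the boxes of the charts.
  let U : Option ι → Set Plane := fun o => o.elim ω fun i => (c i).box
  obtain ⟨f, hf⟩ := SmoothPartitionOfUnity.exists_isSubordinate (modelWithCornersSelf ℝ Plane)
    (s := closure ω) isClosed_closure U
    (by rintro (_ | i); exacts [hω, (c i).isOpen_box])
    (fun x hx => by
      by_cases h : x ∈ ω
      · exact mem_iUnion.2 ⟨none, h⟩
      · have : x ∈ frontier ω := by
          rw [hω.frontier_eq]
          exact ⟨hx, h⟩
        obtain ⟨i, hi⟩ := mem_iUnion.1 (hc this)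
        exact mem_iUnion.2 ⟨some i, (c i).halfBox_subset_box hi⟩)
  have hsum : ∀ x ∈ closure ω, ∑ o, f o x = 1 := fun x hx => by
    rw [← finsum_eq_sum_of_fintype]
    exact f.sum_eq_one hx
  have ht : ∀ o, IsTestFunction (U o) fun x => f o x * φ x := fun o => by
    have h := hφ.mul_left (f := fun x => f o x) ((f o).contMDiff.contDiff)
    exact ⟨h.smooth, h.compactSupport, (tsupport_mul_subset_left).trans (hf o)⟩
  have hgrad : ∀ x, inner ℝ (T x) (gradient φ x)
      = ∑ o, inner ℝ (T x) (gradient (fun y => f o y * φ y) x) := by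
    intro x
    by_cases hx : x ∈ ω
    · have h1 : φ =ᶠ[𝓝 x] fun y => ∑ o, f o y * φ y := by
        filter_upwards [hω.mem_nhds hx] with y hy
        rw [← Finset.sum_mul, hsum y (subset_closure hy), one_mul]
      rw [← inner_sum]
      congr 1
      refine ext_inner_right ℝ fun v => ?_
      rw [sum_inner]
      simp_rw [inner_gradient_left]
      rw [h1.fderiv_eq, fderiv_fun_sum fun o _ => (ht o).differentiable x,
        sum_apply]
    · simp [hT.eq_zero x hx]
  have hb : ∀ i : ι, |∫ x, inner ℝ (T x) (gradient (fun y => f (some i) y * φ y) x)|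
      ≤ ∫ x, ‖f (some i) x * φ x‖ ∂boundaryMeasure ω := fun i => by
    have h := (c i).ofReal_abs_integral_inner_gradient_le hT hω hωb (ht (some i))
    rw [integral_norm_eq_lintegral_enorm (ht (some i)).continuous.aestronglyMeasurable]
    refine (ENNReal.ofReal_le_iff_le_toReal ?_).1 h
    exact ((ht (some i)).integrable (μ := boundaryMeasure ω)).2.ne
  calc ∫ x, inner ℝ (T x) (gradient φ x)
      = ∑ o, ∫ x, inner ℝ (T x) (gradient (fun y => f o y * φ y) x) := by
        simp_rw [hgrad]
        exact integral_finsetSum _ fun o _ => hT.integrable_inner (ht o).integrable_gradient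
    _ = ∑ i, ∫ x, inner ℝ (T x) (gradient (fun y => f (some i) y * φ y) x) := by
        rw [Fintype.sum_option, hT.divFree _ (ht none), zero_add]
    _ ≤ ∑ i, ∫ x, ‖f (some i) x * φ x‖ ∂boundaryMeasure ω :=
        Finset.sum_le_sum fun i _ => (le_abs_self _).trans (hb i)
    _ = ∫ x, ∑ i, ‖f (some i) x * φ x‖ ∂boundaryMeasure ω :=
        (integral_finsetSum _ fun i _ => (ht (some i)).integrable.norm).symm
    _ ≤ ∫ x, ‖φ x‖ ∂boundaryMeasure ω := by
        refine integral_mono_ae (integrable_finsetSum _ fun i _ => (ht (some i)).integrable.norm)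
          hφ.integrable.norm ?_
        filter_upwards [ae_restrict_mem isClosed_frontier.measurableSet] with x hx
        simp_rw [norm_mul, ← Finset.sum_mul]
        refine mul_le_of_le_one_left (norm_nonneg _) ?_
        have h1 := hsum x (frontier_subset_closure hx)
        rw [Fintype.sum_option] at h1
        simp_rw [Real.norm_of_nonneg (f.nonneg _ x)]
        linarith [f.nonneg none x]

theorem ae_eq_of_forall_integral_mul_eq {μ : Measure Plane} [IsFiniteMeasure μ] {f g : Plane → ℝ}
    (hf : Integrable f μ) (hg : Integrable g μ)
    (h : ∀ φ, IsTestFunction univ φ → ∫ x, f x * φ x ∂μ = ∫ x, g x * φ x ∂μ) : f =ᵐ[μ] g := by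
  have h0 := ae_eq_zero_of_integral_contDiff_smul_eq_zero (hf.sub hg).locallyIntegrable
    (fun φ h1 h2 => by
      have hφ : IsTestFunction univ φ := ⟨h1, h2, subset_univ _⟩
      obtain ⟨C, hC⟩ := hφ.exists_bound
      have i1 : Integrable (fun x => f x * φ x) μ :=
        hf.mul_bdd (c := C) hφ.continuous.aestronglyMeasurable (Eventually.of_forall hC)
      have i2 : Integrable (fun x => g x * φ x) μ :=
        hg.mul_bdd (c := C) hφ.continuous.aestronglyMeasurable (Eventually.of_forall hC)
      simp_rw [smul_eq_mul, Pi.sub_apply, mul_sub, mul_comm (φ _)]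
      rw [integral_sub i1 i2, h φ hφ, sub_self])
  filter_upwards [h0] with x hx using sub_eq_zero.1 hx

theorem IsNormalTrace.ae_eq {ω : Set Plane} [IsFiniteMeasure (boundaryMeasure ω)]
    {σ : Plane → Space} {s s' : Plane → ℝ} (h : IsNormalTrace ω σ s) (h' : IsNormalTrace ω σ s') :
    s =ᵐ[boundaryMeasure ω] s' :=
  ae_eq_of_forall_integral_mul_eq (h.memLp.integrable le_top) (h'.memLp.integrable le_top)
    fun φ hφ => by rw [← h.green φ hφ, h'.green φ hφ]

theorem IsNormalTrace.normalTrace_ae_eq {ω : Set Plane} [IsFiniteMeasure (boundaryMeasure ω)]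
    {σ : Plane → Space} {s : Plane → ℝ} (h : IsNormalTrace ω σ s) :
    normalTrace ω σ =ᵐ[boundaryMeasure ω] s := by
  have hex : ∃ s, IsNormalTrace ω σ s := ⟨s, h⟩
  rw [normalTrace, dif_pos hex]
  exact hex.choose_spec.ae_eq h

/-- The normal trace of a field of length at most `1` is a function of modulus at most `1`. -/
theorem IsUnitField.exists_normalTrace {ω : Set Plane} {T : Plane → Plane}
    (hT : IsUnitField ω T) (hω : IsOpen ω) (hωb : Bornology.IsBounded ω)
    (hL : HasLipschitzBoundary ω) :
    ∃ s : Plane → ℝ, StronglyMeasurable s ∧ (∀ x, ‖s x‖ ≤ 1) ∧ ∀ φ, IsTestFunction univ φ →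
      ∫ x, inner ℝ (T x) (gradient φ x) = ∫ x, s x * φ x ∂boundaryMeasure ω := by
  have := isFiniteMeasure_boundaryMeasure hω hωb hL
  have hi : ∀ φ : testSpace univ, Integrable fun x => inner ℝ (T x) (gradientₗ univ φ x) :=
    fun φ => hT.integrable_inner φ.2.integrable_gradient
  obtain ⟨s, hsm, hs1, hs⟩ := exists_density (μ := boundaryMeasure ω) (H := ℝ)
    (testSpace univ).subtype (fun φ => φ.2.integrable)
    { toFun := fun φ => ∫ x, inner ℝ (T x) (gradientₗ univ φ x)
      map_add' := fun φ ψ => by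
        rw [← integral_add (hi φ) (hi ψ)]
        simp only [map_add, Pi.add_apply, inner_add_right]
      map_smul' := fun c φ => by
        rw [RingHom.id_apply, smul_eq_mul, ← integral_const_mul]
        simp only [map_smul, Pi.smul_apply, inner_smul_right] }
    (fun φ => hT.integral_inner_gradient_le hω hωb hL φ.2)
  refine ⟨s, hsm, hs1, fun φ hφ => ?_⟩
  have := hs ⟨φ, hφ⟩
  simpa [gradientₗ, mul_comm] using this

theorem IsUnitField.setIntegral_eq {ω : Set Plane} {T : Plane → Plane}
    (hT : IsUnitField ω T) {σ : Plane → Space}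
    (hσ : ∀ᵐ x ∂volume.restrict ω, planar (σ x) = T x) (f : Plane → Plane) :
    ∫ x in ω, inner ℝ (planar (σ x)) (f x) = ∫ x, inner ℝ (T x) (f x) := by
  rw [← setIntegral_eq_integral_of_forall_compl_eq_zero (s := ω)
    (f := fun x => inner ℝ (T x) (f x)) (fun x hx => by rw [hT.eq_zero x hx, inner_zero_left])]
  refine integral_congr_ae ?_
  filter_upwards [hσ] with x hx
  rw [hx]

/-! ### The measure `σ · Du` -/

/-- The distribution `σ · Du` is `h |Du|` with `|h| ≤ 1`. -/
theorem IsUnitField.exists_pairing_density {ω : Set Plane} {T : Plane → Plane}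
    (hT : IsUnitField ω T) (hω : IsOpen ω) (hωb : Bornology.IsBounded ω)
    {u : Plane → ℝ} (hu : IsBV ω u) {σ : Plane → Space}
    (hσ : ∀ᵐ x ∂volume.restrict ω, planar (σ x) = T x) :
    ∃ h : Plane → ℝ, StronglyMeasurable h ∧ (∀ x, ‖h x‖ ≤ 1) ∧
      (∀ φ, IsTestFunction ω φ → -∫ x in ω, inner ℝ (T x) (gradient φ x) * u x
        = ∫ x, h x * φ x ∂(gradientMeasure ω u).variation) ∧
      ∀ B, MeasurableSet B → B ⊆ ω →
        pairingMeasure ω σ u B = ∫ x in B, h x ∂(gradientMeasure ω u).variation := by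
  have := hu.isFiniteMeasure
  obtain ⟨g, hgm, hg1, hg, _⟩ := exists_polar (gradientMeasure ω u)
  have hg' : ∀ φ, IsTestFunction ω φ → ∫ x in ω, u x • gradient φ x
      = -∫ x, φ x • g x ∂(gradientMeasure ω u).variation := fun φ hφ => by
    rw [← hg φ hφ.integrable, ← hu.isGradientMeasure.integral_eq φ hφ]
  have hi : ∀ φ : testSpace ω, Integrable (fun x => inner ℝ (T x) (gradientₗ ω φ x) * u x)
      (volume.restrict ω) := fun φ => by
    have h1 : Integrable (fun x => u x • gradient (φ : Plane → ℝ) x) (volume.restrict ω) :=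
      φ.2.integrable_mul_gradient hu.1
    refine (hT.integrable_inner h1).congr (Eventually.of_forall fun x => ?_)
    simp only [inner_smul_right]
    exact mul_comm _ _
  obtain ⟨h, hhm, hh1, hh⟩ := exists_density (μ := (gradientMeasure ω u).variation) (H := ℝ)
    (testSpace ω).subtype (fun φ => φ.2.integrable)
    { toFun := fun φ => -∫ x in ω, inner ℝ (T x) (gradientₗ ω φ x) * u x
      map_add' := fun φ ψ => by
        rw [← neg_add, ← integral_add (hi φ) (hi ψ)]
        simp only [map_add, Pi.add_apply, inner_add_right, add_mul]
      map_smul' := fun c φ => by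
        rw [RingHom.id_apply, smul_eq_mul, mul_neg, ← integral_const_mul]
        simp only [map_smul, Pi.smul_apply, inner_smul_right, mul_assoc] }
    (fun φ => (neg_le_abs _).trans
      (hT.abs_integral_inner_gradient_mul_le hω hωb hu.1 hgm hg1 hg' φ.2))
  have hh' : ∀ φ, IsTestFunction ω φ → -∫ x in ω, inner ℝ (T x) (gradient φ x) * u x
      = ∫ x, h x * φ x ∂(gradientMeasure ω u).variation := fun φ hφ => by
    have := hh ⟨φ, hφ⟩
    simpa [gradientₗ, mul_comm] using this
  have hhi : Integrable h (gradientMeasure ω u).variation :=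
    Integrable.of_bound hhm.aestronglyMeasurable 1 (Eventually.of_forall hh1)
  have hpair : ∀ φ, pairing ω σ u φ = -∫ x in ω, inner ℝ (T x) (gradient φ x) * u x := fun φ => by
    rw [pairing]
    congr 1
    refine integral_congr_ae ?_
    filter_upwards [hσ] with x hx
    rw [hx]
  have := isFiniteMeasure_variation_withDensityᵥ hhi
  have hm : IsPairingMeasure ω σ u
      ((gradientMeasure ω u).variation.withDensityᵥ h) := fun φ hφ => by
    rw [integral_withDensityᵥ hhi hφ.integrable, hpair, hh' φ hφ]
    simp [mul_comm]
  refine ⟨h, hhm, hh1, hh', fun B hB hBω => ?_⟩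
  have hex : ∃ m, IsPairingMeasure ω σ u m := ⟨_, hm⟩
  have hspec : IsPairingMeasure ω σ u (pairingMeasure ω σ u) := by
    rw [pairingMeasure, dif_pos hex]
    exact hex.choose_spec
  have hfin : IsFiniteMeasure (pairingMeasure ω σ u).variation := by
    rw [← SignedMeasure.totalVariation_eq_variation]
    infer_instance
  rw [← withDensityᵥ_apply hhi hB]
  exact vectorMeasure_eq_on_of_forall_integral_eq hω
    (fun φ hφ => by rw [← hspec φ hφ, hm φ hφ]) hB hBω

/-! ### Smooth functions on the boundary -/

theorem trace_eq_of_isTestFunction {ω : Set Plane} (hω : IsOpen ω) (hL : HasLipschitzBoundary ω)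
    {φ : Plane → ℝ} (hφ : IsTestFunction univ φ) {x : Plane} (hx : x ∈ frontier ω) :
    trace ω φ x = φ x := by
  obtain ⟨c, hc⟩ := hL.exists_chart hω hx
  have hb := c.halfBox_subset_box hc
  have h0 : c.graph (c.absc x) = x := by
    rw [GraphChart.graph, ← (c.mem_frontier_iff hω hb).1 hx, c.param_absc_height]
  rw [← h0]
  exact c.trace_eq hφ.integrable (c.mem_interval.2 hb.1)
    (isTraceAt_of_continuous hφ.continuous _)

/-- Smooth functions are dense in `L¹(∂ω)`. -/
theorem exists_isTestFunction_lintegral_sub_le {ω : Set Plane} (hωb : Bornology.IsBounded ω)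
    [IsFiniteMeasure (boundaryMeasure ω)] {f : Plane → ℝ} (hf : Integrable f (boundaryMeasure ω))
    {ε : ℝ≥0∞} (hε : 0 < ε) :
    ∃ φ, IsTestFunction univ φ ∧ ∫⁻ x, ‖f x - φ x‖ₑ ∂boundaryMeasure ω ≤ ε := by
  have hε2 : ε / 2 ≠ 0 := (ENNReal.half_pos hε.ne').ne'
  obtain ⟨g, hgs, hg, hgc, _⟩ :=
    (memLp_one_iff_integrable.2 hf).exists_hasCompactSupport_eLpNorm_sub_le
      ENNReal.one_ne_top hε2
  rw [eLpNorm_one_eq_lintegral_enorm] at hg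
  obtain ⟨κ, hκ0, hκ⟩ := ENNReal.exists_pos_mul_lt (measure_ne_top (boundaryMeasure ω) univ) hε2
  obtain ⟨η, hη0, hη⟩ : ∃ η : ℝ, 0 < η ∧ ENNReal.ofReal η ≤ κ := by
    rcases eq_or_ne κ ∞ with rfl | hk
    · exact ⟨1, one_pos, le_top⟩
    · exact ⟨κ.toReal, ENNReal.toReal_pos hκ0.ne' hk, (ENNReal.ofReal_toReal hk).le⟩
  obtain ⟨ψ, hψ, hψg⟩ := (hgs.uniformContinuous_of_continuous hgc).exists_contDiff_dist_le hη0
  obtain ⟨R, hR0, hR⟩ := hωb.closure.subset_closedBall_lt 0 0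
  -- The smooth approximation `ψ` need not have compact support; `χ` is `1` on the boundary.
  let χ : ContDiffBump (0 : Plane) := ⟨R, R + 1, hR0, lt_add_one R⟩
  refine ⟨fun x => ψ x * χ x, ⟨hψ.mul χ.contDiff, χ.hasCompactSupport.mul_left, subset_univ _⟩, ?_⟩
  calc ∫⁻ x, ‖f x - ψ x * χ x‖ₑ ∂boundaryMeasure ω
      ≤ ∫⁻ x, (‖(f - g) x‖ₑ + ENNReal.ofReal η) ∂boundaryMeasure ω := by
        refine lintegral_mono_ae ?_
        filter_upwards [ae_restrict_mem isClosed_frontier.measurableSet] with x hx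
        have h1 : χ x = 1 := χ.one_of_mem_closedBall (hR (frontier_subset_closure hx))
        have h2 := (hψg x).le
        rw [dist_comm, dist_eq_norm] at h2
        rw [h1, mul_one, ← sub_add_sub_cancel (f x) (g x) (ψ x)]
        refine (enorm_add_le _ _).trans (add_le_add_right ?_ _)
        rw [← ofReal_norm]
        exact ENNReal.ofReal_le_ofReal h2
    _ ≤ ε / 2 + ε / 2 := by
        rw [lintegral_add_right _ measurable_const, lintegral_const]
        exact add_le_add hg ((mul_le_mul_left hη _).trans hκ.le)
    _ = ε := ENNReal.add_halves ε

/-! ### Green's formula -/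

theorem lipschitzWith_mollify {δ : ℝ} (hδ : 0 < δ) {f : Plane → ℝ} {K : NNReal}
    (hf : LipschitzWith K f) : LipschitzWith K (mollify hδ f) := by
  refine LipschitzWith.of_dist_le_mul fun x y => ?_
  have hi : ∀ x, Integrable fun z => mollifier hδ z • f (x - z) := fun x => by
    have := hf.continuous
    have := (contDiff_mollifier hδ).continuous
    refine Continuous.integrable_of_hasCompactSupport (by fun_prop)
      ((hasCompactSupport_mollifier hδ).smul_right)
  have e : ∀ x, mollify hδ f x = ∫ z, mollifier hδ z • f (x - z) := fun x => by
    rw [mollify_eq_convolution]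
    rfl
  rw [dist_eq_norm, e, e, ← integral_sub (hi x) (hi y)]
  refine (norm_integral_le_of_norm_le ((integrable_mollifier hδ).mul_const (K * dist x y))
    (Eventually.of_forall fun z => ?_)).trans_eq ?_
  · rw [← smul_sub, norm_smul, Real.norm_of_nonneg (mollifier_nonneg hδ z), ← dist_eq_norm]
    refine mul_le_mul_of_nonneg_left ?_ (mollifier_nonneg hδ z)
    simpa using hf.dist_le_mul (x - z) (y - z)
  · rw [integral_mul_const, integral_mollifier, one_mul]

theorem mollify_eq_of_eq_on_ball {δ : ℝ} (hδ : 0 < δ) {f : Plane → ℝ} {x : Plane} {a : ℝ}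
    (h : ∀ y, dist x y < δ → f y = a) : mollify hδ f x = a := by
  have : ∀ y, mollifier hδ (x - y) • f y = mollifier hδ (x - y) * a := fun y => by
    by_cases hy : dist x y < δ
    · rw [h y hy, smul_eq_mul]
    · rw [mollifier_eq_zero hδ (by rwa [← dist_eq_norm, ← not_lt]), zero_smul, zero_mul]
  rw [mollify]
  simp_rw [this]
  rw [integral_mul_const, integral_mollifier_sub, one_mul]

/-- A cutoff which is `1` at distance at least `4 δ` from the complement of `ω`, `0` at distance at
most `δ`, and whose gradient is at most `1 / δ`. -/
noncomputable def innerCutoff (ω : Set Plane) {δ : ℝ} (hδ : 0 < δ) : Plane → ℝ :=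
  mollify hδ fun x => max 0 (min 1 (δ⁻¹ * Metric.infDist x ωᶜ - 2))

section InnerCutoff

variable {ω : Set Plane} {δ : ℝ} (hδ : 0 < δ)

theorem lipschitzWith_innerCutoff : LipschitzWith (Real.toNNReal δ⁻¹) (innerCutoff ω hδ) := by
  refine lipschitzWith_mollify hδ ?_
  refine LipschitzWith.const_max (LipschitzWith.const_min ?_ _) _
  refine LipschitzWith.of_dist_le_mul fun x y => ?_
  rw [Real.dist_eq, Real.coe_toNNReal _ (by positivity), sub_sub_sub_cancel_right, ← mul_sub,
    abs_mul, abs_of_pos (inv_pos.2 hδ)]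
  gcongr
  have := (Metric.lipschitz_infDist_pt ωᶜ).dist_le_mul x y
  simpa [Real.dist_eq] using this

theorem innerCutoff_eq_zero {x : Plane} (hx : Metric.infDist x ωᶜ ≤ δ) :
    innerCutoff ω hδ x = 0 := by
  refine mollify_eq_of_eq_on_ball hδ fun y hy => ?_
  have h1 := Metric.infDist_le_infDist_add_dist (s := ωᶜ) (x := y) (y := x)
  rw [dist_comm] at h1
  refine max_eq_left ((min_le_right _ _).trans ?_)
  rw [sub_nonpos, inv_mul_le_iff₀ hδ]
  linarith

theorem innerCutoff_eq_one {x : Plane} (hx : 4 * δ ≤ Metric.infDist x ωᶜ) :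
    innerCutoff ω hδ x = 1 := by
  refine mollify_eq_of_eq_on_ball hδ fun y hy => ?_
  have h1 := Metric.infDist_le_infDist_add_dist (s := ωᶜ) (x := x) (y := y)
  have : 1 ≤ δ⁻¹ * Metric.infDist y ωᶜ - 2 := by
    rw [le_sub_iff_add_le, le_inv_mul_iff₀ hδ]
    linarith
  rw [min_eq_left this, max_eq_right zero_le_one]

theorem norm_innerCutoff_le_one (x : Plane) : ‖innerCutoff ω hδ x‖ ≤ 1 := by
  refine norm_mollify_le hδ (fun y => ?_) x
  rw [Real.norm_of_nonneg (le_max_left _ _)]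
  exact max_le zero_le_one (min_le_left _ _)

theorem tsupport_innerCutoff_subset :
    tsupport (innerCutoff ω hδ) ⊆ {x | δ ≤ Metric.infDist x ωᶜ} := by
  refine closure_minimal (fun x hx => ?_)
    (isClosed_le continuous_const (Metric.continuous_infDist_pt _))
  by_contra h
  exact hx (innerCutoff_eq_zero hδ (not_le.1 h).le)

theorem contDiff_innerCutoff : ContDiff ℝ (⊤ : ℕ∞) (innerCutoff ω hδ) := by
  refine contDiff_mollify hδ (Continuous.locallyIntegrable ?_)
  have := Metric.continuous_infDist_pt ωᶜ
  fun_prop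

theorem isTestFunction_innerCutoff (hωb : Bornology.IsBounded ω) :
    IsTestFunction ω (innerCutoff ω hδ) := by
  have h : tsupport (innerCutoff ω hδ) ⊆ ω := fun x hx => by
    by_contra hxω
    have h1 : δ ≤ Metric.infDist x ωᶜ := tsupport_innerCutoff_subset hδ hx
    rw [Metric.infDist_zero_of_mem (show x ∈ ωᶜ from hxω)] at h1
    exact absurd hδ (not_lt.2 h1)
  exact ⟨contDiff_innerCutoff hδ, Metric.isCompact_of_isClosed_isBounded (isClosed_tsupport _)
    (hωb.subset h), h⟩

theorem norm_gradient_innerCutoff_le (x : Plane) :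
    ‖gradient (innerCutoff ω hδ) x‖ ≤ δ⁻¹ := by
  rw [norm_gradient]
  have := norm_fderiv_le_of_lipschitz ℝ (lipschitzWith_innerCutoff (ω := ω) hδ) (x₀ := x)
  rwa [Real.coe_toNNReal _ (by positivity)] at this

theorem gradient_innerCutoff_eq_zero {x : Plane} (hx : 4 * δ < Metric.infDist x ωᶜ) :
    gradient (innerCutoff ω hδ) x = 0 := by
  have h : innerCutoff ω hδ =ᶠ[𝓝 x] fun _ => 1 := by
    filter_upwards [(isOpen_lt continuous_const (Metric.continuous_infDist_pt ωᶜ)).mem_nhds hx]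
      with y hy using innerCutoff_eq_one hδ (le_of_lt hy)
  rw [gradient, h.fderiv_eq, fderiv_const_apply, map_zero]

end InnerCutoff

/-- The points of `ω` near its boundary lie in thin strips over the graphs of finitely many
charts. -/
theorem exists_strips {ω : Set Plane} (hω : IsOpen ω) (hωb : Bornology.IsBounded ω)
    {ι : Type} [Fintype ι] {c : ι → GraphChart ω} (hc : frontier ω ⊆ ⋃ i, (c i).halfBox) :
    ∃ δ₀ > 0, ∀ δ, 0 < δ → δ ≤ δ₀ → ∀ x ∈ ω, Metric.infDist x ωᶜ ≤ 4 * δ →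
      ∃ i, x ∈ (c i).param '' ((c i).interval ×ˢ Ioo 0 (5 * (1 + (c i).K) * δ)) := by
  have hK : IsCompact (frontier ω) := Metric.isCompact_of_isClosed_isBounded isClosed_frontier
    (hωb.closure.subset frontier_subset_closure)
  obtain ⟨r, hr, hrs⟩ := hK.exists_thickening_subset_open
    (isOpen_iUnion fun i => (c i).isOpen_halfBox) hc
  obtain ⟨r', hr', hri⟩ : ∃ r' > 0, ∀ i, 4 * (1 + (c i).K) * r' ≤ (c i).ρ / 4 := by
    have h : ∀ i, ∃ r' > 0, ∀ r'' ≤ r', 4 * (1 + ((c i).K : ℝ)) * r'' ≤ (c i).ρ / 4 := fun i => by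
      have hpos : 0 < 4 * (1 + ((c i).K : ℝ)) := by positivity
      refine ⟨(c i).ρ / 4 / (4 * (1 + (c i).K)), div_pos (by linarith [(c i).ρ_pos]) hpos,
        fun r'' h => ?_⟩
      rwa [le_div_iff₀ hpos, mul_comm] at h
    choose R hR0 hR using h
    rcases isEmpty_or_nonempty ι with hι | hι
    · exact ⟨1, one_pos, fun i => hι.elim i⟩
    · obtain ⟨i₀, hi₀⟩ := Finite.exists_min R
      exact ⟨R i₀, hR0 i₀, fun i => hR i _ (hi₀ i)⟩
  refine ⟨min (r / 8) r', by positivity, fun δ hδ hδ₀ x hx hxd => ?_⟩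
  have h1 : δ ≤ r / 8 := hδ₀.trans (min_le_left _ _)
  have h2 : δ ≤ r' := hδ₀.trans (min_le_right _ _)
  have hne : ω ≠ univ := by
    rintro rfl
    exact NormedSpace.unbounded_univ ℝ Plane hωb
  obtain ⟨y, hy, hxy⟩ := exists_mem_frontier_infDist_compl_eq_dist hx hne
  rw [hxy] at hxd
  obtain ⟨i, hi⟩ := mem_iUnion.1 (hrs (Metric.mem_thickening_iff.2 ⟨y, hy, by linarith⟩))
  have hKi : (0 : ℝ) ≤ (c i).K := (c i).K.2
  have hρ := (c i).ρ_pos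
  have hsmall : 4 * (1 + ((c i).K : ℝ)) * δ ≤ (c i).ρ / 4 :=
    (mul_le_mul_of_nonneg_left h2 (by positivity)).trans (hri i)
  have h4δ : 4 * δ ≤ (c i).ρ / 4 := by nlinarith
  have ha : |(c i).absc x - (c i).absc y| ≤ 4 * δ := by
    have := (c i).lipschitz_absc.dist_le_mul x y
    rw [Real.dist_eq, NNReal.coe_one, one_mul] at this
    linarith
  have hh : |(c i).height x - (c i).height y| ≤ 4 * (1 + (c i).K) * δ := by
    have := (c i).lipschitz_height.dist_le_mul x y
    rw [Real.dist_eq] at this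
    push_cast at this
    refine this.trans ?_
    have := mul_le_mul_of_nonneg_left hxd (show (0 : ℝ) ≤ 1 + (c i).K by positivity)
    linarith
  have hyb : y ∈ (c i).box := by
    constructor
    · have h3 := abs_sub_le ((c i).absc y) ((c i).absc x) (c i).t₀
      have h4 := hi.1
      rw [abs_sub_comm] at ha
      linarith
    · have h3 := abs_sub_abs_le_abs_sub ((c i).height y) ((c i).height x)
      have h4 := hi.2
      rw [abs_sub_comm] at h3
      linarith
  rw [((c i).mem_frontier_iff hω hyb).1 hy, sub_zero] at hh
  have hxb := (c i).halfBox_subset_box hi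
  refine ⟨i, (c i).mem_image_param.2 ⟨(c i).mem_interval.2 hxb.1,
    ((c i).mem_iff_height_pos hxb).1 hx, ?_⟩⟩
  have : 0 < (1 + ((c i).K : ℝ)) * δ := by positivity
  have h5 := le_abs_self ((c i).height x)
  dsimp only
  linarith

/-- The commutator term in Green's formula, `∫ |u - φ| |∇η|` with a cutoff `η` of gradient at most
`1 / δ` near the boundary, is controlled by the distance of the traces in `L¹(∂ω)`. -/
theorem exists_lintegral_gradient_innerCutoff_le {ω : Set Plane} (hω : IsOpen ω)
    (hωb : Bornology.IsBounded ω) (hL : HasLipschitzBoundary ω) :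
    ∃ M : ℝ≥0∞, M ≠ ∞ ∧ ∀ u, IsBV ω u → ∀ φ, IsTestFunction univ φ → ∀ η : ℝ, 0 < η →
      ∃ δ₀ > 0, ∀ δ, ∀ hδ : 0 < δ, δ ≤ δ₀ →
        ∫⁻ x in ω, ‖u x - φ x‖ₑ * ‖gradient (innerCutoff ω hδ) x‖ₑ
          ≤ M * ((∫⁻ x, ‖trace ω u x - φ x‖ₑ ∂boundaryMeasure ω) + ENNReal.ofReal η) := by
  obtain ⟨ι, _, c, hc⟩ := hL.exists_cover hω hωb
  obtain ⟨δ₁, hδ₁, hstrip⟩ := exists_strips hω hωb hc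
  refine ⟨∑ i, ENNReal.ofReal (5 * (1 + (c i).K)),
    ENNReal.sum_ne_top.2 fun i _ => ENNReal.ofReal_ne_top, fun u hu φ hφ η hη => ?_⟩
  have hφu : UniformContinuous φ := hφ.compactSupport.uniformContinuous_of_continuous hφ.continuous
  choose R hR0 hR using fun i => (c i).exists_lintegral_sub_le hω hu hφu hη
  obtain ⟨r, hr, hri⟩ : ∃ r > 0, ∀ i, 5 * (1 + ((c i).K : ℝ)) * r ≤ R i := by
    have hpos : ∀ i, 0 < 5 * (1 + ((c i).K : ℝ)) := fun i => by positivity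
    rcases isEmpty_or_nonempty ι with hι | hι
    · exact ⟨1, one_pos, fun i => hι.elim i⟩
    · obtain ⟨i₀, hi₀⟩ := Finite.exists_min fun i => R i / (5 * (1 + ((c i).K : ℝ)))
      refine ⟨_, div_pos (hR0 i₀) (hpos i₀), fun i => ?_⟩
      have := hi₀ i
      rwa [le_div_iff₀ (hpos i), mul_comm] at this
  refine ⟨min δ₁ r, lt_min hδ₁ hr, fun δ hδ hδ₀ => ?_⟩
  set D := (∫⁻ x, ‖trace ω u x - φ x‖ₑ ∂boundaryMeasure ω) + ENNReal.ofReal η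
  let S : ι → Set Plane := fun i =>
    (c i).param '' ((c i).interval ×ˢ Ioo 0 (5 * (1 + (c i).K) * δ))
  have hSm : ∀ i, MeasurableSet (S i) := fun i =>
    (c i).measurableEmbedding_param.measurableSet_image.2
      (measurableSet_Ioo.prod measurableSet_Ioo)
  have hδ0 : ENNReal.ofReal δ ≠ 0 := by simpa using hδ
  calc ∫⁻ x in ω, ‖u x - φ x‖ₑ * ‖gradient (innerCutoff ω hδ) x‖ₑ
      ≤ ∫⁻ x in ω, (⋃ i, S i).indicator (fun x => ENNReal.ofReal δ⁻¹ * ‖u x - φ x‖ₑ) x := by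
        refine setLIntegral_mono' hω.measurableSet fun x hx => ?_
        rcases le_or_gt (Metric.infDist x ωᶜ) (4 * δ) with h | h
        · rw [indicator_of_mem (mem_iUnion.2 (hstrip δ hδ (hδ₀.trans (min_le_left _ _)) x hx h)),
            mul_comm]
          gcongr
          rw [← ofReal_norm]
          exact ENNReal.ofReal_le_ofReal (norm_gradient_innerCutoff_le hδ x)
        · rw [gradient_innerCutoff_eq_zero hδ h]
          simp
    _ ≤ ∫⁻ x in ⋃ i, S i, ENNReal.ofReal δ⁻¹ * ‖u x - φ x‖ₑ := by
        rw [← lintegral_indicator (MeasurableSet.iUnion hSm)]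
        exact setLIntegral_le_lintegral _ _
    _ ≤ ∑ i, ∫⁻ x in S i, ENNReal.ofReal δ⁻¹ * ‖u x - φ x‖ₑ := by
        refine (lintegral_iUnion_le _ _).trans_eq (tsum_fintype _)
    _ ≤ ∑ i, ENNReal.ofReal (5 * (1 + (c i).K)) * D := by
        refine Finset.sum_le_sum fun i _ => ?_
        rw [lintegral_const_mul' _ _ ENNReal.ofReal_ne_top]
        have h1 := hR i (5 * (1 + (c i).K) * δ) (by positivity)
          ((mul_le_mul_of_nonneg_left (hδ₀.trans (min_le_right _ _)) (by positivity)).trans (hri i))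
        refine (mul_le_mul_right h1 _).trans_eq ?_
        rw [ENNReal.ofReal_mul (by positivity), ENNReal.ofReal_inv_of_pos hδ]
        calc _ = ((ENNReal.ofReal δ)⁻¹ * ENNReal.ofReal δ)
                * (ENNReal.ofReal (5 * (1 + (c i).K)) * D) := by
              ring
          _ = _ := by rw [ENNReal.inv_mul_cancel hδ0 ENNReal.ofReal_ne_top, one_mul]
    _ = _ := by rw [Finset.sum_mul]

/-- Green's formula in approximate form: the error is the error made in replacing the trace of `u`
by a smooth function. -/
theorem IsUnitField.ofReal_abs_sub_le {ω : Set Plane} {T : Plane → Plane}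
    (hT : IsUnitField ω T) (hω : IsOpen ω) (hωb : Bornology.IsBounded ω)
    {u : Plane → ℝ} (hu : IsBV ω u) {h : Plane → ℝ} (hhm : StronglyMeasurable h)
    (hh1 : ∀ x, ‖h x‖ ≤ 1)
    (hh : ∀ φ, IsTestFunction ω φ → -∫ x in ω, inner ℝ (T x) (gradient φ x) * u x
      = ∫ x, h x * φ x ∂(gradientMeasure ω u).variation)
    {φ : Plane → ℝ} (hφ : IsTestFunction univ φ) {C : ℝ≥0∞}
    (hC : ∃ δ₀ > 0, ∀ δ, ∀ hδ : 0 < δ, δ ≤ δ₀ →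
      ∫⁻ x in ω, ‖u x - φ x‖ₑ * ‖gradient (innerCutoff ω hδ) x‖ₑ ≤ C) :
    ENNReal.ofReal |(∫ x in ω, h x ∂(gradientMeasure ω u).variation)
      - ∫ x, inner ℝ (T x) (gradient φ x)| ≤ C := by
  have := hu.isFiniteMeasure
  obtain ⟨δ₀, hδ₀, hC⟩ := hC
  have hne : ω ≠ univ := by
    rintro rfl
    exact NormedSpace.unbounded_univ ℝ Plane hωb
  let d : ℕ → ℝ := fun n => 1 / ((n : ℝ) + 1)
  have hd0 : ∀ n, 0 < d n := fun n => by positivity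
  have hdl : Tendsto d atTop (𝓝 0) := tendsto_one_div_add_atTop_nhds_zero_nat
  let η : ℕ → Plane → ℝ := fun n => innerCutoff ω (hd0 n)
  have hη : ∀ n, IsTestFunction ω (η n) := fun n => isTestFunction_innerCutoff (hd0 n) hωb
  have hη1 : ∀ n x, ‖η n x‖ ≤ 1 := fun n x => norm_innerCutoff_le_one (hd0 n) x
  have hηω : ∀ x ∈ ω, ∀ᶠ n in atTop, η n x = 1 := fun x hx => by
    have hpos : 0 < Metric.infDist x ωᶜ :=
      (hω.isClosed_compl.notMem_iff_infDist_pos (nonempty_compl.2 hne)).1 (not_not.2 hx)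
    filter_upwards [hdl.eventually (gt_mem_nhds (div_pos hpos (zero_lt_four' ℝ)))] with n hn
    refine innerCutoff_eq_one (hd0 n) ?_
    rw [lt_div_iff₀ zero_lt_four] at hn
    linarith
  have hhi : Integrable h (gradientMeasure ω u).variation :=
    Integrable.of_bound hhm.aestronglyMeasurable 1 (Eventually.of_forall hh1)
  have hTφ : Integrable fun x => inner ℝ (T x) (gradient φ x) :=
    hT.integrable_inner hφ.integrable_gradient
  have ha : Tendsto (fun n => ∫ x, h x * η n x ∂(gradientMeasure ω u).variation) atTop
      (𝓝 (∫ x in ω, h x ∂(gradientMeasure ω u).variation)) := by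
    rw [← integral_indicator hω.measurableSet]
    refine tendsto_integral_of_dominated_convergence _ (fun n => ?_) hhi.norm
      (fun n => Eventually.of_forall fun x => ?_) (Eventually.of_forall fun x => ?_)
    · exact hhi.1.mul (hη n).continuous.aestronglyMeasurable
    · rw [norm_mul]
      exact mul_le_of_le_one_right (norm_nonneg _) (hη1 n x)
    · by_cases hx : x ∈ ω
      · rw [indicator_of_mem hx]
        refine tendsto_const_nhds.congr' ?_
        filter_upwards [hηω x hx] with n hn
        rw [hn, mul_one]
      · rw [indicator_of_notMem hx]
        simp [fun n => (hη n).eq_zero_of_notMem hx]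
  have hb : Tendsto (fun n => ∫ x, η n x * inner ℝ (T x) (gradient φ x)) atTop
      (𝓝 (∫ x, inner ℝ (T x) (gradient φ x))) := by
    refine tendsto_integral_of_dominated_convergence _ (fun n => ?_) hTφ.norm
      (fun n => Eventually.of_forall fun x => ?_) (Eventually.of_forall fun x => ?_)
    · exact (hη n).continuous.aestronglyMeasurable.mul hTφ.1
    · rw [norm_mul]
      exact mul_le_of_le_one_left (norm_nonneg _) (hη1 n x)
    · by_cases hx : x ∈ ω
      · refine tendsto_const_nhds.congr' ?_
        filter_upwards [hηω x hx] with n hn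
        rw [hn, one_mul]
      · simp [hT.eq_zero x hx]
  have hbn : ∀ n, ∫ x, η n x * inner ℝ (T x) (gradient φ x)
      = -∫ x in ω, inner ℝ (T x) (gradient (η n) x) * φ x := fun n => by
    have h0 := hT.divFree _ ((hη n).mul_left hφ.smooth)
    have e : ∀ x, gradient (φ * η n) x = φ x • gradient (η n) x + η n x • gradient φ x :=
      fun x => gradient_mul' (hφ.differentiable x) ((hη n).differentiable x)
    change ∫ x, inner ℝ (T x) (gradient (φ * η n) x) = 0 at h0
    simp_rw [e, inner_add_right, inner_smul_right] at h0
    rw [integral_add] at h0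
    · rw [setIntegral_eq_integral_of_forall_compl_eq_zero (fun x hx => by
        rw [hT.eq_zero x hx, inner_zero_left, zero_mul])]
      simp_rw [mul_comm (inner ℝ (T _) _) (φ _)]
      linarith
    · obtain ⟨B, hB⟩ := hφ.exists_bound
      exact (hT.integrable_inner (hη n).integrable_gradient).bdd_mul (c := B)
        hφ.continuous.aestronglyMeasurable (Eventually.of_forall hB)
    · exact hTφ.bdd_mul (c := 1) (hη n).continuous.aestronglyMeasurable
        (Eventually.of_forall (hη1 n))
  have i1 : ∀ n, IntegrableOn (fun x => inner ℝ (T x) (gradient (η n) x) * u x) ω := fun n => by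
    have h1 : Integrable (fun x => u x • gradient (η n) x) (volume.restrict ω) :=
      (hη n).integrable_mul_gradient hu.1
    refine (hT.integrable_inner h1).congr (Eventually.of_forall fun x => ?_)
    simp only [inner_smul_right]
    exact mul_comm _ _
  have i2 : ∀ n, IntegrableOn (fun x => inner ℝ (T x) (gradient (η n) x) * φ x) ω := fun n => by
    obtain ⟨B, hB⟩ := hφ.exists_bound
    exact ((hT.integrable_inner (hη n).integrable_gradient).mul_bdd (c := B)
      hφ.continuous.aestronglyMeasurable (Eventually.of_forall hB)).integrableOn
  -- With the cutoffs `ηₙ`, the difference is `-∫ (T · ∇ηₙ) (u - φ)`.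
  have hlim := (ENNReal.continuous_ofReal.tendsto _).comp (ha.sub hb).abs
  refine le_of_tendsto hlim ?_
  filter_upwards [hdl.eventually (ge_mem_nhds hδ₀)] with n hn
  refine le_trans ?_ (hC (d n) (hd0 n) hn)
  simp only [Function.comp_apply]
  rw [← hh _ (hη n), hbn, ← neg_sub', abs_neg, ← integral_sub (i1 n) (i2 n), ← Real.norm_eq_abs,
    ofReal_norm]
  refine (enorm_integral_le_lintegral_enorm _).trans (lintegral_mono fun x => ?_)
  rw [← mul_sub, enorm_mul, mul_comm]
  gcongr
  rw [← ofReal_norm, ← ofReal_norm]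
  exact ENNReal.ofReal_le_ofReal (hT.norm_inner_le _ _)

/-- Green's formula for functions of bounded variation: the total mass of `σ · Du` is the flux of
`σ` weighted with the trace of `u`. -/
theorem IsUnitField.setIntegral_density_eq {ω : Set Plane} {T : Plane → Plane}
    (hT : IsUnitField ω T) (hω : IsOpen ω) (hωb : Bornology.IsBounded ω)
    (hL : HasLipschitzBoundary ω) {u : Plane → ℝ} (hu : IsBV ω u) {h : Plane → ℝ}
    (hhm : StronglyMeasurable h) (hh1 : ∀ x, ‖h x‖ ≤ 1)
    (hh : ∀ φ, IsTestFunction ω φ → -∫ x in ω, inner ℝ (T x) (gradient φ x) * u x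
      = ∫ x, h x * φ x ∂(gradientMeasure ω u).variation)
    {s : Plane → ℝ} (hsm : AEStronglyMeasurable s (boundaryMeasure ω))
    (hs1 : ∀ᵐ x ∂boundaryMeasure ω, ‖s x‖ ≤ 1)
    (hs : ∀ φ, IsTestFunction univ φ →
      ∫ x, inner ℝ (T x) (gradient φ x) = ∫ x, s x * φ x ∂boundaryMeasure ω) :
    ∫ x in ω, h x ∂(gradientMeasure ω u).variation
      = ∫ x, s x * trace ω u x ∂boundaryMeasure ω := by
  have := isFiniteMeasure_boundaryMeasure hω hωb hL
  obtain ⟨M, hM, hMu⟩ := exists_lintegral_gradient_innerCutoff_le hω hωb hL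
  have htr := integrable_trace hω hωb hL hu
  have key : ∀ η : ℝ, 0 < η → |(∫ x in ω, h x ∂(gradientMeasure ω u).variation)
      - ∫ x, s x * trace ω u x ∂boundaryMeasure ω| ≤ (2 * M.toReal + 1) * η := by
    intro η hη
    obtain ⟨φ, hφ, hφη⟩ := exists_isTestFunction_lintegral_sub_le hωb htr
      (ε := ENNReal.ofReal η) (by simpa using hη)
    have hφi : Integrable φ (boundaryMeasure ω) := hφ.integrable
    have h1 := hT.ofReal_abs_sub_le hω hωb hu hhm hh1 hh hφ (hMu u hu φ hφ η hη)
    rw [hs φ hφ] at h1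
    have h1' : ENNReal.ofReal |(∫ x in ω, h x ∂(gradientMeasure ω u).variation)
        - ∫ x, s x * φ x ∂boundaryMeasure ω| ≤ ENNReal.ofReal (M.toReal * (η + η)) := by
      refine h1.trans ?_
      rw [ENNReal.ofReal_mul ENNReal.toReal_nonneg, ENNReal.ofReal_toReal hM,
        ENNReal.ofReal_add hη.le hη.le]
      gcongr
    rw [ENNReal.ofReal_le_ofReal_iff (by positivity)] at h1'
    have i1 : Integrable (fun x => s x * φ x) (boundaryMeasure ω) := hφi.bdd_mul (c := 1) hsm hs1
    have i2 : Integrable (fun x => s x * trace ω u x) (boundaryMeasure ω) :=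
      htr.bdd_mul (c := 1) hsm hs1
    have h2 : |(∫ x, s x * φ x ∂boundaryMeasure ω)
        - ∫ x, s x * trace ω u x ∂boundaryMeasure ω| ≤ η := by
      rw [← integral_sub i1 i2, ← Real.norm_eq_abs]
      have h3 : ∫ x, ‖trace ω u x - φ x‖ ∂boundaryMeasure ω ≤ η := by
        have hm : AEStronglyMeasurable (fun x => trace ω u x - φ x) (boundaryMeasure ω) :=
          (htr.sub hφi).1
        rw [integral_norm_eq_lintegral_enorm hm]
        exact ENNReal.toReal_le_of_le_ofReal hη.le hφη
      refine (norm_integral_le_of_norm_le (htr.sub hφi).norm ?_).trans h3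
      filter_upwards [hs1] with x hx
      rw [← mul_sub, norm_mul, norm_sub_rev, Pi.sub_apply]
      exact mul_le_of_le_one_left (norm_nonneg _) hx
    have h3 := abs_sub_le (∫ x in ω, h x ∂(gradientMeasure ω u).variation)
      (∫ x, s x * φ x ∂boundaryMeasure ω) (∫ x, s x * trace ω u x ∂boundaryMeasure ω)
    linarith
  have hc : 0 < 2 * M.toReal + 1 := by positivity
  refine sub_eq_zero.1 (abs_eq_zero.1 (le_antisymm (le_of_forall_pos_le_add fun ε hε => ?_)
    (abs_nonneg _)))
  have := key (ε / (2 * M.toReal + 1)) (by positivity)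
  rwa [mul_div_cancel₀ _ hc.ne', ← zero_add ε] at this

/-! ### Duality -/

/-- The primal functional as a real number. -/
noncomputable def primalValue (ω : Set Plane) (u₀ u : Plane → ℝ) : ℝ :=
  ((gradientMeasure ω u).variation ω).toReal + ∫ x, |trace ω u x - u₀ x| ∂boundaryMeasure ω

section

variable {ω : Set Plane} {u₀ : Plane → ℝ}

theorem primalValue_nonneg (u : Plane → ℝ) : 0 ≤ primalValue ω u₀ u :=
  add_nonneg ENNReal.toReal_nonneg (integral_nonneg fun _ => abs_nonneg _)

/-- On `BV(ω)`, the functional is finite, so that nothing is lost in passing to real numbers. -/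
theorem primal_eq_ofReal (hω : IsOpen ω) (hωb : Bornology.IsBounded ω)
    (hL : HasLipschitzBoundary ω) (hu₀ : Integrable u₀ (boundaryMeasure ω)) {u : Plane → ℝ}
    (hu : IsBV ω u) : primal ω u₀ u = ENNReal.ofReal (primalValue ω u₀ u) := by
  have := hu.isFiniteMeasure
  have hi := (integrable_trace hω hωb hL hu).sub hu₀
  rw [primalValue, ENNReal.ofReal_add ENNReal.toReal_nonneg (integral_nonneg fun _ => abs_nonneg _),
    ENNReal.ofReal_toReal (measure_ne_top _ _), primal]
  congr 1
  exact (ofReal_integral_norm_eq_lintegral_enorm hi).symm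

theorem primal_le_primal_iff (hω : IsOpen ω) (hωb : Bornology.IsBounded ω)
    (hL : HasLipschitzBoundary ω) (hu₀ : Integrable u₀ (boundaryMeasure ω)) {u v : Plane → ℝ}
    (hu : IsBV ω u) (hv : IsBV ω v) :
    primal ω u₀ u ≤ primal ω u₀ v ↔ primalValue ω u₀ u ≤ primalValue ω u₀ v := by
  rw [primal_eq_ofReal hω hωb hL hu₀ hu, primal_eq_ofReal hω hωb hL hu₀ hv,
    ENNReal.ofReal_le_ofReal_iff (primalValue_nonneg v)]

/-- The duality gap is the sum of an integral over `ω`, with respect to `|Du|`, and an integral over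
the boundary, both with nonnegative integrands. -/
theorem exists_gap_eq (hω : IsOpen ω) (hωb : Bornology.IsBounded ω)
    (hL : HasLipschitzBoundary ω) (hu₀ : Integrable u₀ (boundaryMeasure ω)) {u : Plane → ℝ}
    (hu : IsBV ω u) {σ : Plane → Space} (hσ : IsAdmissible ω σ) :
    ∃ h : Plane → ℝ, StronglyMeasurable h ∧ (∀ x, ‖h x‖ ≤ 1) ∧
      (∀ B, MeasurableSet B → B ⊆ ω →
        pairingMeasure ω σ u B = ∫ x in B, h x ∂(gradientMeasure ω u).variation) ∧
      (∀ᵐ x ∂boundaryMeasure ω, ‖normalTrace ω σ x‖ ≤ 1) ∧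
      Integrable (fun x => |trace ω u x - u₀ x| - normalTrace ω σ x * (trace ω u x - u₀ x))
        (boundaryMeasure ω) ∧
      primalValue ω u₀ u - dual ω u₀ σ
        = (∫ x in ω, (1 + h x) ∂(gradientMeasure ω u).variation)
          + ∫ x, (|trace ω u x - u₀ x| - normalTrace ω σ x * (trace ω u x - u₀ x))
            ∂boundaryMeasure ω := by
  have := isFiniteMeasure_boundaryMeasure hω hωb hL
  have := hu.isFiniteMeasure
  obtain ⟨T, hT, hσT⟩ := hσ.exists_isUnitField hω.measurableSet
  obtain ⟨s, hsm, hs1, hs⟩ := hT.exists_normalTrace hω hωb hL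
  have hnt : IsNormalTrace ω σ s :=
    ⟨memLp_top_of_bound hsm.aestronglyMeasurable 1 (Eventually.of_forall hs1), fun φ hφ => by
      rw [hT.setIntegral_eq hσT, hs φ hφ]⟩
  have hae := hnt.normalTrace_ae_eq
  obtain ⟨h, hhm, hh1, hh, hpair⟩ := hT.exists_pairing_density hω hωb hu hσT
  have hgreen := hT.setIntegral_density_eq hω hωb hL hu hhm hh1 hh hsm.aestronglyMeasurable
    (Eventually.of_forall hs1) hs
  have htr := integrable_trace hω hωb hL hu
  have hnm : AEStronglyMeasurable (normalTrace ω σ) (boundaryMeasure ω) :=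
    ⟨s, hsm, hae⟩
  have hn1 : ∀ᵐ x ∂boundaryMeasure ω, ‖normalTrace ω σ x‖ ≤ 1 := by
    filter_upwards [hae] with x hx
    rw [hx]
    exact hs1 x
  have i1 : Integrable (fun x => |trace ω u x - u₀ x|) (boundaryMeasure ω) := (htr.sub hu₀).abs
  have i2 : Integrable (fun x => normalTrace ω σ x * (trace ω u x - u₀ x)) (boundaryMeasure ω) :=
    (htr.sub hu₀).bdd_mul (c := 1) hnm hn1
  have i3 : Integrable (fun x => normalTrace ω σ x * trace ω u x) (boundaryMeasure ω) :=
    htr.bdd_mul (c := 1) hnm hn1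
  have i4 : Integrable (fun x => normalTrace ω σ x * u₀ x) (boundaryMeasure ω) :=
    hu₀.bdd_mul (c := 1) hnm hn1
  have hhi : Integrable h (gradientMeasure ω u).variation :=
    Integrable.of_bound hhm.aestronglyMeasurable 1 (Eventually.of_forall hh1)
  refine ⟨h, hhm, hh1, hpair, hn1, i1.sub i2, ?_⟩
  rw [integral_sub i1 i2, integral_add (integrable_const _) hhi.integrableOn, hgreen]
  have e1 : ∫ x, normalTrace ω σ x * (trace ω u x - u₀ x) ∂boundaryMeasure ω
      = (∫ x, s x * trace ω u x ∂boundaryMeasure ω)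
        - ∫ x, normalTrace ω σ x * u₀ x ∂boundaryMeasure ω := by
    simp_rw [mul_sub]
    rw [integral_sub i3 i4]
    congr 1
    refine integral_congr_ae ?_
    filter_upwards [hae] with x hx
    rw [hx]
  rw [e1, primalValue, dual]
  simp only [integral_const, smul_eq_mul, mul_one, Measure.real, Measure.restrict_apply_univ]
  ring

theorem abs_sub_mul_nonneg {s w : ℝ} (hs : ‖s‖ ≤ 1) : 0 ≤ |w| - s * w := by
  have h1 : s * w ≤ |s| * |w| := (le_abs_self _).trans (abs_mul s w).le
  have h2 : |s| * |w| ≤ |w| := mul_le_of_le_one_left (abs_nonneg _) hs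
  linarith

theorem abs_sub_mul_eq_zero_iff {s w : ℝ} (hw : w ≠ 0) : |w| - s * w = 0 ↔ s = w / |w| := by
  have hw' : |w| ≠ 0 := abs_ne_zero.2 hw
  rw [eq_div_iff hw']
  rcases abs_choice w with h | h <;> rw [h]
  · constructor
    · intro h0
      linarith
    · intro h0
      linarith
  · constructor
    · intro h0
      have : w * (-1 - s) = 0 := by linarith
      rcases mul_eq_zero.1 this with h1 | h1
      · exact absurd h1 hw
      · nlinarith
    · intro h0
      linarith

/-- Weak duality. -/
theorem dual_le_primalValue (hω : IsOpen ω) (hωb : Bornology.IsBounded ω)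
    (hL : HasLipschitzBoundary ω) (hu₀ : Integrable u₀ (boundaryMeasure ω)) {u : Plane → ℝ}
    (hu : IsBV ω u) {σ : Plane → Space} (hσ : IsAdmissible ω σ) :
    dual ω u₀ σ ≤ primalValue ω u₀ u := by
  obtain ⟨h, _, hh1, _, hn1, _, hgap⟩ := exists_gap_eq hω hωb hL hu₀ hu hσ
  have h1 : 0 ≤ ∫ x in ω, (1 + h x) ∂(gradientMeasure ω u).variation :=
    integral_nonneg fun x => by
      have := (abs_le.1 (hh1 x)).1
      show 0 ≤ 1 + h x
      linarith
  have h2 : 0 ≤ ∫ x, (|trace ω u x - u₀ x| - normalTrace ω σ x * (trace ω u x - u₀ x))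
      ∂boundaryMeasure ω := by
    refine integral_nonneg_of_ae ?_
    filter_upwards [hn1] with x hx using abs_sub_mul_nonneg hx
  linarith

/-- The duality gap vanishes if and only if the optimality conditions hold. -/
theorem dual_eq_primalValue_iff (hω : IsOpen ω) (hωb : Bornology.IsBounded ω)
    (hL : HasLipschitzBoundary ω) (hu₀ : Integrable u₀ (boundaryMeasure ω)) {u : Plane → ℝ}
    (hu : IsBV ω u) {σ : Plane → Space} (hσ : IsAdmissible ω σ) :
    dual ω u₀ σ = primalValue ω u₀ u ↔
      ((∀ B : Set Plane, MeasurableSet B → B ⊆ ω →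
          -(pairingMeasure ω σ u B) = ((gradientMeasure ω u).variation B).toReal) ∧
        (∀ᵐ x ∂boundaryMeasure ω, trace ω u x ≠ u₀ x →
            normalTrace ω σ x = (trace ω u x - u₀ x) / |trace ω u x - u₀ x|)) := by
  have := hu.isFiniteMeasure
  obtain ⟨h, hhm, hh1, hpair, hn1, hint, hgap⟩ := exists_gap_eq hω hωb hL hu₀ hu hσ
  have hhi : Integrable h (gradientMeasure ω u).variation :=
    Integrable.of_bound hhm.aestronglyMeasurable 1 (Eventually.of_forall hh1)
  have hpos : ∀ x, 0 ≤ 1 + h x := fun x => by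
    have := (abs_le.1 (hh1 x)).1
    linarith
  have hset : ∀ B : Set Plane, ∫ x in B, (1 + h x) ∂(gradientMeasure ω u).variation
      = ((gradientMeasure ω u).variation B).toReal
        + ∫ x in B, h x ∂(gradientMeasure ω u).variation := fun B => by
    rw [integral_add (integrable_const _) hhi.integrableOn]
    simp [Measure.real]
  have h1 : 0 ≤ ∫ x in ω, (1 + h x) ∂(gradientMeasure ω u).variation :=
    integral_nonneg fun x => hpos x
  have hbd : 0 ≤ᵐ[boundaryMeasure ω]
      fun x => |trace ω u x - u₀ x| - normalTrace ω σ x * (trace ω u x - u₀ x) := by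
    filter_upwards [hn1] with x hx using abs_sub_mul_nonneg hx
  have h2 := integral_nonneg_of_ae hbd
  have hA : (∫ x in ω, (1 + h x) ∂(gradientMeasure ω u).variation = 0) ↔
      ∀ B : Set Plane, MeasurableSet B → B ⊆ ω →
        -(pairingMeasure ω σ u B) = ((gradientMeasure ω u).variation B).toReal := by
    constructor
    · intro h0 B hB hBω
      have h3 : ∫ x in B, (1 + h x) ∂(gradientMeasure ω u).variation = 0 := by
        refine le_antisymm ?_ (integral_nonneg fun x => hpos x)
        rw [← h0]
        exact setIntegral_mono_set ((integrable_const _).add hhi).integrableOn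
          (Eventually.of_forall hpos) hBω.eventuallyLE
      rw [hset] at h3
      rw [hpair B hB hBω]
      linarith
    · intro h0
      have h3 := h0 ω hω.measurableSet subset_rfl
      rw [hpair ω hω.measurableSet subset_rfl] at h3
      rw [hset]
      linarith
  have hB : (∫ x, (|trace ω u x - u₀ x| - normalTrace ω σ x * (trace ω u x - u₀ x))
      ∂boundaryMeasure ω = 0) ↔ ∀ᵐ x ∂boundaryMeasure ω, trace ω u x ≠ u₀ x →
        normalTrace ω σ x = (trace ω u x - u₀ x) / |trace ω u x - u₀ x| := by
    rw [integral_eq_zero_iff_of_nonneg_ae hbd hint]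
    refine eventually_congr (Eventually.of_forall fun x => ?_)
    rw [Pi.zero_apply]
    rcases eq_or_ne (trace ω u x) (u₀ x) with h | h
    · simp [h]
    · rw [abs_sub_mul_eq_zero_iff (sub_ne_zero.2 h)]
      exact ⟨fun h' _ => h', fun h' => h' h⟩
  rw [← hA, ← hB]
  constructor
  · intro h0
    rw [h0, sub_self] at hgap
    constructor <;> linarith
  · rintro ⟨h3, h4⟩
    linarith

theorem primalValue_of_isTestFunction (hω : IsOpen ω) (hL : HasLipschitzBoundary ω)
    {φ : Plane → ℝ} (hφ : IsTestFunction univ φ) :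
    primalValue ω u₀ φ
      = (∫ x in ω, ‖gradient φ x‖) + ∫ x, ‖φ x - u₀ x‖ ∂boundaryMeasure ω := by
  rw [primalValue, hφ.variation_gradientMeasure hω,
    integral_norm_eq_lintegral_enorm hφ.integrable_gradient.1]
  congr 1
  refine integral_congr_ae ?_
  filter_upwards [ae_restrict_mem isClosed_frontier.measurableSet] with x hx
  rw [trace_eq_of_isTestFunction hω hL hφ hx, Real.norm_eq_abs]

theorem planar_toSpace (v : Plane) : planar !₂[v 0, v 1, 0] = v := by
  ext i
  fin_cases i <;> rfl

theorem norm_toSpace (v : Plane) : ‖(!₂[v 0, v 1, 0] : Space)‖ = ‖v‖ := by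
  rw [EuclideanSpace.norm_eq, EuclideanSpace.norm_eq, Fin.sum_univ_two, Fin.sum_univ_three]
  simp

/-- Strong duality: if the primal functional is at least `m` on smooth functions, then the dual
functional takes the value `m`. By homogeneity, the linear form `(φ, c) ↦ m c` is dominated by
`∫_ω |∇φ| + ∫_{∂ω} |φ - c u₀|`; its densities are a field and its normal trace. -/
theorem exists_isAdmissible_dual_eq (hω : IsOpen ω) (hωb : Bornology.IsBounded ω)
    (hL : HasLipschitzBoundary ω) (hu₀ : Integrable u₀ (boundaryMeasure ω)) {m : ℝ} (hm0 : 0 ≤ m)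
    (hm : ∀ φ, IsTestFunction univ φ → m ≤ primalValue ω u₀ φ) :
    ∃ τ, IsAdmissible ω τ ∧ dual ω u₀ τ = m := by
  have := isFiniteMeasure_boundaryMeasure hω hωb hL
  have : IsFiniteMeasure (volume.restrict ω) := ⟨by simpa using hωb.measure_lt_top⟩
  let A : (testSpace univ × ℝ) →ₗ[ℝ] Plane → Plane :=
    (gradientₗ univ).comp (LinearMap.fst ℝ (testSpace univ) ℝ)
  let B : (testSpace univ × ℝ) →ₗ[ℝ] Plane → ℝ :=
    (testSpace univ).subtype.comp (LinearMap.fst ℝ (testSpace univ) ℝ)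
      - (LinearMap.toSpanSingleton ℝ (Plane → ℝ) u₀).comp (LinearMap.snd ℝ (testSpace univ) ℝ)
  let L : (testSpace univ × ℝ) →ₗ[ℝ] ℝ := m • LinearMap.snd ℝ (testSpace univ) ℝ
  have hA : ∀ p, A p = gradient (p.1 : Plane → ℝ) := fun p => rfl
  have hB : ∀ p x, B p x = (p.1 : Plane → ℝ) x - p.2 * u₀ x := fun p x => rfl
  have hLp : ∀ p, L p = m * p.2 := fun p => rfl
  have hAi : ∀ p, Integrable (A p) (volume.restrict ω) := fun p => p.1.2.integrable_gradient
  have hBi : ∀ p, Integrable (B p) (boundaryMeasure ω) := fun p =>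
    p.1.2.integrable.sub (hu₀.const_mul p.2)
  have hle : ∀ p, L p ≤ (∫ x in ω, ‖A p x‖) + ∫ x, ‖B p x‖ ∂boundaryMeasure ω := by
    rintro ⟨φ, c⟩
    rcases eq_or_ne c 0 with rfl | hc
    · rw [hLp, mul_zero]
      exact add_nonneg (integral_nonneg fun _ => norm_nonneg _)
        (integral_nonneg fun _ => norm_nonneg _)
    -- The case `c ≠ 0` is the hypothesis for `φ / c`, multiplied by `|c|`.
    · have ht : IsTestFunction univ (c⁻¹ • (φ : Plane → ℝ)) := φ.2.const_smul c⁻¹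
      have h1 := hm _ ht
      rw [primalValue_of_isTestFunction hω hL ht] at h1
      have h2 := mul_le_mul_of_nonneg_left h1 (abs_nonneg c)
      have hcc : |c| ≠ 0 := abs_ne_zero.2 hc
      have e1 : ∀ x, |c| * ‖gradient (c⁻¹ • (φ : Plane → ℝ)) x‖ = ‖A (φ, c) x‖ := fun x => by
        rw [hA, gradient_const_smul' (φ.2.differentiable x), norm_smul, norm_inv, Real.norm_eq_abs,
          mul_inv_cancel_left₀ hcc]
      have e2 : ∀ x, |c| * ‖(c⁻¹ • (φ : Plane → ℝ)) x - u₀ x‖ = ‖B (φ, c) x‖ := fun x => by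
        rw [hB, ← Real.norm_eq_abs, ← norm_mul, mul_sub, Pi.smul_apply, smul_eq_mul,
          mul_inv_cancel_left₀ hc]
      rw [mul_add, ← integral_const_mul, ← integral_const_mul] at h2
      simp_rw [e1, e2] at h2
      refine le_trans ?_ h2
      rw [hLp, mul_comm]
      exact mul_le_mul_of_nonneg_right (le_abs_self c) hm0
  obtain ⟨g, s, hgm, hg1, hsm, hs1, hgs⟩ := exists_density_pair A B hAi hBi L hle
  -- At `c = 0` the form vanishes: `s` is the normal trace of the field `-g`.
  have h0 : ∀ φ, IsTestFunction univ φ → ∫ x in ω, inner ℝ (-(g x)) (gradient φ x)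
      = ∫ x, s x * φ x ∂boundaryMeasure ω := fun φ hφ => by
    have h1 := hgs (⟨φ, hφ⟩, 0)
    rw [hLp, mul_zero] at h1
    simp only [hA, hB, zero_mul, sub_zero] at h1
    simp only [inner_neg_left, integral_neg]
    have e : ∀ x, inner ℝ (s x) (φ x) = s x * φ x := fun x => by simp [mul_comm]
    simp_rw [e] at h1
    linarith
  have hcont : Continuous fun v : Plane => (!₂[v 0, v 1, 0] : Space) := by
    refine (PiLp.continuous_toLp 2 _).comp (continuous_pi fun i => ?_)
    fin_cases i <;> simp <;> fun_prop
  let τ : Plane → Space := fun x => !₂[(-(g x)) 0, (-(g x)) 1, 0]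
  have hτp : ∀ x, planar (τ x) = -(g x) := fun x => planar_toSpace _
  have hτ1 : ∀ x, ‖τ x‖ ≤ 1 := fun x => by
    rw [show ‖τ x‖ = ‖-(g x)‖ from norm_toSpace _, norm_neg]
    exact hg1 x
  have hτm : StronglyMeasurable τ := hcont.comp_stronglyMeasurable hgm.neg
  have hτ : IsAdmissible ω τ :=
    ⟨memLp_top_of_bound hτm.aestronglyMeasurable 1 (Eventually.of_forall hτ1), fun φ hφ => by
      simp_rw [hτp]
      rw [h0 φ (hφ.mono (subset_univ _))]
      refine integral_eq_zero_of_ae ?_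
      filter_upwards [ae_restrict_mem isClosed_frontier.measurableSet] with x hx
      rw [hφ.eq_zero_of_notMem fun hxω => ?_, mul_zero, Pi.zero_apply]
      rw [hω.frontier_eq] at hx
      exact hx.2 hxω, Eventually.of_forall hτ1⟩
  have hnt : IsNormalTrace ω τ s :=
    ⟨memLp_top_of_bound hsm.aestronglyMeasurable 1 (Eventually.of_forall hs1), fun φ hφ => by
      simp_rw [hτp]
      exact h0 φ hφ⟩
  refine ⟨τ, hτ, ?_⟩
  -- At `φ = 0` and `c = 1` the representation is `m = -∫ s u₀`.
  have h1 := hgs (0, 1)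
  rw [hLp, mul_one] at h1
  have e1 : ∀ x, A (0, 1) x = 0 := fun x => by
    rw [show A (0, 1) = 0 from map_zero (gradientₗ univ), Pi.zero_apply]
  have e2 : ∀ x, inner ℝ (s x) (B (0, 1) x) = -(s x * u₀ x) := fun x => by
    rw [hB]
    simp [mul_comm]
  simp_rw [e1, e2, inner_zero_right] at h1
  rw [integral_zero, zero_add, integral_neg] at h1
  rw [h1, dual, integral_congr_ae]
  filter_upwards [hnt.normalTrace_ae_eq] with x hx
  rw [hx]

end

end LeastGradient

theorem proposition4p3
    (ω : Set LeastGradient.Plane) (hω : IsOpen ω) (hωb : Bornology.IsBounded ω)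
    (hωL : LeastGradient.HasLipschitzBoundary ω)
    (u₀ : LeastGradient.Plane → ℝ) (hu₀ : Integrable u₀ (LeastGradient.boundaryMeasure ω))
    (u : LeastGradient.Plane → ℝ) (hu : LeastGradient.IsBV ω u)
    (σ : LeastGradient.Plane → LeastGradient.Space)
    (hσ : MemLp σ ∞ (volume.restrict ω))
    (hdiv : LeastGradient.IsDivFree ω σ)
    (hσ1 : ∀ᵐ x ∂volume.restrict ω, ‖σ x‖ ≤ 1) :
    (LeastGradient.IsExtremalPrimal ω u₀ u ∧ LeastGradient.IsExtremalDual ω u₀ σ) ↔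
      ((∀ B : Set LeastGradient.Plane, MeasurableSet B → B ⊆ ω →
          -(LeastGradient.pairingMeasure ω σ u B) =
            ((LeastGradient.gradientMeasure ω u).variation B).toReal) ∧
        (∀ᵐ x ∂LeastGradient.boundaryMeasure ω,
          LeastGradient.trace ω u x ≠ u₀ x →
            LeastGradient.normalTrace ω σ x =
              (LeastGradient.trace ω u x - u₀ x) / |LeastGradient.trace ω u x - u₀ x|)) := by
  have hadm : LeastGradient.IsAdmissible ω σ := ⟨hσ, hdiv, hσ1⟩
  rw [← LeastGradient.dual_eq_primalValue_iff hω hωb hωL hu₀ hu hadm]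
  have hweak := fun {v} (hv : LeastGradient.IsBV ω v) {τ} (hτ : LeastGradient.IsAdmissible ω τ) =>
    LeastGradient.dual_le_primalValue hω hωb hωL hu₀ hv hτ
  constructor
  · rintro ⟨⟨-, hmin⟩, -, hmax⟩
    obtain ⟨τ, hτ, hτu⟩ := LeastGradient.exists_isAdmissible_dual_eq hω hωb hωL hu₀
      (LeastGradient.primalValue_nonneg u) fun φ hφ =>
        (LeastGradient.primal_le_primal_iff hω hωb hωL hu₀ hu (hφ.isBV)).1
          (hmin φ (hφ.isBV))
    exact le_antisymm (hweak hu hadm) (hτu ▸ hmax τ hτ)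
  · intro h
    exact ⟨⟨hu, fun v hv => (LeastGradient.primal_le_primal_iff hω hωb hωL hu₀ hu hv).2
      (h ▸ hweak hv hadm)⟩, hadm, fun τ hτ => h ▸ hweak hu hτ⟩
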